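/- Let $2\le k\le n$ be integers, let $\sigma_m(\lambda)=\sum_{i_1<\dots<i_m}\lambda_{i_1}\cdots\lambda_{i_m}$ be the elementary symmetric functions on $\mathbb{R}^n$, and let $\overline\Gamma_k$ be the closure of the Gårding cone $\Gamma_k=\{\lambda\in\mathbb{R}^n:\sigma_m(\lambda)>0,\ m=1,\dots,k\}$. A $C^2$ function (respectively a $C^{1,1}$ function) $v$ is called $k$-convex in $\Omega$ if the eigenvalue vector $\lambda(D^2v(x))$ lies in $\overline\Gamma_k$ for every (respectively almost every) $x\in\Omega$. Let $\Omega\subset\mathbb{R}^n$ be a bounded domain, let $f>0$ satisfy $f^{1/(k-1)}\in C^{1,1}(\overline\Omega\times\mathbb{R})$, and let $u\in C^4(\overline\Omega)$ be a $k$-convex solution of the Dirichlet problem $$\sigma_k(\lambda(D^2u))=f(x,u)\ \text{ in }\Omega,\qquad u=\varphi\ \text{ on }\partial\Omega .$$ Assume that $\overline u\in C^{1,1}(\overline\Omega)$ is $k$-convex in $\Omega$ and that $$\overline u\ge u\ \text{ in }\Omega,\qquad \overline u=u\ \text{ on }\partial\Omega .$$ Then $$(\overline u-u)^{\alpha}\,|D^2u|\le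 C\quad\text{in }\Omega,$$ where $\alpha=k-1$ if $k>2$ and $\alpha=2$ if $k=2$. The constant $C$ depends only on $n$, $k$ and upper bounds for $\operatorname{diam}\Omega$, $\|u\|_{C^1(\overline\Omega)}$, $\|\overline u\|_{C^{1,1}(\overline\Omega)}$ and $\|f^{1/(k-1)}\|_{C^{1,1}(\overline\Omega\times[\inf_\Omega u,\,\sup_\Omega u])}$; in particular, it does not depend on a positive lower bound of $f$. -/

import Mathlib

open MeasureTheory Set
open scoped NNReal ENNReal

noncomputable section

namespace HessianPogorelov

/-- The `m`-th elementary symmetric function `σ_m` on `ℝⁿ`. -/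
def sigma {n : ℕ} (m : ℕ) (l : Fin n → ℝ) : ℝ :=
  ∑ s ∈ Finset.powersetCard m (Finset.univ : Finset (Fin n)), ∏ i ∈ s, l i

/-- Gårding's (open) cone `Γ_k`. -/
def gardingCone (n k : ℕ) : Set (Fin n → ℝ) :=
  {l | ∀ m : ℕ, 1 ≤ m → m ≤ k → 0 < sigma m l}

/-- The Hessian matrix `D²v(x) = (v_{ij}(x))`. -/
def hessian {n : ℕ} (v : EuclideanSpace ℝ (Fin n) → ℝ) (x : EuclideanSpace ℝ (Fin n)) :
    Matrix (Fin n) (Fin n) ℝ :=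
  Matrix.of fun i j =>
    fderiv ℝ (fderiv ℝ v) x (EuclideanSpace.single i 1) (EuclideanSpace.single j 1)

open Classical in
/-- The eigenvalues `λ(A)` of a real symmetric matrix, with multiplicity. (The value on
non-symmetric matrices plays no role: the Hessian is symmetric at every point of an open set where
the function is `C²`, and almost everywhere if the gradient is Lipschitz.) -/
def eigenvalues {n : ℕ} (A : Matrix (Fin n) (Fin n) ℝ) : Fin n → ℝ :=
  if h : A.IsHermitian then h.eigenvalues else 0

/-- The Euclidean (Frobenius) norm `|D²v(x)|`. -/
def hessianNorm {n : ℕ} (v : EuclideanSpace ℝ (Fin n) → ℝ) (x : EuclideanSpace ℝ (Fin n)) : ℝ :=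
  Real.sqrt (∑ i, ∑ j, hessian v x i j ^ 2)

/-- `k`-convexity of a `C²` function on `Ω`: `λ(D²v(x))` lies in the closure of `Γ_k` for every
`x ∈ Ω`. -/
def IsKConvexOn {n : ℕ} (k : ℕ) (v : EuclideanSpace ℝ (Fin n) → ℝ)
    (Ω : Set (EuclideanSpace ℝ (Fin n))) : Prop :=
  ∀ x ∈ Ω, eigenvalues (hessian v x) ∈ closure (gardingCone n k)

/-- `k`-convexity of a `C^{1,1}` function on `Ω`: its Hessian exists almost everywhere, and
`λ(D²v(x))` lies in the closure of `Γ_k` for almost every `x ∈ Ω`. -/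
def IsKConvexAEOn {n : ℕ} (k : ℕ) (v : EuclideanSpace ℝ (Fin n) → ℝ)
    (Ω : Set (EuclideanSpace ℝ (Fin n))) : Prop :=
  ∀ᵐ x ∂(volume.restrict Ω),
    DifferentiableAt ℝ (fderiv ℝ v) x ∧
      eigenvalues (hessian v x) ∈ closure (gardingCone n k)

section Norms

variable {E : Type*} [NormedAddCommGroup E] [NormedSpace ℝ E]

/-- The `C¹` norm `sup |w| + sup |Dw|` over `S`, as an extended nonnegative number. -/
def c1Norm (w : E → ℝ) (S : Set E) : ℝ≥0∞ :=
  (⨆ x ∈ S, ‖w x‖ₑ) + ⨆ x ∈ S, ‖fderiv ℝ w x‖ₑ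

/-- The `C^{1,1}` norm over `S`: the `C¹` norm plus the least Lipschitz constant of `Dw` on `S`
(in `ℝ≥0∞` one has `0 / 0 = 0`, so the diagonal does not contribute). -/
def c11Norm (w : E → ℝ) (S : Set E) : ℝ≥0∞ :=
  c1Norm w S + ⨆ x ∈ S, ⨆ y ∈ S, edist (fderiv ℝ w x) (fderiv ℝ w y) / edist x y

/-- `w ∈ C^{1,1}(closure U)` for an open set `U`. (A Lipschitz gradient on `U` extends
continuously to the closure.) -/
def MemC11 (w : E → ℝ) (U : Set E) : Prop :=
  ContDiffOn ℝ 1 w U ∧ ContinuousOn w (closure U) ∧ c11Norm w U < ∞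

/-- `w ∈ C^r(closure U)` for an open set `U`: `w` is `C^r` in `U`, and all derivatives of order at
most `r` extend continuously to the closure of `U`. -/
def MemCUpTo (r : ℕ) (w : E → ℝ) (U : Set E) : Prop :=
  ContDiffOn ℝ r w U ∧ ContinuousOn w (closure U) ∧
    ∀ m : ℕ, m ≤ r → ∃ g : E → ContinuousMultilinearMap ℝ (fun _ : Fin m => E) ℝ,
      ContinuousOn g (closure U) ∧ EqOn (iteratedFDeriv ℝ m w) g U

end Norms

/-- The function `f^{1/(k-1)}` of `(x, z)`. -/
def rootRHS {n : ℕ} (k : ℕ) (f : EuclideanSpace ℝ (Fin n) → ℝ → ℝ) :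
    EuclideanSpace ℝ (Fin n) × ℝ → ℝ :=
  fun p => f p.1 p.2 ^ (1 / ((k : ℝ) - 1))

/-- `f^{1/(k-1)} ∈ C^{1,1}(closure Ω × ℝ)`, where `C^{1,1}` is understood locally in the unbounded
variable `z`, that is, on `closure Ω × [-r, r]` for every `r`. -/
def RootIsC11 {n : ℕ} (k : ℕ) (f : EuclideanSpace ℝ (Fin n) → ℝ → ℝ)
    (Ω : Set (EuclideanSpace ℝ (Fin n))) : Prop :=
  ∀ r : ℝ, 0 < r → MemC11 (rootRHS k f) (Ω ×ˢ Ioo (-r) r)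

/-- `u` solves the Dirichlet problem `σ_k(λ(D²u)) = f(x, u)` in `Ω`, `u = φ` on `∂Ω`. -/
def SolvesDirichlet {n : ℕ} (k : ℕ) (f : EuclideanSpace ℝ (Fin n) → ℝ → ℝ)
    (φ : EuclideanSpace ℝ (Fin n) → ℝ) (u : EuclideanSpace ℝ (Fin n) → ℝ)
    (Ω : Set (EuclideanSpace ℝ (Fin n))) : Prop :=
  (∀ x ∈ Ω, sigma k (eigenvalues (hessian u x)) = f x (u x)) ∧ ∀ x ∈ frontier Ω, u x = φ x

/-- The exponent `α`: `2` for `k = 2` and `k - 1` for `k > 2`. -/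
def pogorelovExponent (k : ℕ) : ℕ := if k = 2 then 2 else k - 1

end HessianPogorelov

end

/-! Write `k = j + 2`, `h = f^{1/(k-1)}`, `W = ubar - u` and `F_i = ∂σ_k/∂λ_i`. Following Pogorelov,
one maximizes `W^α · D²u(v,v) · exp(B/2 |Du|² + A/2 |x-z|²)` over points and unit vectors
(`exists_max_point`). It then suffices to bound `W^α Λ` at a maximum point, `Λ` being the largest
eigenvalue there. The heart is `max_point_estimate`: unless `W^α Λ` is bounded for elementary
reasons, `W Λ^{1/(k-1)} ≤ C` there. Three difficulties shape the argument.

The function `ubar` is only `C^{1,1}`, so its Hessian may not exist at the maximum point. Solving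
the maximality inequality for `ubar` shows that `ubar` is touched from above by the smooth function
`u + w`, where `w` is an explicit power of the remaining factors. Since `D² ubar` lies in the closed
Gårding cone almost everywhere and the gradient of `σ_k` pairs nonnegatively with that cone, `ubar`
is a subsolution of the linear operator with frozen coefficients `F_i`. `viscosity_subsolution`
transfers this to the touching function, and `touching_estimate` reads off the first and second
order conditions.

No positive lower bound of `f` may enter. All error terms must therefore be multiples of `h^{k-2}`,
to be compared with `∑ F_i ≥ Λ^{1/(k-1)} h^{k-2}`, which comes from the Maclaurin-type inequality
`Cone.maclaurin`. Differentiating `σ_k = h^{k-1}` twice produces the dangerous term `(k-1)(k-2)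
h^{k-3} h₁²`. The concavity of `(σ_k/ℓ)^{1/(k-1)}`, with `ℓ` the sum of the eigenvalues outside
`k-2` indices (`Cone.log_concave`), cancels exactly this term. The price is a term containing the
third derivatives `u_{11p}` with `p` outside those indices, taken as `u_{pp1}`.

These third derivatives are paid for by letting the direction `v` rotate with `x` (`frameField`),
which gains `-2 u_{pp1}²/(nΛ²)` in the direction `p`. The gain is effective because, for the late
indices `p`, `F_p` is comparable with `∑ F_i` (`exists_gradient_lower_bound`). The terms `u_{11i}²`
are absorbed by the mixed part of the second derivative of `σ_k`. This uses `1 + 1/α ≤ 3/2 < 2`,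
hence `α ≥ 2`, while the final inequality needs `α ≥ k-1`; both requirements together give the
stated exponent. -/

noncomputable section

namespace HessianPogorelov

/-! ### Elementary symmetric functions and Newton's inequality -/

section ElementarySymmetric

variable {ι : Type*}

/-- The elementary symmetric function of degree `m` in the variables indexed by `s`. -/
def es (s : Finset ι) (m : ℕ) (l : ι → ℝ) : ℝ :=
  ∑ t ∈ Finset.powersetCard m s, ∏ i ∈ t, l i

theorem sigma_eq_es {n : ℕ} (m : ℕ) (l : Fin n → ℝ) : sigma m l = es Finset.univ m l := rfl

@[simp] theorem es_zero (s : Finset ι) (l : ι → ℝ) : es s 0 l = 1 := by simp [es]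

theorem es_eq_zero {s : Finset ι} {m : ℕ} (h : s.card < m) (l : ι → ℝ) : es s m l = 0 := by
  simp [es, Finset.powersetCard_eq_empty.2 h]

theorem es_one (s : Finset ι) (l : ι → ℝ) : es s 1 l = ∑ i ∈ s, l i := by
  simp [es, Finset.powersetCard_one]

theorem continuous_es (s : Finset ι) (m : ℕ) : Continuous (es s m) := by
  unfold es; fun_prop

theorem es_smul (s : Finset ι) (m : ℕ) (c : ℝ) (l : ι → ℝ) :
    es s m (c • l) = c ^ m * es s m l := by
  unfold es
  rw [Finset.mul_sum]
  refine Finset.sum_congr rfl fun t ht => ?_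
  rw [Finset.mem_powersetCard] at ht
  simp [Finset.prod_mul_distrib, ht.2]

theorem es_eq_coeff (s : Finset ι) (m j : ℕ) (l : ι → ℝ) (h : m + j = s.card) :
    es s m l = (∏ i ∈ s, (Polynomial.X + Polynomial.C (l i))).coeff j := by
  rw [Finset.prod_X_add_C_coeff s l (by omega), show s.card - j = m by omega]; rfl

section Newton

open Polynomial

/-- Rolle's theorem with multiplicities: differentiation loses at most one real root, and the degree
drops by at least one. -/
theorem splits_derivative {p : ℝ[X]} (hp : p.Splits) : (derivative p).Splits := by
  rw [splits_iff_card_roots] at hp ⊢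
  have h1 := card_roots_le_derivative p
  have h2 := (derivative p).card_roots'
  rcases Nat.eq_zero_or_pos p.natDegree with h | h
  · rw [eq_C_of_natDegree_eq_zero h]; simp
  · have h3 : (derivative p).natDegree < p.natDegree := natDegree_derivative_lt (by omega)
    omega

theorem splits_iterate_derivative {p : ℝ[X]} (hp : p.Splits) (j : ℕ) :
    (derivative^[j] p).Splits := by
  induction j with
  | zero => exact hp
  | succ j ih => rw [Function.iterate_succ_apply']; exact splits_derivative ih

/-- This is `p'² - p p'' ≥ 0` at the origin for a real-rooted `p`. Multiplication by `X - a` turns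
the defect `c₁² - 2 c₀ c₂` into `c₀² + a² (c₁² - 2 c₀ c₂)`, which makes the induction immediate. -/
theorem coeff_one_sq_ge_of_splits {p : ℝ[X]} (hp : p.Splits) :
    2 * p.coeff 0 * p.coeff 2 ≤ p.coeff 1 ^ 2 := by
  have key : ∀ s : Multiset ℝ, 2 * ((s.map fun x => X - C x).prod).coeff 0 *
      ((s.map fun x => X - C x).prod).coeff 2 ≤ ((s.map fun x => X - C x).prod).coeff 1 ^ 2 := by
    intro s
    induction s using Multiset.induction_on with
    | empty => simp [coeff_one]
    | cons a s ih =>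
      rw [Multiset.map_cons, Multiset.prod_cons]
      set q := (s.map fun x => X - C x).prod
      have e0 : ((X - C a) * q).coeff 0 = - a * q.coeff 0 := by simp [sub_mul]
      have e1 : ((X - C a) * q).coeff 1 = q.coeff 0 - a * q.coeff 1 := by
        simp [sub_mul, coeff_X_mul q 0]
      have e2 : ((X - C a) * q).coeff 2 = q.coeff 1 - a * q.coeff 2 := by
        simp [sub_mul, coeff_X_mul q 1]
      rw [e0, e1, e2]
      nlinarith [sq_nonneg (q.coeff 0), mul_le_mul_of_nonneg_left ih (sq_nonneg a)]
  rw [hp.eq_prod_roots]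
  simp only [coeff_C_mul]
  nlinarith [mul_le_mul_of_nonneg_left (key p.roots) (sq_nonneg p.leadingCoeff)]

/-- Newton's inequality, in its weak form, for arbitrary real arguments. -/
theorem newton (s : Finset ι) (m : ℕ) (l : ι → ℝ) :
    es s m l * es s (m + 2) l ≤ es s (m + 1) l ^ 2 := by
  rcases lt_or_ge s.card (m + 2) with h | h
  · rw [es_eq_zero h]; nlinarith [sq_nonneg (es s (m + 1) l)]
  obtain ⟨j, hj⟩ := Nat.exists_eq_add_of_le h
  set p : ℝ[X] := ∏ i ∈ s, (X + C (l i)) with hp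
  have hs : p.Splits := Splits.prod fun i _ => Splits.X_add_C _
  -- Differentiating `j` times moves the three consecutive coefficients `j, j+1, j+2`, that is
  -- `σ_{m+2}, σ_{m+1}, σ_m`, to the bottom of a polynomial that is still real-rooted. The
  -- descending factorials give the factor `(j+2)/(j+1) ≥ 1`, which is discarded at the end.
  have h3 := coeff_one_sq_ge_of_splits (splits_iterate_derivative hs j)
  simp only [coeff_iterate_derivative, nsmul_eq_mul] at h3
  rw [← es_eq_coeff s (m + 2) (0 + j) l (by omega), ← es_eq_coeff s (m + 1) (1 + j) l (by omega),
    ← es_eq_coeff s m (2 + j) l (by omega)] at h3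
  rcases le_or_gt (es s m l * es s (m + 2) l) 0 with h0 | h0
  · exact h0.trans (sq_nonneg _)
  have d0 : (Nat.descFactorial (0 + j) j : ℝ) = j.factorial := by
    simp [Nat.descFactorial_self]
  have d1 : (Nat.descFactorial (1 + j) j : ℝ) = (j + 1) * j.factorial := by
    have := Nat.factorial_mul_descFactorial (n := 1 + j) (k := j) (by omega)
    rw [show 1 + j - j = 1 by omega, Nat.factorial_one, one_mul, add_comm 1 j,
      Nat.factorial_succ] at this
    rw [add_comm 1 j, this]; push_cast; ring
  have d2 : 2 * (Nat.descFactorial (2 + j) j : ℝ) = (j + 2) * (j + 1) * j.factorial := by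
    have := Nat.factorial_mul_descFactorial (n := 2 + j) (k := j) (by omega)
    rw [show 2 + j - j = 2 by omega, Nat.factorial_two, add_comm 2 j, Nat.factorial_succ,
      Nat.factorial_succ] at this
    rw [add_comm 2 j]; exact_mod_cast (by rw [this]; ring)
  rw [d0, d1] at h3
  have hf : (0 : ℝ) < j.factorial := by exact_mod_cast j.factorial_pos
  have h4 : (j.factorial : ℝ) ^ 2 * (j + 1) * ((j + 2) * (es s m l * es s (m + 2) l)) ≤
      (j.factorial : ℝ) ^ 2 * (j + 1) * ((j + 1) * es s (m + 1) l ^ 2) := by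
    calc _ = (j.factorial * es s (m + 2) l) *
          (((j + 2) * (j + 1) * j.factorial) * es s m l) := by ring
      _ ≤ _ := by rw [← d2]; nlinarith [h3]
  have h5 := le_of_mul_le_mul_left h4 (by positivity)
  have h6 : ((j : ℝ) + 1) * (es s m l * es s (m + 2) l) ≤ (j + 1) * es s (m + 1) l ^ 2 := by
    nlinarith
  exact le_of_mul_le_mul_left h6 (by positivity)

end Newton

variable [DecidableEq ι]

theorem es_insert {s : Finset ι} {i : ι} (hi : i ∉ s) (m : ℕ) (l : ι → ℝ) :
    es (insert i s) (m + 1) l = l i * es s m l + es s (m + 1) l := by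
  unfold es
  rw [Finset.powersetCard_succ_insert hi, Finset.sum_union, add_comm, Finset.sum_image,
    Finset.mul_sum]
  · congr 1
    refine Finset.sum_congr rfl fun t ht => ?_
    rw [Finset.prod_insert fun h => hi ((Finset.mem_powersetCard.1 ht).1 h)]
  · intro a ha b hb hab
    have ha' : i ∉ a := fun h => hi ((Finset.mem_powersetCard.1 ha).1 h)
    have hb' : i ∉ b := fun h => hi ((Finset.mem_powersetCard.1 hb).1 h)
    rw [← Finset.erase_insert ha', ← Finset.erase_insert hb', hab]
  · rw [Finset.disjoint_left]
    intro t ht ht'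
    obtain ⟨t', -, rfl⟩ := Finset.mem_image.1 ht'
    exact hi ((Finset.mem_powersetCard.1 ht).1 (Finset.mem_insert_self _ _))

theorem es_erase {s : Finset ι} {i : ι} (hi : i ∈ s) (m : ℕ) (l : ι → ℝ) :
    es s (m + 1) l = l i * es (s.erase i) m l + es (s.erase i) (m + 1) l := by
  conv_lhs => rw [← Finset.insert_erase hi]
  exact es_insert (Finset.notMem_erase i s) m l

/-- Euler's identity for the elementary symmetric functions. -/
theorem sum_mul_es_erase (s : Finset ι) (m : ℕ) (l : ι → ℝ) :
    ∑ i ∈ s, l i * es (s.erase i) m l = (m + 1) * es s (m + 1) l := by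
  induction s using Finset.induction_on generalizing m with
  | empty => simp [es_eq_zero (s := (∅ : Finset ι)) (m := m + 1) (by simp)]
  | insert a s ha ih =>
    rw [Finset.sum_insert ha, Finset.erase_insert ha]
    have h : ∀ i ∈ s, (insert a s).erase i = insert a (s.erase i) := fun i hi =>
      Finset.erase_insert_of_ne (fun h => ha (h ▸ hi))
    rw [Finset.sum_congr rfl fun i hi => by rw [h i hi]]
    have ha' : ∀ i, a ∉ s.erase i := fun i h => ha (Finset.mem_of_mem_erase h)
    cases m with
    | zero =>
      have := ih 0
      simp only [es_zero, mul_one] at this ⊢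
      rw [es_insert ha, this]; simp
    | succ m =>
      have h2 : ∀ i ∈ s, l i * es (insert a (s.erase i)) (m + 1) l =
          l a * (l i * es (s.erase i) m l) + l i * es (s.erase i) (m + 1) l := fun i _ => by
        rw [es_insert (ha' i)]; ring
      rw [Finset.sum_congr rfl h2, Finset.sum_add_distrib, ← Finset.mul_sum, ih, ih, es_insert ha]
      push_cast; ring

theorem sum_es_erase (s : Finset ι) (m : ℕ) (l : ι → ℝ) :
    ∑ i ∈ s, es (s.erase i) m l = ((s.card : ℝ) - m) * es s m l := by
  cases m with
  | zero => simp
  | succ m =>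
    have h : ∀ i ∈ s, es (s.erase i) (m + 1) l = es s (m + 1) l - l i * es (s.erase i) m l :=
      fun i hi => by rw [es_erase hi]; ring
    rw [Finset.sum_congr rfl h, Finset.sum_sub_distrib, sum_mul_es_erase]
    simp only [Finset.sum_const, nsmul_eq_mul]
    push_cast; ring

end ElementarySymmetric

/-! ### Gårding's cone: Maclaurin inequality, convexity, superadditive quotients -/

section Cone

variable {ι : Type*}

/-- Gårding's cone in the variables indexed by `s`. -/
def Cone (s : Finset ι) (k : ℕ) (l : ι → ℝ) : Prop := ∀ m ≤ k, 0 < es s m l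

theorem Cone.mono {s : Finset ι} {k k' : ℕ} {l : ι → ℝ} (h : Cone s k l) (hk : k' ≤ k) :
    Cone s k' l := fun m hm => h m (hm.trans hk)

theorem mem_gardingCone_iff {n k : ℕ} {l : Fin n → ℝ} :
    l ∈ gardingCone n k ↔ Cone Finset.univ k l := by
  constructor
  · intro h m hm
    rcases Nat.eq_zero_or_pos m with rfl | hm0
    · simp
    · exact h m hm0 hm
  · intro h m _ hm
    exact h m hm

theorem Cone.smul {s : Finset ι} {k : ℕ} {l : ι → ℝ} (h : Cone s k l) {c : ℝ} (hc : 0 < c) :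
    Cone s k (c • l) := fun m hm => by
  rw [es_smul]; have := h m hm; positivity

theorem isOpen_cone (s : Finset ι) (k : ℕ) : IsOpen {l | Cone s k l} := by
  have : {l | Cone s k l} = ⋂ m ∈ Finset.range (k + 1), {l | 0 < es s m l} := by
    ext l; simp [Cone]
  rw [this]
  exact isOpen_biInter_finset fun m _ => isOpen_lt continuous_const (continuous_es s m)

theorem Cone.quotient_anti {s : Finset ι} {k : ℕ} {x : ι → ℝ} (hx : Cone s (k + 1) x) :
    es s (k + 2) x / es s (k + 1) x ≤ es s (k + 1) x / es s k x := by
  rw [div_le_div_iff₀ (hx _ le_rfl) (hx _ (by omega))]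
  have := newton s k x
  linarith

/-- Maclaurin-type inequality `σ_1 σ_k^{k-2} ≤ σ_{k-1}^{k-1}`, with `k = j + 2`. -/
theorem Cone.maclaurin {s : Finset ι} {j : ℕ} {x : ι → ℝ} (hx : Cone s (j + 2) x) :
    es s 1 x * es s (j + 2) x ^ j ≤ es s (j + 1) x ^ (j + 1) := by
  set q := es s (j + 2) x / es s (j + 1) x with hq
  have hq0 : 0 < q := div_pos (hx _ le_rfl) (hx _ (by omega))
  have hmono : ∀ i ≤ j, q ≤ es s (j - i + 2) x / es s (j - i + 1) x := by
    intro i hi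
    induction i with
    | zero => exact le_rfl
    | succ i ih =>
      refine (ih (by omega)).trans ?_
      have := (hx.mono (show j - (i + 1) + 1 + 1 ≤ j + 2 by omega)).quotient_anti
      rwa [show j - (i + 1) + 1 + 2 = j - i + 2 by omega, show j - (i + 1) + 1 + 1 =
        j - (i + 1) + 2 by omega, show es s (j - i + 2) x / es s (j - (i + 1) + 2) x =
        es s (j - i + 2) x / es s (j - i + 1) x by
          rw [show j - (i + 1) + 2 = j - i + 1 by omega]] at this
  -- Every quotient `σ_{i+1}/σ_i` up to the last is at least the last one, `q`, so climbing from
  -- `σ_1` costs at least a factor `q` per step.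
  have hprod : ∀ i ≤ j, es s 1 x * q ^ i ≤ es s (i + 1) x := by
    intro i hi
    induction i with
    | zero => simp
    | succ i ih =>
      have h1 := hmono (j - i) (by omega)
      rw [show j - (j - i) = i by omega, le_div_iff₀ (hx _ (by omega))] at h1
      have h2 := mul_le_mul_of_nonneg_left (ih (by omega)) hq0.le
      calc es s 1 x * q ^ (i + 1) = q * (es s 1 x * q ^ i) := by ring
        _ ≤ q * es s (i + 1) x := h2
        _ ≤ _ := h1
  have h := hprod j le_rfl
  have hp := hx (j + 1) (by omega)
  have he : es s (j + 2) x = q * es s (j + 1) x := by rw [hq, div_mul_cancel₀ _ hp.ne']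
  calc es s 1 x * es s (j + 2) x ^ j = (es s 1 x * q ^ j) * es s (j + 1) x ^ j := by
        rw [he]; ring
    _ ≤ es s (j + 1) x * es s (j + 1) x ^ j := by gcongr
    _ = _ := by ring

/-- The quotients `σ_{r+1}/σ_r` decrease and the first is `σ_1`. Stated without division so that it
survives passage to the closure of the cone, where it forces `σ_m > 0` as soon as `σ_k > 0`. -/
theorem Cone.es_le_mul_pow {s : Finset ι} {k : ℕ} {x : ι → ℝ} (hx : Cone s k x) (m i : ℕ)
    (h1 : 1 ≤ m) (hk : m + i = k) : es s k x ≤ es s m x * es s 1 x ^ i := by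
  have hq : ∀ r, 1 ≤ r → r + 1 ≤ k → es s (r + 1) x ≤ es s r x * es s 1 x := by
    intro r hr
    induction r, hr using Nat.le_induction with
    | base =>
      intro h
      have := newton s 0 x
      simp only [es_zero, one_mul, zero_add] at this
      calc _ ≤ _ := this
        _ = _ := by ring
    | succ r hr ih =>
      intro h
      have ih' := ih (by omega)
      have := (hx.mono (show r + 1 ≤ k by omega)).quotient_anti
      rw [div_le_div_iff₀ (hx _ (by omega)) (hx _ (by omega))] at this
      have hr0 := hx r (by omega)
      have hr1 := hx (r + 1) (by omega)
      have h3 : es s (r + 2) x * es s r x ≤ es s (r + 1) x * es s 1 x * es s r x := by nlinarith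
      exact le_of_mul_le_mul_right h3 hr0
  induction i generalizing k with
  | zero => simp at hk; simp [hk]
  | succ i ih =>
    subst hk
    have := ih (k := m + i) (hx.mono (by omega)) rfl (fun r a b => hq r a (by omega))
    have h2 := hq (m + i) (by omega) (by omega)
    have h3 := hx 1 (by omega)
    calc _ ≤ _ := h2
      _ ≤ es s m x * es s 1 x ^ i * es s 1 x := by gcongr
      _ = _ := by ring

/-- A point of the closed cone at which `σ_k` is positive lies in the open cone. -/
theorem mem_cone_of_mem_closure {n k : ℕ} {l : Fin n → ℝ} (hk : 1 ≤ k)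
    (h : l ∈ closure (gardingCone n k)) (hpos : 0 < sigma k l) : Cone Finset.univ k l := by
  have hle : ∀ m i : ℕ, 1 ≤ m → m + i = k →
      es Finset.univ k l ≤ es Finset.univ m l * es Finset.univ 1 l ^ i := by
    intro m i hm hi
    have hcl : IsClosed {l : Fin n → ℝ |
        es Finset.univ k l ≤ es Finset.univ m l * es Finset.univ 1 l ^ i} :=
      isClosed_le (continuous_es _ _) ((continuous_es _ _).mul ((continuous_es _ _).pow _))
    exact closure_minimal (fun x hx => (mem_gardingCone_iff.1 hx).es_le_mul_pow m i hm hi) hcl h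
  have h1 : 0 ≤ es Finset.univ 1 l := by
    have hcl : IsClosed {l : Fin n → ℝ | 0 ≤ es Finset.univ 1 l} :=
      isClosed_le continuous_const (continuous_es _ _)
    exact closure_minimal (fun x hx => (mem_gardingCone_iff.1 hx 1 hk).le) hcl h
  intro m hm
  rcases Nat.eq_zero_or_pos m with rfl | hm0
  · simp
  have h2 := hle m (k - m) hm0 (by omega)
  rw [sigma_eq_es] at hpos
  by_contra! hc
  have : es Finset.univ m l * es Finset.univ 1 l ^ (k - m) ≤ 0 :=
    mul_nonpos_of_nonpos_of_nonneg hc (by positivity)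
  linarith

variable [DecidableEq ι]

/-- With `a, b, c` the functions of degrees `k, k+1, k+2` in the remaining variables, `b ≤ 0` would
give `l_i a > -b` and `c > -l_i b`, hence `a c > b²`, against Newton. -/
theorem Cone.erase {s : Finset ι} {k : ℕ} {l : ι → ℝ} (h : Cone s (k + 1) l) {i : ι}
    (hi : i ∈ s) : Cone (s.erase i) k l := by
  induction k with
  | zero => intro m hm; simp [Nat.le_zero.1 hm]
  | succ k ih =>
    have ih' := ih (h.mono (by omega))
    intro m hm
    rcases Nat.lt_or_ge m (k + 1) with hm' | hm'
    · exact ih' m (by omega)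
    obtain rfl : m = k + 1 := by omega
    have ha := ih' k le_rfl
    have h1 := h (k + 1) (by omega)
    have h2 := h (k + 1 + 1) le_rfl
    rw [es_erase hi] at h1 h2
    have hN := newton (s.erase i) k l
    by_contra! hb
    set a := es (s.erase i) k l
    set b := es (s.erase i) (k + 1) l
    set c := es (s.erase i) (k + 2) l
    have h3 : -(a * (l i * b)) < a * c := by nlinarith
    nlinarith

theorem Cone.sdiff {s : Finset ι} {k : ℕ} {l : ι → ℝ} {t : Finset ι} (ht : t ⊆ s)
    (h : Cone s (k + t.card) l) : Cone (s \ t) k l := by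
  induction t using Finset.induction_on generalizing k with
  | empty => simpa using h
  | insert a t ha ih =>
    rw [Finset.card_insert_of_notMem ha] at h
    have := ih (k := k + 1) ((Finset.subset_insert a t).trans ht) (by convert h using 1; omega)
    rw [Finset.sdiff_insert]
    exact this.erase (Finset.mem_sdiff.2 ⟨ht (Finset.mem_insert_self a t), ha⟩)

/-- The inner denominator `σ_{k+1}/σ_k^{(i)}` equals `z_i` plus the quotient of one lower degree in
the variables other than `i`. This makes induction on the degree possible: `z²/d` is jointly convex,
homogeneous of degree one and decreasing in `d > 0`. -/
theorem quotient_formula {s : Finset ι} {k : ℕ} {z : ι → ℝ} (h : es s (k + 1) z ≠ 0) :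
    ((k : ℝ) + 2) * (es s (k + 2) z / es s (k + 1) z) =
      ∑ i ∈ s, (z i - z i ^ 2 / (es s (k + 1) z / es (s.erase i) k z)) := by
  have h1 : ∀ i ∈ s, z i - z i ^ 2 / (es s (k + 1) z / es (s.erase i) k z) =
      (z i * es (s.erase i) (k + 1) z) / es s (k + 1) z := fun i hi => by
    rw [div_div_eq_mul_div, eq_div_iff h, sub_mul, div_mul_cancel₀ _ h, es_erase hi]; ring
  rw [Finset.sum_congr rfl h1, ← Finset.sum_div, sum_mul_es_erase]
  push_cast; ring

theorem sq_div_add_le {x y a b c : ℝ} (ha : 0 < a) (hb : 0 < b) (hc : a + b ≤ c) :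
    (x + y) ^ 2 / c ≤ x ^ 2 / a + y ^ 2 / b := by
  calc (x + y) ^ 2 / c ≤ (x + y) ^ 2 / (a + b) := by gcongr
    _ ≤ x ^ 2 / a + y ^ 2 / b := by
      rw [div_add_div _ _ ha.ne' hb.ne', div_le_div_iff₀ (by positivity) (by positivity)]
      nlinarith [sq_nonneg (x * b - y * a), mul_pos ha hb]

/-- The quotients `σ_{k+1} / σ_k` are superadditive on Gårding's cone (Marcus and Lopes), and the
cone is closed under addition. -/
theorem cone_add_and_quotient (k : ℕ) : ∀ (s : Finset ι) (x y : ι → ℝ), Cone s k x → Cone s k y →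
    Cone s k (x + y) ∧ es s (k + 1) x / es s k x + es s (k + 1) y / es s k y ≤
      es s (k + 1) (x + y) / es s k (x + y) := by
  induction k with
  | zero =>
    intro s x y _ _
    refine ⟨fun m hm => by simp [Nat.le_zero.1 hm], ?_⟩
    simp [es_one, Finset.sum_add_distrib]
  | succ k ih =>
    intro s x y hx hy
    obtain ⟨h1, h2⟩ := ih s x y (hx.mono (by omega)) (hy.mono (by omega))
    -- Closure under addition is obtained along with superadditivity: the quotient of lower degree
    -- at `x + y` exceeds a sum of two positive numbers.
    have hpos : 0 < es s (k + 1) (x + y) := by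
      have a1 := div_pos (hx (k + 1) le_rfl) (hx k (by omega))
      have a2 := div_pos (hy (k + 1) le_rfl) (hy k (by omega))
      have a3 : 0 < es s (k + 1) (x + y) / es s k (x + y) := by linarith
      exact (div_pos_iff_of_pos_right (h1 k le_rfl)).1 a3
    have hxy : Cone s (k + 1) (x + y) := fun m hm => by
      rcases Nat.lt_or_ge m (k + 1) with h | h
      · exact h1 m (by omega)
      · rwa [show m = k + 1 by omega]
    refine ⟨hxy, ?_⟩
    have key : ((k : ℝ) + 2) * (es s (k + 2) x / es s (k + 1) x) +
        ((k : ℝ) + 2) * (es s (k + 2) y / es s (k + 1) y) ≤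
        ((k : ℝ) + 2) * (es s (k + 2) (x + y) / es s (k + 1) (x + y)) := by
      rw [quotient_formula (hx (k + 1) le_rfl).ne', quotient_formula (hy (k + 1) le_rfl).ne',
        quotient_formula hpos.ne', ← Finset.sum_add_distrib]
      refine Finset.sum_le_sum fun i hi => ?_
      have hd : ∀ z : ι → ℝ, Cone s (k + 1) z → es s (k + 1) z / es (s.erase i) k z =
          z i + es (s.erase i) (k + 1) z / es (s.erase i) k z := fun z hz => by
        have := (hz.erase hi k le_rfl).ne'
        rw [es_erase hi]; field_simp
      have h3 := (ih (s.erase i) x y (hx.erase hi) (hy.erase hi)).2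
      have dx : 0 < es s (k + 1) x / es (s.erase i) k x :=
        div_pos (hx _ le_rfl) (hx.erase hi k le_rfl)
      have dy : 0 < es s (k + 1) y / es (s.erase i) k y :=
        div_pos (hy _ le_rfl) (hy.erase hi k le_rfl)
      have h4 : es s (k + 1) x / es (s.erase i) k x + es s (k + 1) y / es (s.erase i) k y ≤
          es s (k + 1) (x + y) / es (s.erase i) k (x + y) := by
        rw [hd x hx, hd y hy, hd _ hxy, Pi.add_apply]; linarith
      have h5 := sq_div_add_le (x := x i) (y := y i) dx dy h4
      rw [Pi.add_apply]; linarith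
    have : (0 : ℝ) < k + 2 := by positivity
    rw [← mul_add] at key
    exact le_of_mul_le_mul_left key this

theorem Cone.add {s : Finset ι} {k : ℕ} {x y : ι → ℝ} (hx : Cone s k x) (hy : Cone s k y) :
    Cone s k (x + y) := (cone_add_and_quotient k s x y hx hy).1

theorem Cone.quotient_add_le {s : Finset ι} {k : ℕ} {x y : ι → ℝ} (hx : Cone s k x)
    (hy : Cone s k y) : es s (k + 1) x / es s k x + es s (k + 1) y / es s k y ≤
      es s (k + 1) (x + y) / es s k (x + y) := (cone_add_and_quotient k s x y hx hy).2

/-- Each successive quotient increases when `y` is added, and `σ_k` is the product of these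
quotients. -/
theorem Cone.es_le_es_add {s : Finset ι} {k : ℕ} {x y : ι → ℝ} (hx : Cone s k x)
    (hy : Cone s k y) : es s k x ≤ es s k (x + y) := by
  induction k with
  | zero => simp
  | succ k ih =>
    have ih' := ih (hx.mono (by omega)) (hy.mono (by omega))
    have hx' := hx.mono (Nat.le_succ k)
    have hy' := hy.mono (Nat.le_succ k)
    have h1 := hx'.quotient_add_le hy'
    have p1 := hx' k le_rfl
    have p2 := hy' k le_rfl
    have p3 := (hx'.add hy') k le_rfl
    have q1 := hx (k + 1) le_rfl
    have q2 := div_pos (hy (k + 1) le_rfl) p2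
    have h2 : es s (k + 1) x / es s k x ≤ es s (k + 1) (x + y) / es s k (x + y) := by linarith
    rw [div_le_div_iff₀ p1 p3] at h2
    have h3 : es s (k + 1) x * es s k x ≤ es s (k + 1) (x + y) * es s k x := by nlinarith
    exact le_of_mul_le_mul_right h3 p1

end Cone

/-! ### Two-jets of functions of one variable at the origin -/

section Jets

open Filter Topology

/-- `f` is differentiable near `0`, twice differentiable at `0`, and its value and first two
derivatives at `0` are `a`, `b`, `c`. -/
def J2 (f : ℝ → ℝ) (a b c : ℝ) : Prop :=
  ∃ f' : ℝ → ℝ, f 0 = a ∧ f' 0 = b ∧ (∀ᶠ t in 𝓝 0, HasDerivAt f (f' t) t) ∧ HasDerivAt f' c 0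

theorem J2.val {f : ℝ → ℝ} {a b c : ℝ} (h : J2 f a b c) : f 0 = a := by
  obtain ⟨f', h0, -⟩ := h; exact h0

theorem J2.hasDerivAt {f : ℝ → ℝ} {a b c : ℝ} (h : J2 f a b c) : HasDerivAt f b 0 := by
  obtain ⟨f', -, rfl, h1, -⟩ := h; exact h1.self_of_nhds

theorem J2.const (a : ℝ) : J2 (fun _ => a) a 0 0 :=
  ⟨fun _ => 0, rfl, rfl, .of_forall fun t => hasDerivAt_const t a, hasDerivAt_const 0 0⟩

theorem J2.id : J2 (fun t => t) 0 1 0 :=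
  ⟨fun _ => 1, rfl, rfl, .of_forall fun t => hasDerivAt_id t, hasDerivAt_const 0 1⟩

theorem J2.congr_coeff {f : ℝ → ℝ} {a b c a' b' c' : ℝ} (h : J2 f a b c) (ha : a = a')
    (hb : b = b') (hc : c = c') : J2 f a' b' c' := by subst ha hb hc; exact h

theorem J2.congr {f g : ℝ → ℝ} {a b c : ℝ} (h : J2 f a b c) (hfg : g =ᶠ[𝓝 0] f) :
    J2 g a b c := by
  obtain ⟨f', h0, h1, h2, h3⟩ := h
  refine ⟨f', by rw [hfg.self_of_nhds, h0], h1, ?_, h3⟩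
  filter_upwards [h2, hfg.eventually_nhds] with t ht ht'
  exact ht.congr_of_eventuallyEq ht'

theorem J2.unique {f : ℝ → ℝ} {a b c a' b' c' : ℝ} (h : J2 f a b c) (h' : J2 f a' b' c') :
    a = a' ∧ b = b' ∧ c = c' := by
  refine ⟨h.val.symm.trans h'.val, h.hasDerivAt.unique h'.hasDerivAt, ?_⟩
  obtain ⟨f', -, -, h2, h3⟩ := h
  obtain ⟨g', -, -, k2, k3⟩ := h'
  have : f' =ᶠ[𝓝 0] g' := by
    filter_upwards [h2, k2] with t ht kt using ht.unique kt
  exact (h3.congr_of_eventuallyEq this.symm).unique k3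

theorem J2.add {f g : ℝ → ℝ} {a b c a' b' c' : ℝ} (h : J2 f a b c) (h' : J2 g a' b' c') :
    J2 (fun t => f t + g t) (a + a') (b + b') (c + c') := by
  obtain ⟨f', rfl, rfl, h2, h3⟩ := h
  obtain ⟨g', rfl, rfl, k2, k3⟩ := h'
  refine ⟨fun t => f' t + g' t, rfl, rfl, ?_, h3.add k3⟩
  filter_upwards [h2, k2] with t ht kt using ht.add kt

theorem J2.mul {f g : ℝ → ℝ} {a b c a' b' c' : ℝ} (h : J2 f a b c) (h' : J2 g a' b' c') :
    J2 (fun t => f t * g t) (a * a') (b * a' + a * b') (c * a' + 2 * (b * b') + a * c') := by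
  have hf := h.hasDerivAt
  have hg := h'.hasDerivAt
  obtain ⟨f', rfl, rfl, h2, h3⟩ := h
  obtain ⟨g', rfl, rfl, k2, k3⟩ := h'
  refine ⟨fun t => f' t * g t + f t * g' t, rfl, rfl, ?_, ?_⟩
  · filter_upwards [h2, k2] with t ht kt using ht.mul kt
  · refine ((h3.mul hg).add (hf.mul k3)).congr_deriv ?_
    ring

theorem J2.const_mul {f : ℝ → ℝ} {a b c : ℝ} (r : ℝ) (h : J2 f a b c) :
    J2 (fun t => r * f t) (r * a) (r * b) (r * c) :=
  ((J2.const r).mul h).congr_coeff rfl (by ring) (by ring)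

theorem J2.neg {f : ℝ → ℝ} {a b c : ℝ} (h : J2 f a b c) :
    J2 (fun t => - f t) (-a) (-b) (-c) := by
  simpa using h.const_mul (-1)

theorem J2.sub {f g : ℝ → ℝ} {a b c a' b' c' : ℝ} (h : J2 f a b c) (h' : J2 g a' b' c') :
    J2 (fun t => f t - g t) (a - a') (b - b') (c - c') := by
  simpa [sub_eq_add_neg] using h.add h'.neg

theorem J2.sum {ι : Type*} {s : Finset ι} {f : ι → ℝ → ℝ} {a b c : ι → ℝ}
    (h : ∀ i ∈ s, J2 (f i) (a i) (b i) (c i)) :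
    J2 (fun t => ∑ i ∈ s, f i t) (∑ i ∈ s, a i) (∑ i ∈ s, b i) (∑ i ∈ s, c i) := by
  classical
  induction s using Finset.induction_on with
  | empty => simpa using J2.const 0
  | insert i s hi ih =>
    simp only [Finset.sum_insert hi]
    exact (h i (Finset.mem_insert_self i s)).add
      (ih fun j hj => h j (Finset.mem_insert_of_mem hj))

theorem J2.comp {f g g' : ℝ → ℝ} {a b c d : ℝ} (h : J2 f a b c)
    (hg : ∀ᶠ y in 𝓝 a, HasDerivAt g (g' y) y) (hg' : HasDerivAt g' d a) :
    J2 (fun t => g (f t)) (g a) (g' a * b) (d * b ^ 2 + g' a * c) := by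
  have hf := h.hasDerivAt
  obtain ⟨f', rfl, rfl, h2, h3⟩ := h
  refine ⟨fun t => g' (f t) * f' t, rfl, rfl, ?_, ?_⟩
  · filter_upwards [h2, hf.continuousAt.eventually hg] with t ht kt using kt.comp t ht
  · refine ((hg'.comp 0 hf).mul h3).congr_deriv ?_
    simp only [Function.comp]; ring

theorem J2.exp {f : ℝ → ℝ} {a b c : ℝ} (h : J2 f a b c) :
    J2 (fun t => Real.exp (f t)) (Real.exp a) (Real.exp a * b)
      (Real.exp a * b ^ 2 + Real.exp a * c) :=
  h.comp (.of_forall Real.hasDerivAt_exp) (Real.hasDerivAt_exp a)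

theorem J2.log {f : ℝ → ℝ} {a b c : ℝ} (h : J2 f a b c) (ha : 0 < a) :
    J2 (fun t => Real.log (f t)) (Real.log a) (a⁻¹ * b) (-(a ^ 2)⁻¹ * b ^ 2 + a⁻¹ * c) := by
  refine h.comp (g' := fun y => y⁻¹) ?_ (hasDerivAt_inv ha.ne')
  filter_upwards [lt_mem_nhds ha] with y hy using Real.hasDerivAt_log hy.ne'

theorem J2.pow {f : ℝ → ℝ} {a b c : ℝ} (h : J2 f a b c) (m : ℕ) :
    J2 (fun t => f t ^ m) (a ^ m) (m * a ^ (m - 1) * b)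
      ((m * ((m - 1 : ℕ) * a ^ (m - 1 - 1))) * b ^ 2 + m * a ^ (m - 1) * c) :=
  h.comp (.of_forall fun y => hasDerivAt_pow m y) ((hasDerivAt_pow (m - 1) a).const_mul _)

theorem J2.prod {ι : Type*} [DecidableEq ι] {s : Finset ι} {f : ι → ℝ → ℝ} {a b c : ι → ℝ}
    (h : ∀ i ∈ s, J2 (f i) (a i) (b i) (c i)) :
    J2 (fun t => ∏ i ∈ s, f i t) (∏ i ∈ s, a i) (∑ i ∈ s, (∏ j ∈ s.erase i, a j) * b i)
      (∑ i ∈ s, (∏ j ∈ s.erase i, a j) * c i +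
        ∑ i ∈ s, ∑ j ∈ s.erase i, (∏ l ∈ (s.erase i).erase j, a l) * (b i * b j)) := by
  have hd : ∀ i ∈ s, HasDerivAt (f i) (b i) 0 := fun i hi => (h i hi).hasDerivAt
  have hv : ∀ i ∈ s, f i 0 = a i := fun i hi => (h i hi).val
  choose! f' h0 h1 h2 h3 using h
  refine ⟨fun t => ∑ i ∈ s, (∏ j ∈ s.erase i, f j t) * f' i t,
    Finset.prod_congr rfl hv, ?_, ?_, ?_⟩
  · refine Finset.sum_congr rfl fun i hi => ?_
    rw [h1 i hi, Finset.prod_congr rfl fun j hj => hv j (Finset.mem_of_mem_erase hj)]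
  · have : ∀ᶠ t in 𝓝 (0 : ℝ), ∀ i ∈ s, HasDerivAt (f i) (f' i t) t :=
      (Filter.eventually_all_finset s).2 h2
    filter_upwards [this] with t ht
    simpa using HasDerivAt.fun_finsetProd ht
  · have key : ∀ i ∈ s, HasDerivAt (fun t => (∏ j ∈ s.erase i, f j t) * f' i t)
        ((∏ j ∈ s.erase i, a j) * c i +
          ∑ j ∈ s.erase i, (∏ l ∈ (s.erase i).erase j, a l) * (b i * b j)) 0 := by
      intro i hi
      have e1 := HasDerivAt.fun_finsetProd (u := s.erase i) (f := f) (f' := b) (x := (0 : ℝ))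
        fun j hj => hd j (Finset.mem_of_mem_erase hj)
      refine (e1.mul (h3 i hi)).congr_deriv ?_
      rw [h1 i hi, Finset.prod_congr rfl fun j hj => hv j (Finset.mem_of_mem_erase hj), add_comm,
        Finset.sum_mul]
      congr 1
      refine Finset.sum_congr rfl fun j _ => ?_
      rw [Finset.prod_congr rfl fun l hl =>
        hv l (Finset.mem_of_mem_erase (Finset.mem_of_mem_erase hl)), smul_eq_mul]
      ring
    rw [← Finset.sum_add_distrib]
    exact HasDerivAt.fun_sum key

theorem J2.of_isLocalMax {f : ℝ → ℝ} {a b c : ℝ} (h : J2 f a b c) (hm : IsLocalMax f 0) :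
    b = 0 ∧ c ≤ 0 := by
  have hb : b = 0 := hm.hasDerivAt_eq_zero h.hasDerivAt
  refine ⟨hb, ?_⟩
  by_contra! hc
  have hcont := h.hasDerivAt.continuousAt
  have hderiv := h.hasDerivAt.deriv
  have h' := h
  obtain ⟨f', -, -, h2, h3⟩ := h
  have hdd : deriv (deriv f) 0 = c := by
    have : deriv f =ᶠ[𝓝 0] f' := by filter_upwards [h2] with t ht using ht.deriv
    rw [this.deriv_eq, h3.deriv]
  -- A positive second derivative would make the maximum a strict-type minimum as well; the function
  -- would then be locally constant and its second derivative zero.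
  have hmin := isLocalMin_of_deriv_deriv_pos (f := f) (x₀ := 0) (by rw [hdd]; exact hc)
    (by rw [hderiv, hb]) hcont
  have hconst : (fun _ => a) =ᶠ[𝓝 0] f := by
    filter_upwards [hm, hmin] with t h1 h2
    rw [← h'.val]; exact le_antisymm h2 h1
  have := (h'.congr hconst).unique (J2.const a)
  linarith [this.2.2]

theorem J2.of_contDiffAt {E : Type*} [NormedAddCommGroup E] [NormedSpace ℝ E] {g : E → ℝ} {x : E}
    (hg : ContDiffAt ℝ 2 g x) (v : E) :
    J2 (fun t => g (x + t • v)) (g x) (fderiv ℝ g x v)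
      (fderiv ℝ (fun y => fderiv ℝ g y v) x v) := by
  have hline : ∀ t : ℝ, HasDerivAt (fun t : ℝ => x + t • v) v t := fun t => by
    simpa using ((hasDerivAt_id t).smul_const v).const_add x
  have hcont : Tendsto (fun t : ℝ => x + t • v) (𝓝 0) (𝓝 x) := by
    have := (hline 0).continuousAt.tendsto; simpa using this
  refine ⟨fun t => fderiv ℝ g (x + t • v) v, by simp, by simp, ?_, ?_⟩
  · have h1 : ∀ᶠ y in 𝓝 x, DifferentiableAt ℝ g y :=
      (hg.eventually (by simp)).mono fun y hy => hy.differentiableAt (by simp)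
    filter_upwards [hcont.eventually h1] with t ht
    exact ht.hasFDerivAt.comp_hasDerivAt t (hline t)
  · have h2 : DifferentiableAt ℝ (fun y => fderiv ℝ g y v) x :=
      ((hg.fderiv_right (m := 1) (by norm_num)).differentiableAt (by simp)).clm_apply
        (differentiableAt_const v)
    have h3 : HasFDerivAt (fun y => fderiv ℝ g y v) (fderiv ℝ (fun y => fderiv ℝ g y v) x)
        (x + (0 : ℝ) • v) := by simpa using h2.hasFDerivAt
    exact h3.comp_hasDerivAt 0 (hline 0)

end Jets

/-! ### Coefficients of polynomials by Lagrange interpolation -/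

section Interpolation

open Polynomial

/-- The weights expressing the `j`-th coefficient of a polynomial of degree at most `N` through its
values at `0, 1, …, N`. -/
def nodeWeight (N j r : ℕ) : ℝ :=
  (Lagrange.basis (Finset.range (N + 1)) (fun r : ℕ => (r : ℝ)) r).coeff j

theorem coeff_eq_sum_nodeWeight {N : ℕ} (j : ℕ) {p : ℝ[X]} (hp : p.natDegree ≤ N) :
    p.coeff j = ∑ r ∈ Finset.range (N + 1), nodeWeight N j r * p.eval (r : ℝ) := by
  have h := Lagrange.eq_interpolate (s := Finset.range (N + 1)) (v := fun r : ℕ => (r : ℝ)) (f := p)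
    (fun a _ b _ hab => Nat.cast_injective hab)
    (by
      rw [Finset.card_range]
      exact lt_of_le_of_lt degree_le_natDegree (by exact_mod_cast Nat.lt_succ_of_le hp))
  conv_lhs => rw [h, Lagrange.interpolate_apply, finsetSum_coeff]
  refine Finset.sum_congr rfl fun r _ => ?_
  rw [coeff_C_mul, nodeWeight, mul_comm]

/-- The weights depend on `m` and `s` only through the codegree `j = |s| - m`. So `σ_k`, its first
derivatives (one variable removed, degree `k-1`) and its second derivatives (two removed, degree
`k-2`) all share the same weights. -/
theorem es_eq_sum_nodeWeight {ι : Type*} (s : Finset ι) {N m j : ℕ} (l : ι → ℝ)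
    (h : m + j = s.card) (hN : s.card ≤ N) :
    es s m l = ∑ r ∈ Finset.range (N + 1), nodeWeight N j r * ∏ i ∈ s, ((r : ℝ) + l i) := by
  rw [es_eq_coeff s m j l h, coeff_eq_sum_nodeWeight (N := N)]
  · simp [eval_prod]
  · refine (natDegree_prod_le _ _).trans (le_trans ?_ hN)
    simp

end Interpolation

/-! ### Second order expansion of `σ_k` of a matrix at a diagonal matrix -/

section Determinant

variable {n : ℕ}

/-- The sum of the principal minors of order `k`, expressed through characteristic polynomials. -/
def minorSum (n k : ℕ) (A : Matrix (Fin n) (Fin n) ℝ) : ℝ :=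
  ∑ r ∈ Finset.range (n + 1), nodeWeight n (n - k) r *
    (Matrix.diagonal (fun _ : Fin n => (r : ℝ)) + A).det

theorem minorSum_eq_es {k : ℕ} (hk : k ≤ n) {A : Matrix (Fin n) (Fin n) ℝ} {l : Fin n → ℝ}
    (h : ∀ r : ℝ, (Matrix.diagonal (fun _ : Fin n => r) + A).det = ∏ i, (r + l i)) :
    minorSum n k A = es Finset.univ k l := by
  rw [es_eq_sum_nodeWeight (N := n) (j := n - k) Finset.univ l (by simp; omega) (by simp)]
  simp [minorSum, h]

/-- In the Leibniz expansion at a diagonal matrix, a permutation contributes to order two only if it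
moves at most two indices. These are the identity and the transpositions, the latter giving `-B_ij
B_ji`. -/
theorem J2.det {A : ℝ → Matrix (Fin n) (Fin n) ℝ} {d : Fin n → ℝ} {B C : Matrix (Fin n) (Fin n) ℝ}
    (h : ∀ p q, J2 (fun t => A t p q) (Matrix.diagonal d p q) (B p q) (C p q)) :
    J2 (fun t => (A t).det) (∏ i, d i) (∑ i, (∏ j ∈ Finset.univ.erase i, d j) * B i i)
      (∑ i, (∏ j ∈ Finset.univ.erase i, d j) * C i i +
        ∑ i, ∑ j ∈ Finset.univ.erase i, (∏ l ∈ (Finset.univ.erase i).erase j, d l) *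
          (B i i * B j j - B i j * B j i)) := by
  have hprod := fun σ : Equiv.Perm (Fin n) =>
    (J2.prod (s := Finset.univ) fun i _ => h (σ i) i).const_mul ((Equiv.Perm.sign σ : ℤ) : ℝ)
  have hsum := J2.sum (s := Finset.univ) fun σ _ => hprod σ
  have hzero : ∀ (σ : Equiv.Perm (Fin n)) (s : Finset (Fin n)) (i : Fin n), i ∈ s → σ i ≠ i →
      ∏ l ∈ s, Matrix.diagonal d (σ l) l = 0 := fun σ s i hi hσ =>
    Finset.prod_eq_zero hi (Matrix.diagonal_apply_ne _ hσ)
  have hone : ∀ s : Finset (Fin n),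
      ∏ l ∈ s, Matrix.diagonal d ((1 : Equiv.Perm (Fin n)) l) l = ∏ l ∈ s, d l := fun s => by simp
  have hfix1 : ∀ (σ : Equiv.Perm (Fin n)) (i : Fin n), σ ≠ 1 →
      ∏ l ∈ Finset.univ.erase i, Matrix.diagonal d (σ l) l = 0 := by
    intro σ i hσ
    by_contra hne
    apply hσ
    have hf : ∀ l, l ≠ i → σ l = l := fun l hl => by
      by_contra hl'
      exact hne (hzero σ _ l (Finset.mem_erase.2 ⟨hl, Finset.mem_univ l⟩) hl')
    ext l
    by_cases hl : l = i
    · subst hl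
      have : σ l = l := by
        by_contra hl'
        exact hl' (σ.injective (hf _ hl'))
      simp [this]
    · simp [hf l hl]
  refine (hsum.congr (g := fun t => (A t).det) (.of_forall fun t => Matrix.det_apply' _)).congr_coeff
    ?_ ?_ ?_
  · rw [Finset.sum_eq_single (1 : Equiv.Perm (Fin n))]
    · simp
    · intro σ _ hσ
      obtain ⟨i, hi⟩ : ∃ i, σ i ≠ i := by
        by_contra! hc; exact hσ (Equiv.ext hc)
      rw [hzero σ _ i (Finset.mem_univ i) hi, mul_zero]
    · simp
  · simp only [Finset.mul_sum]
    rw [Finset.sum_comm]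
    refine Finset.sum_congr rfl fun i _ => ?_
    rw [Finset.sum_eq_single (1 : Equiv.Perm (Fin n))]
    · simp
    · intro σ _ hσ
      rw [hfix1 σ i hσ]; simp
    · simp
  · simp only [mul_add, Finset.mul_sum, Finset.sum_add_distrib]
    congr 1
    · rw [Finset.sum_comm]
      refine Finset.sum_congr rfl fun i _ => ?_
      rw [Finset.sum_eq_single (1 : Equiv.Perm (Fin n))]
      · simp
      · intro σ _ hσ
        rw [hfix1 σ i hσ]; simp
      · simp
    · rw [Finset.sum_comm]
      refine Finset.sum_congr rfl fun i _ => ?_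
      rw [Finset.sum_comm]
      refine Finset.sum_congr rfl fun j hj => ?_
      have hji : j ≠ i := (Finset.mem_erase.1 hj).1
      rw [Finset.sum_eq_add (1 : Equiv.Perm (Fin n)) (Equiv.swap i j)]
      · have hs : ∏ l ∈ (Finset.univ.erase i).erase j, Matrix.diagonal d (Equiv.swap i j l) l =
            ∏ l ∈ (Finset.univ.erase i).erase j, d l := by
          refine Finset.prod_congr rfl fun l hl => ?_
          have h1 := Finset.mem_erase.1 hl
          rw [Equiv.swap_apply_of_ne_of_ne (Finset.mem_erase.1 h1.2).1 h1.1,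
            Matrix.diagonal_apply_eq]
        rw [hs, Equiv.Perm.sign_swap hji.symm]
        simp
        ring
      · intro hc
        have := congrArg (fun σ : Equiv.Perm (Fin n) => σ i) hc
        simp at this
        exact hji this.symm
      · intro σ _ hσ
        by_contra hne
        have hf : ∀ l, l ≠ i → l ≠ j → σ l = l := fun l hl hl2 => by
          by_contra hl'
          apply hne
          rw [hzero σ _ l (Finset.mem_erase.2 ⟨hl2, Finset.mem_erase.2 ⟨hl, Finset.mem_univ l⟩⟩) hl']
          simp
        have hij : ∀ x, (σ i = x) → x = i ∨ x = j := fun x hx => by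
          by_contra! hc
          have := hf x hc.1 hc.2
          exact hc.1 (σ.injective (this.trans hx.symm))
        have hjj : ∀ x, (σ j = x) → x = i ∨ x = j := fun x hx => by
          by_contra! hc
          have := hf x hc.1 hc.2
          exact hc.2 (σ.injective (this.trans hx.symm))
        rcases hij _ rfl with h1 | h1 <;> rcases hjj _ rfl with h2 | h2
        · exact hji (σ.injective (h2.trans h1.symm))
        · apply hσ.1
          ext l
          by_cases hl : l = i
          · simp [hl, h1]
          by_cases hl2 : l = j
          · simp [hl2, h2]
          simp [hf l hl hl2]
        · apply hσ.2
          ext l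
          by_cases hl : l = i
          · simp [hl, h1]
          by_cases hl2 : l = j
          · simp [hl2, h2]
          rw [hf l hl hl2, Equiv.swap_apply_of_ne_of_ne hl hl2]
        · exact hji (σ.injective (h2.trans h1.symm))
      · simp
      · simp

/-- The second order expansion of the sum of principal minors at a diagonal matrix. -/
theorem J2.minorSum {k : ℕ} (hk : k + 2 ≤ n) {A : ℝ → Matrix (Fin n) (Fin n) ℝ} {d : Fin n → ℝ}
    {B C : Matrix (Fin n) (Fin n) ℝ}
    (h : ∀ p q, J2 (fun t => A t p q) (Matrix.diagonal d p q) (B p q) (C p q)) :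
    J2 (fun t => minorSum n (k + 2) (A t)) (es Finset.univ (k + 2) d)
      (∑ i, es (Finset.univ.erase i) (k + 1) d * B i i)
      (∑ i, es (Finset.univ.erase i) (k + 1) d * C i i +
        ∑ i, ∑ j ∈ Finset.univ.erase i, es ((Finset.univ.erase i).erase j) k d *
          (B i i * B j j - B i j * B j i)) := by
  -- `σ_k(A)` is a fixed linear combination of `det(r + A)`, `r = 0, …, n`, so its jet is the same
  -- combination of determinant jets. The weights then recombine the products in the jets into
  -- elementary symmetric functions.
  have hdet : ∀ r : ℕ, _ := fun r : ℕ => J2.det (A := fun t =>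
    Matrix.diagonal (fun _ : Fin n => (r : ℝ)) + A t) (d := fun i => (r : ℝ) + d i) (B := B) (C := C)
    fun p q => by
      refine ((J2.const (Matrix.diagonal (fun _ : Fin n => (r : ℝ)) p q)).add
        (h p q)).congr_coeff ?_ (zero_add _) (zero_add _)
      rw [← Matrix.diagonal_add]; rfl
  have hsum := J2.sum (s := Finset.range (n + 1)) fun r _ =>
    (hdet r).const_mul (nodeWeight n (n - (k + 2)) r)
  have c1 : ∀ i : Fin n, (Finset.univ.erase i).card = n - 1 := fun i => by simp
  refine hsum.congr_coeff ?_ ?_ ?_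
  · exact (es_eq_sum_nodeWeight _ d (by simp; omega) (by simp)).symm
  · simp only [Finset.mul_sum]
    rw [Finset.sum_comm]
    refine Finset.sum_congr rfl fun i _ => ?_
    rw [es_eq_sum_nodeWeight (N := n) (j := n - (k + 2)) _ d (by rw [c1]; omega)
      (by rw [c1]; omega), Finset.sum_mul]
    exact Finset.sum_congr rfl fun r _ => by ring
  · simp only [Finset.mul_sum, mul_add, Finset.sum_add_distrib]
    congr 1
    · rw [Finset.sum_comm]
      refine Finset.sum_congr rfl fun i _ => ?_
      rw [es_eq_sum_nodeWeight (N := n) (j := n - (k + 2)) _ d (by rw [c1]; omega)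
        (by rw [c1]; omega), Finset.sum_mul]
      exact Finset.sum_congr rfl fun r _ => by ring
    · rw [Finset.sum_comm]
      refine Finset.sum_congr rfl fun i _ => ?_
      rw [Finset.sum_comm]
      refine Finset.sum_congr rfl fun j hj => ?_
      have c2 : ((Finset.univ.erase i).erase j).card = n - 2 := by
        rw [Finset.card_erase_of_mem hj, c1]; omega
      rw [es_eq_sum_nodeWeight (N := n) (j := n - (k + 2)) _ d (by rw [c2]; omega)
        (by rw [c2]; omega), Finset.sum_mul]
      exact Finset.sum_congr rfl fun r _ => by ring

end Determinant

/-! ### Gradient of `σ_k` on the cone and logarithmic concavity -/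

section ConeCalculus

open Filter Topology

variable {n : ℕ}

theorem minorSum_diagonal {k : ℕ} (hk : k ≤ n) (l : Fin n → ℝ) :
    minorSum n k (Matrix.diagonal l) = es Finset.univ k l :=
  minorSum_eq_es hk fun r => by rw [Matrix.diagonal_add, Matrix.det_diagonal]

theorem J2.es_line {k : ℕ} (hk : k + 2 ≤ n) (x y : Fin n → ℝ) :
    J2 (fun t => es Finset.univ (k + 2) (x + t • y)) (es Finset.univ (k + 2) x)
      (∑ i, es (Finset.univ.erase i) (k + 1) x * y i)
      (∑ i, ∑ j ∈ Finset.univ.erase i, es ((Finset.univ.erase i).erase j) k x * (y i * y j)) := by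
  have h := J2.minorSum hk (A := fun t => Matrix.diagonal (x + t • y)) (d := x)
    (B := Matrix.diagonal y) (C := 0) fun p q => by
      by_cases hpq : p = q
      · subst hpq
        simp only [Matrix.diagonal_apply_eq, Pi.add_apply, Pi.smul_apply, smul_eq_mul]
        exact ((J2.const (x p)).add (J2.id.mul (J2.const (y p)))).congr_coeff
          (by ring) (by ring) (by simp)
      · simpa [Matrix.diagonal_apply_ne _ hpq] using J2.const 0
  simp only [minorSum_diagonal hk] at h
  refine h.congr_coeff rfl (by simp) ?_
  simp only [Matrix.zero_apply, mul_zero, Finset.sum_const_zero, zero_add,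
    Matrix.diagonal_apply_eq]
  refine Finset.sum_congr rfl fun i _ => Finset.sum_congr rfl fun j hj => ?_
  rw [Matrix.diagonal_apply_ne _ (Finset.mem_erase.1 hj).1, mul_zero, sub_zero]

/-- The gradient of `σ_k` at a point of the cone pairs nonnegatively with the closed cone. -/
theorem Cone.gradient_nonneg {k : ℕ} (hk : k + 2 ≤ n) {x y : Fin n → ℝ}
    (hx : Cone Finset.univ (k + 2) x) (hy : y ∈ closure (gardingCone n (k + 2))) :
    0 ≤ ∑ i, es (Finset.univ.erase i) (k + 1) x * y i := by
  have hcl : IsClosed {y : Fin n → ℝ | 0 ≤ ∑ i, es (Finset.univ.erase i) (k + 1) x * y i} :=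
    isClosed_le continuous_const (by fun_prop)
  refine closure_minimal (fun y hy => ?_) hcl hy
  have hy' := mem_gardingCone_iff.1 hy
  have hd := (J2.es_line hk x y).hasDerivAt
  -- For `y` in the open cone, `σ_k` does not decrease from `x` to `x + t y`, so the one-sided
  -- difference quotients are nonnegative.
  refine ge_of_tendsto (hasDerivAt_iff_tendsto_slope_zero.1 hd |>.mono_left
    (nhdsWithin_mono 0 (s := Ioi 0) fun t ht => (ne_of_gt ht : t ≠ 0))) ?_
  filter_upwards [self_mem_nhdsWithin] with t ht
  have ht' : (0 : ℝ) < t := ht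
  have := hx.es_le_es_add (hy'.smul ht')
  simp only [zero_add, zero_smul, add_zero, smul_eq_mul]
  exact mul_nonneg (inv_nonneg.2 ht'.le) (by linarith)

/-- The indicator of the first `k+2` indices lies in the open cone, so it remains there after
subtracting `e` times the indicator of the other indices. Pairing with the gradient bounds the sum
of the other partial derivatives by `e⁻¹` times the sum over the first `k+2`. For decreasing
variables the partial derivatives increase with the index, so each of the latter is at most the one
at `p`. -/
theorem exists_gradient_lower_bound {k : ℕ} (hk : k + 2 ≤ n) :
    ∃ c : ℝ, 0 < c ∧ ∀ x : Fin n → ℝ, Antitone x → Cone Finset.univ (k + 2) x →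
      ∀ p : Fin n, k + 1 ≤ (p : ℕ) →
        c * ∑ i, es (Finset.univ.erase i) (k + 1) x ≤ es (Finset.univ.erase p) (k + 1) x := by
  classical
  set K : Finset (Fin n) := Finset.univ.filter fun i => (i : ℕ) < k + 2 with hK
  have hKc : K.card = k + 2 := by
    rw [hK, Fin.card_filter_val_lt]; omega
  set y0 : Fin n → ℝ := fun i => if i ∈ K then 1 else 0 with hy0
  set y1 : Fin n → ℝ := fun i => if i ∈ K then 0 else 1 with hy1
  have hcone : Cone Finset.univ (k + 2) y0 := by
    intro m hm
    have hnn : ∀ t ∈ Finset.powersetCard m (Finset.univ : Finset (Fin n)),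
        0 ≤ ∏ i ∈ t, y0 i := fun t _ => Finset.prod_nonneg fun i _ => by
      simp only [hy0]; split_ifs <;> norm_num
    obtain ⟨t, htK, htc⟩ := Finset.exists_subset_card_eq (hKc ▸ hm : m ≤ K.card)
    refine lt_of_lt_of_le ?_ (Finset.single_le_sum hnn
      (Finset.mem_powersetCard.2 ⟨Finset.subset_univ t, htc⟩))
    exact Finset.prod_pos fun i hi => by simp [hy0, htK hi]
  have hev : ∀ᶠ t in 𝓝 (0 : ℝ), Cone Finset.univ (k + 2) (y0 - t • y1) := by
    have hc : Continuous fun t : ℝ => y0 - t • y1 := by fun_prop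
    refine hc.continuousAt.eventually (IsOpen.mem_nhds (isOpen_cone _ _) ?_)
    simpa using hcone
  obtain ⟨δ, hδ, hball⟩ := Metric.eventually_nhds_iff.1 hev
  set e : ℝ := min (δ / 2) 1 with he
  have he0 : 0 < e := by positivity
  have hcone2 : Cone Finset.univ (k + 2) (y0 - e • y1) := by
    apply hball
    rw [Real.dist_eq, sub_zero, abs_of_pos he0]
    exact lt_of_le_of_lt (min_le_left _ _) (by linarith)
  refine ⟨e / (2 * (k + 2)), by positivity, fun x hx hxc p hp => ?_⟩
  set F : Fin n → ℝ := fun i => es (Finset.univ.erase i) (k + 1) x with hF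
  have hFpos : ∀ i, 0 < F i := fun i => hxc.erase (Finset.mem_univ i) (k + 1) le_rfl
  have hmono : ∀ i j : Fin n, i ≤ j → F i ≤ F j := by
    intro i j hij
    rcases eq_or_ne i j with rfl | hne
    · exact le_rfl
    have e1 : F i = x j * es ((Finset.univ.erase i).erase j) k x +
        es ((Finset.univ.erase i).erase j) (k + 1) x :=
      es_erase (Finset.mem_erase.2 ⟨hne.symm, Finset.mem_univ j⟩) k x
    have e2 : F j = x i * es ((Finset.univ.erase i).erase j) k x +
        es ((Finset.univ.erase i).erase j) (k + 1) x := by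
      rw [Finset.erase_right_comm]
      exact es_erase (Finset.mem_erase.2 ⟨hne, Finset.mem_univ i⟩) k x
    have e3 : 0 < es ((Finset.univ.erase i).erase j) k x :=
      (hxc.erase (Finset.mem_univ i)).erase (Finset.mem_erase.2 ⟨hne.symm, Finset.mem_univ j⟩)
        k le_rfl
    rw [e1, e2]
    have := mul_le_mul_of_nonneg_right (hx hij) e3.le
    linarith
  have hg := hxc.gradient_nonneg hk (subset_closure (mem_gardingCone_iff.2 hcone2))
  have hsplit : ∑ i, F i * (y0 - e • y1) i = ∑ i ∈ K, F i - e * ∑ i ∈ Kᶜ, F i := by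
    rw [← Finset.sum_add_sum_compl K, sub_eq_add_neg (∑ i ∈ K, F i), Finset.mul_sum,
      ← Finset.sum_neg_distrib]
    congr 1
    · exact Finset.sum_congr rfl fun i hi => by simp [hy0, hy1, hi]
    · refine Finset.sum_congr rfl fun i hi => ?_
      have : i ∉ K := Finset.mem_compl.1 hi
      simp [hy0, hy1, this, mul_comm]
  rw [hsplit] at hg
  have hKle : ∑ i ∈ K, F i ≤ (k + 2) * F p := by
    have : ∑ i ∈ K, F i ≤ ∑ i ∈ K, F p := Finset.sum_le_sum fun i hi => by
      refine hmono i p (Fin.le_def.2 ?_)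
      have := (Finset.mem_filter.1 hi).2
      omega
    rw [Finset.sum_const, hKc, nsmul_eq_mul] at this
    push_cast at this; exact this
  have htot := Finset.sum_add_sum_compl K F
  have he1 : e ≤ 1 := min_le_right _ _
  have hKnn : 0 ≤ ∑ i ∈ K, F i := Finset.sum_nonneg fun i _ => (hFpos i).le
  rw [div_mul_eq_mul_div, div_le_iff₀ (by positivity), ← htot]
  nlinarith

/-- With `r = a/b`, midpoint concavity gives `r'' ≤ 0`, hence `(log r)'' ≤ -(r'/r)²`. This
strengthened form, with the negative square, is what can be iterated. -/
theorem ratio_concave_second_order {a b : ℝ → ℝ} {a0 a1 a2 b0 b1 b2 : ℝ} (ha : J2 a a0 a1 a2)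
    (hb : J2 b b0 b1 b2) (ha0 : 0 < a0) (hb0 : 0 < b0)
    (h : ∀ᶠ t in 𝓝 0, a t / b t + a (-t) / b (-t) ≤ 2 * (a0 / b0)) :
    a2 / a0 - (a1 / a0) ^ 2 ≤ b2 / b0 - (b1 / b0) ^ 2 - (a1 / a0 - b1 / b0) ^ 2 := by
  have hinv : J2 (fun t => (b t)⁻¹) b0⁻¹ (-(b0 ^ 2)⁻¹ * b1)
      (2 * (b0 ^ 3)⁻¹ * b1 ^ 2 + -(b0 ^ 2)⁻¹ * b2) := by
    refine hb.comp (g' := fun y => -(y ^ 2)⁻¹) ?_ ?_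
    · filter_upwards [lt_mem_nhds hb0] with y hy using hasDerivAt_inv hy.ne'
    · have := ((hasDerivAt_pow 2 b0).fun_inv (by positivity)).fun_neg
      refine this.congr_deriv ?_
      field_simp
      norm_num
      ring
  have hr := ha.mul hinv
  have hneg : ∀ {f : ℝ → ℝ} {p q r : ℝ}, J2 f p q r → J2 (fun t => f (-t)) p (-q) r := by
    rintro f p q r ⟨f', rfl, rfl, h2, h3⟩
    have hn : Tendsto (fun t : ℝ => -t) (𝓝 0) (𝓝 0) := by simpa using tendsto_neg (0 : ℝ)
    refine ⟨fun t => - f' (-t), by simp, by simp, ?_, ?_⟩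
    · filter_upwards [hn.eventually h2] with t ht
      have := HasDerivAt.comp t ht (hasDerivAt_neg t)
      simpa [Function.comp_def] using this
    · have h3' : HasDerivAt f' r (-0) := by simpa using h3
      have := (HasDerivAt.comp (0 : ℝ) h3' (hasDerivAt_neg 0)).fun_neg
      simpa [Function.comp_def] using this
  have hsum := hr.add (hneg hr)
  have hmax : IsLocalMax (fun t => a t * (b t)⁻¹ + a (-t) * (b (-t))⁻¹) 0 := by
    filter_upwards [h] with t ht
    simp only [neg_zero, ha.val, hb.val, ← div_eq_mul_inv]
    linarith
  have h2 := (hsum.of_isLocalMax hmax).2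
  have h3 : a2 * b0⁻¹ + 2 * (a1 * (-(b0 ^ 2)⁻¹ * b1)) +
      a0 * (2 * (b0 ^ 3)⁻¹ * b1 ^ 2 + -(b0 ^ 2)⁻¹ * b2) ≤ 0 := by linarith
  have h4 : (a2 * b0⁻¹ + 2 * (a1 * (-(b0 ^ 2)⁻¹ * b1)) +
      a0 * (2 * (b0 ^ 3)⁻¹ * b1 ^ 2 + -(b0 ^ 2)⁻¹ * b2)) * (b0 / a0) ≤ 0 :=
    mul_nonpos_of_nonpos_of_nonneg h3 (by positivity)
  have h5 : (a2 * b0⁻¹ + 2 * (a1 * (-(b0 ^ 2)⁻¹ * b1)) +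
      a0 * (2 * (b0 ^ 3)⁻¹ * b1 ^ 2 + -(b0 ^ 2)⁻¹ * b2)) * (b0 / a0) =
      a2 / a0 - 2 * (a1 / a0) * (b1 / b0) + 2 * (b1 / b0) ^ 2 - b2 / b0 := by
    field_simp
    ring
  rw [h5] at h4
  nlinarith

variable {ι : Type*}

theorem es_add_one (s : Finset ι) (x y : ι → ℝ) : es s 1 (x + y) = es s 1 x + es s 1 y := by
  simp [es_one, Finset.sum_add_distrib]

theorem exists_J2_es (s : Finset ι) (m : ℕ) (x ξ : ι → ℝ) :
    ∃ b c, J2 (fun t => es s m (x + t • ξ)) (es s m x) b c := by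
  have h : ContDiff ℝ 2 fun t : ℝ => es s m (x + t • ξ) := by
    simp only [es, Pi.add_apply, Pi.smul_apply, smul_eq_mul]
    fun_prop
  have := J2.of_contDiffAt (h.contDiffAt (x := 0)) 1
  simp only [zero_add, smul_eq_mul, mul_one, zero_smul, add_zero] at this
  exact ⟨_, _, this⟩

theorem Cone.eventually_line {s : Finset ι} {k : ℕ} {x : ι → ℝ} (h : Cone s k x) (ξ : ι → ℝ) :
    ∀ᶠ t in 𝓝 (0 : ℝ), Cone s k (x + t • ξ) := by
  have hc : Continuous fun t : ℝ => x + t • ξ := by fun_prop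
  refine hc.continuousAt.eventually (IsOpen.mem_nhds (isOpen_cone _ _) ?_)
  simpa using h

variable [DecidableEq ι]

theorem Cone.quotient_line {s : Finset ι} {k : ℕ} {x : ι → ℝ} (h : Cone s k x) (ξ : ι → ℝ) :
    ∀ᶠ t in 𝓝 (0 : ℝ), es s (k + 1) (x + t • ξ) / es s k (x + t • ξ) +
      es s (k + 1) (x + (-t) • ξ) / es s k (x + (-t) • ξ) ≤
        2 * (es s (k + 1) x / es s k x) := by
  have hn : Tendsto (fun t : ℝ => -t) (𝓝 0) (𝓝 0) := by simpa using tendsto_neg (0 : ℝ)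
  filter_upwards [h.eventually_line ξ, hn.eventually (h.eventually_line ξ)] with t h1 h2
  refine (h1.quotient_add_le h2).trans (le_of_eq ?_)
  have : x + t • ξ + (x + (-t) • ξ) = (2 : ℝ) • x := by
    ext i; simp; ring
  rw [this, es_smul, es_smul, pow_succ]
  have := (h k le_rfl).ne'
  field_simp

/-- Second order form of the concavity of `(σ_k / ℓ) ^ (1 / (k - 1))` on Gårding's cone, where `ℓ`
is the sum of the variables outside a set of `k - 2` indices. -/
theorem Cone.log_concave {s J : Finset ι} (hJ : J ⊆ s) {x : ι → ℝ}
    (hx : Cone s (J.card + 2) x) (ξ : ι → ℝ) {p1 p2 : ℝ}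
    (hp : J2 (fun t => es s (J.card + 2) (x + t • ξ)) (es s (J.card + 2) x) p1 p2) :
    p2 / es s (J.card + 2) x - (p1 / es s (J.card + 2) x) ^ 2 ≤
      -(es (s \ J) 1 ξ / es (s \ J) 1 x) ^ 2 - ((J.card : ℝ) + 1)⁻¹ *
        (p1 / es s (J.card + 2) x - es (s \ J) 1 ξ / es (s \ J) 1 x) ^ 2 := by
  induction J using Finset.induction_on generalizing s p1 p2 with
  | empty =>
    simp only [Finset.card_empty, zero_add, Finset.sdiff_empty, Nat.cast_zero] at hx hp ⊢
    have h1 : J2 (fun t => es s 1 (x + t • ξ)) (es s 1 x) (es s 1 ξ) 0 := by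
      have he : ∀ t : ℝ, es s 1 (x + t • ξ) = es s 1 x + t * es s 1 ξ := fun t => by
        rw [es_add_one, es_smul, pow_one]
      simp only [he]
      exact ((J2.const _).add (J2.id.mul (J2.const _))).congr_coeff (by ring) (by ring) (by ring)
    have := ratio_concave_second_order hp h1 (hx 2 le_rfl) (hx 1 (by omega))
      ((hx.mono (by omega : 1 ≤ 2)).quotient_line ξ)
    simp only [zero_div] at this
    linarith
  | insert i J hi ih =>
    rw [Finset.card_insert_of_notMem hi] at hx hp ⊢
    have his : i ∈ s := hJ (Finset.mem_insert_self i J)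
    have hx' : Cone (s.erase i) (J.card + 2) x := hx.erase his
    have hJ' : J ⊆ s.erase i := fun j hj => Finset.mem_erase.2
      ⟨fun h => hi (h ▸ hj), hJ (Finset.mem_insert_of_mem hj)⟩
    obtain ⟨b1, b2, hb⟩ := exists_J2_es (s.erase i) (J.card + 2) x ξ
    have h1 := ih hJ' hx' hb
    have hset : s.erase i \ J = s \ insert i J := by
      rw [Finset.sdiff_insert, Finset.erase_sdiff_comm]
    rw [hset] at h1
    have hd : ∀ z : ι → ℝ, Cone (s.erase i) (J.card + 2) z →
        es s (J.card + 1 + 2) z / es (s.erase i) (J.card + 2) z =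
          z i + es (s.erase i) (J.card + 2 + 1) z / es (s.erase i) (J.card + 2) z := fun z hz => by
      have := (hz _ le_rfl).ne'
      rw [show J.card + 1 + 2 = J.card + 2 + 1 by omega, es_erase his]; field_simp
    have hn : Tendsto (fun t : ℝ => -t) (𝓝 0) (𝓝 0) := by simpa using tendsto_neg (0 : ℝ)
    -- The ratio of `σ_k` to its counterpart without the variable `i` is `x_i` plus a concave
    -- quotient; removing the indices of `J` one by one ends at `σ_2/σ_1` on `s \ J`.
    have h2 := ratio_concave_second_order hp hb (hx _ le_rfl) (hx' _ le_rfl) (by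
      filter_upwards [hx'.quotient_line ξ, hx'.eventually_line ξ,
        hn.eventually (hx'.eventually_line ξ)] with t e1 e2 e3
      rw [hd _ e2, hd _ e3, hd _ hx']
      simp only [Pi.add_apply, Pi.smul_apply, smul_eq_mul]
      linarith)
    set P := p1 / es s (J.card + 1 + 2) x
    set Q := b1 / es (s.erase i) (J.card + 2) x
    set L := es (s \ insert i J) 1 ξ / es (s \ insert i J) 1 x
    -- Cauchy–Schwarz with weights `|J| + 1` and `1` merges the negative square gained at this step
    -- with the one from the induction.
    have h3 : ((J.card : ℝ) + 1 + 1)⁻¹ * (P - L) ^ 2 ≤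
        ((J.card : ℝ) + 1)⁻¹ * (Q - L) ^ 2 + (P - Q) ^ 2 := by
      have hN : (0 : ℝ) < (J.card : ℝ) + 1 := by positivity
      have := sq_div_add_le (x := Q - L) (y := P - Q) hN one_pos le_rfl
      rw [show Q - L + (P - Q) = P - L by ring] at this
      simpa [div_eq_inv_mul] using this
    push_cast
    linarith

end ConeCalculus

/-! ### Almost everywhere subsolutions are viscosity subsolutions -/

section Viscosity

open Filter Topology Metric

variable {E : Type*} [NormedAddCommGroup E]

theorem shift_mem_ball [NormedSpace ℝ E] {x b y : E} {ε ρ t : ℝ} (ht : t ∈ ball (0 : ℝ) (ρ / (‖b‖ + 1)))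
    (hy : y ∈ ball (0 : E) ε) : x + t • b + y ∈ ball x (ε + ρ) := by
  rw [mem_ball_zero_iff] at hy
  rw [mem_ball_zero_iff, Real.norm_eq_abs, lt_div_iff₀ (by positivity)] at ht
  rw [mem_ball_iff_norm, show x + t • b + y - x = y + t • b by abel]
  have h1 : ‖t • b‖ < ρ := by
    rw [norm_smul, Real.norm_eq_abs]
    nlinarith [abs_nonneg t]
  calc _ ≤ ‖y‖ + ‖t • b‖ := norm_add_le _ _
    _ < _ := by linarith

theorem continuousOn_ball_shift {G : E → ℝ} {S : Set E} (hG : ContinuousOn G S) {x : E} {ε : ℝ}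
    (hS : ∀ y ∈ ball (0 : E) ε, x + y ∈ S) : ContinuousOn (fun y => G (x + y)) (ball 0 ε) :=
  hG.comp (by fun_prop) hS

variable [MeasurableSpace E] [BorelSpace E] (μ : Measure E) [μ.IsAddHaarMeasure]

theorem ae_shift {P : E → Prop} {Ω : Set E} (hΩ : MeasurableSet Ω)
    (h : ∀ᵐ x ∂μ.restrict Ω, P x) {x : E} {ε : ℝ} (hS : ∀ y ∈ ball (0 : E) ε, x + y ∈ Ω) :
    ∀ᵐ y ∂μ.restrict (ball 0 ε), P (x + y) := by
  rw [ae_restrict_iff' hΩ] at h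
  rw [ae_restrict_iff' measurableSet_ball]
  filter_upwards [(measurePreserving_add_left μ x).quasiMeasurePreserving.ae h] with y hy hyb
  exact hy (hS y hyb)

variable [InnerProductSpace ℝ E] [FiniteDimensional ℝ E]

theorem integrableOn_ball_shift {G : E → ℝ} {S : Set E} {K : ℝ≥0} (hG : LipschitzOnWith K G S)
    {x : E} {ε : ℝ} (hε : 0 < ε) (hS : ∀ y ∈ ball (0 : E) ε, x + y ∈ S) :
    IntegrableOn (fun y => G (x + y)) (ball 0 ε) μ := by
  have : IsFiniteMeasure (μ.restrict (ball (0 : E) ε)) :=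
    ⟨by rw [Measure.restrict_apply_univ]; exact measure_ball_lt_top⟩
  refine Integrable.of_bound ((continuousOn_ball_shift hG.continuousOn hS).aestronglyMeasurable
    measurableSet_ball) (|G x| + K * ε) ?_
  rw [ae_restrict_iff' measurableSet_ball]
  refine .of_forall fun y hy => ?_
  have hx : x ∈ S := by simpa using hS 0 (mem_ball_self hε)
  have h1 := hG.dist_le_mul (x + y) (hS y hy) x hx
  rw [mem_ball_zero_iff] at hy
  rw [dist_eq_norm, dist_eq_norm, add_sub_cancel_left] at h1
  have h2 : (K : ℝ) * ‖y‖ ≤ K * ε := by gcongr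
  have h3 : ‖G (x + y)‖ ≤ ‖G (x + y) - G x‖ + ‖G x‖ := by
    simpa using norm_add_le (G (x + y) - G x) (G x)
  rw [Real.norm_eq_abs (G x)] at h3
  linarith

/-- Difference quotients of a Lipschitz function are bounded by `K ‖b‖`, so dominated convergence
permits differentiation under the integral even though the derivative exists only almost everywhere.
-/
theorem hasDerivAt_ball_integral {G : E → ℝ} {S : Set E} {K : ℝ≥0} (hG : LipschitzOnWith K G S)
    {x b : E} {ε ρ : ℝ} (hε : 0 < ε) (hρ : 0 < ρ) (hS : ball x (ε + ρ) ⊆ S) {G' : E → ℝ}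
    (hm : AEStronglyMeasurable G' (μ.restrict (ball 0 ε)))
    (hd : ∀ᵐ y ∂μ.restrict (ball 0 ε), HasDerivAt (fun t : ℝ => G (x + t • b + y)) (G' y) 0) :
    IntegrableOn G' (ball 0 ε) μ ∧
      HasDerivAt (fun t : ℝ => ∫ y in ball 0 ε, G (x + t • b + y) ∂μ)
        (∫ y in ball 0 ε, G' y ∂μ) 0 := by
  have hs0 : (0 : ℝ) < ρ / (‖b‖ + 1) := by positivity
  refine hasDerivAt_integral_of_dominated_loc_of_lip (s := ball (0 : ℝ) (ρ / (‖b‖ + 1)))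
    (bound := fun _ => K * ‖b‖) (ball_mem_nhds _ hs0) ?_ ?_ hm ?_ ?_ hd
  · filter_upwards [ball_mem_nhds _ hs0] with t ht
    exact (continuousOn_ball_shift hG.continuousOn fun y hy =>
      hS (shift_mem_ball ht hy)).aestronglyMeasurable measurableSet_ball
  · exact integrableOn_ball_shift μ hG hε fun y hy => hS (shift_mem_ball (mem_ball_self hs0) hy)
  · rw [ae_restrict_iff' measurableSet_ball]
    refine .of_forall fun y hy => LipschitzOnWith.of_dist_le_mul fun t ht t' ht' => ?_
    refine (hG.dist_le_mul _ (hS (shift_mem_ball ht hy)) _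
      (hS (shift_mem_ball ht' hy))).trans (le_of_eq ?_)
    rw [dist_eq_norm, dist_eq_norm, show x + t • b + y - (x + t' • b + y) = (t - t') • b by
      rw [sub_smul]; abel, norm_smul, Real.coe_nnabs, abs_of_nonneg (by positivity)]
    ring
  · have : IsFiniteMeasure (μ.restrict (ball (0 : E) ε)) :=
      ⟨by rw [Measure.restrict_apply_univ]; exact measure_ball_lt_top⟩
    exact integrable_const _

/-- Averages over balls of a function with Lipschitz gradient are twice differentiable along
lines, and their second derivatives are the averages of the almost everywhere Hessian. -/
theorem J2.ball_integral {v : E → ℝ} {Ω : Set E} (hΩ : IsOpen Ω) {D K : ℝ≥0}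
    (hdiff : ∀ x ∈ Ω, DifferentiableAt ℝ v x) (hD : ∀ x ∈ Ω, ‖fderiv ℝ v x‖₊ ≤ D)
    (hK : LipschitzOnWith K (fderiv ℝ v) Ω)
    (hae : ∀ᵐ x ∂μ.restrict Ω, DifferentiableAt ℝ (fderiv ℝ v) x) {x b : E} {ε ρ : ℝ} (hε : 0 < ε)
    (hρ : 0 < ρ) (hS : ball x (ε + 2 * ρ) ⊆ Ω) :
    IntegrableOn (fun y => fderiv ℝ (fderiv ℝ v) (x + y) b b) (ball 0 ε) μ ∧
    J2 (fun t : ℝ => ∫ y in ball 0 ε, v (x + t • b + y) ∂μ) (∫ y in ball 0 ε, v (x + y) ∂μ)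
      (∫ y in ball 0 ε, fderiv ℝ v (x + y) b ∂μ)
      (∫ y in ball 0 ε, fderiv ℝ (fderiv ℝ v) (x + y) b b ∂μ) := by
  have hlip : LipschitzOnWith D v (ball x (ε + 2 * ρ)) :=
    (convex_ball x _).lipschitzOnWith_of_nnnorm_fderiv_le (fun y hy => hdiff y (hS hy))
      fun y hy => hD y (hS hy)
  have hlip2 : LipschitzOnWith (K * ‖b‖₊) (fun y => fderiv ℝ v y b) (ball x (ε + 2 * ρ)) := by
    refine LipschitzOnWith.of_dist_le_mul fun y hy z hz => ?_
    have h1 := hK.dist_le_mul y (hS hy) z (hS hz)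
    rw [dist_eq_norm] at h1 ⊢
    rw [← sub_apply]
    calc _ ≤ ‖fderiv ℝ v y - fderiv ℝ v z‖ * ‖b‖ := ContinuousLinearMap.le_opNorm _ _
      _ ≤ (K * dist y z) * ‖b‖ := by gcongr
      _ = _ := by push_cast; ring
  have hline : ∀ z y : E, HasDerivAt (fun t : ℝ => z + t • b + y) b 0 := fun z y => by
    simpa using (((hasDerivAt_id (0 : ℝ)).smul_const b).const_add z).add_const y
  have hm1 : ∀ z : E, Measurable fun y => fderiv ℝ v (z + y) b := fun z =>
    (measurable_fderiv_apply_const ℝ v b).comp (measurable_const_add z)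
  have hm2 : Measurable fun y => fderiv ℝ (fderiv ℝ v) (x + y) b b := by
    have h1 := (measurable_fderiv_apply_const ℝ (fderiv ℝ v) b).comp (measurable_const_add x)
    exact (ContinuousLinearMap.apply ℝ ℝ b).continuous.measurable.comp h1
  have hae' := ae_shift μ hΩ.measurableSet hae (x := x) (ε := ε) fun y hy => hS (by
    rw [mem_ball_zero_iff] at hy
    rw [mem_ball_iff_norm, add_sub_cancel_left]; linarith)
  have second := hasDerivAt_ball_integral μ hlip2 (x := x) (b := b) hε hρ
    (ball_subset_ball (by linarith)) hm2.aestronglyMeasurable (by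
      filter_upwards [hae'] with y hy
      have h2 : HasFDerivAt (fderiv ℝ v) (fderiv ℝ (fderiv ℝ v) (x + y)) (x + (0 : ℝ) • b + y) := by
        simpa using hy.hasFDerivAt
      exact ((ContinuousLinearMap.apply ℝ ℝ b).hasFDerivAt.comp _ h2).comp_hasDerivAt (0 : ℝ)
        (hline x y))
  refine ⟨second.1, fun t => ∫ y in ball 0 ε, fderiv ℝ v (x + t • b + y) b ∂μ, by simp, by simp,
    ?_, second.2⟩
  have hs0 : (0 : ℝ) < ρ / (‖b‖ + 1) := by positivity
  filter_upwards [ball_mem_nhds _ hs0] with t ht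
  -- The radius `ε + 2ρ` is spent twice: one `ρ` moves the base point along the line, the other
  -- leaves room to differentiate there.
  have hsub : ball (x + t • b) (ε + ρ) ⊆ ball x (ε + 2 * ρ) := by
    refine ball_subset_ball' ?_
    have : dist (x + t • b) x ≤ ρ := by
      rw [dist_eq_norm, add_sub_cancel_left, norm_smul]
      rw [mem_ball_zero_iff, lt_div_iff₀ (by positivity)] at ht
      nlinarith [norm_nonneg t]
    linarith
  have first := (hasDerivAt_ball_integral μ (hlip.mono hsub) (x := x + t • b) (b := b) hε hρ
    subset_rfl (hm1 (x + t • b)).aestronglyMeasurable (by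
      rw [ae_restrict_iff' measurableSet_ball]
      refine .of_forall fun y hy => ?_
      have hmem : x + t • b + y ∈ Ω := hS (hsub (by
        rw [mem_ball_zero_iff] at hy
        rw [mem_ball_iff_norm, add_sub_cancel_left]; linarith))
      have h2 : HasFDerivAt v (fderiv ℝ v (x + t • b + y)) (x + t • b + (0 : ℝ) • b + y) := by
        simpa using (hdiff _ hmem).hasFDerivAt
      exact h2.comp_hasDerivAt (0 : ℝ) (hline (x + t • b) y))).2
  have h0 : HasDerivAt (fun s : ℝ => s - t) 1 t := (hasDerivAt_id t).sub_const t
  have first' : HasDerivAt (fun s : ℝ => ∫ y in ball 0 ε, v (x + t • b + s • b + y) ∂μ)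
      (∫ y in ball 0 ε, fderiv ℝ v (x + t • b + y) b ∂μ) (t - t) := by simpa using first
  have := HasDerivAt.scomp (h := fun s : ℝ => s - t) t first' h0
  simp only [one_smul] at this
  refine this.congr_of_eventuallyEq (.of_forall fun s => ?_)
  simp only [Function.comp]
  congr 1
  ext y
  congr 1
  rw [sub_smul]; abel

/-- A function with Lipschitz gradient which is a subsolution almost everywhere of a constant
coefficient equation is a subsolution in the sense of test functions touching from above. -/
theorem viscosity_subsolution {ι : Type*} [Fintype ι] {v : E → ℝ} {Ω : Set E} (hΩ : IsOpen Ω)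
    {D K : ℝ≥0} (hdiff : ∀ x ∈ Ω, DifferentiableAt ℝ v x) (hD : ∀ x ∈ Ω, ‖fderiv ℝ v x‖₊ ≤ D)
    (hK : LipschitzOnWith K (fderiv ℝ v) Ω) {F : ι → ℝ} (hF : ∀ i, 0 ≤ F i) {b : ι → E}
    (hae : ∀ᵐ x ∂μ.restrict Ω, DifferentiableAt ℝ (fderiv ℝ v) x ∧
      0 ≤ ∑ i, F i * fderiv ℝ (fderiv ℝ v) x (b i) (b i))
    {x₀ : E} (hx₀ : x₀ ∈ Ω) {q : E → ℝ} (hq : ContDiffAt ℝ 2 q x₀)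
    (hle : ∀ᶠ x in 𝓝 x₀, v x ≤ q x) (heq : v x₀ = q x₀) :
    0 ≤ ∑ i, F i * fderiv ℝ (fun y => fderiv ℝ q y (b i)) x₀ (b i) := by
  by_contra! hneg
  set L : E → ℝ := fun x => ∑ i, F i * fderiv ℝ (fun y => fderiv ℝ q y (b i)) x (b i) with hL
  set B : ℝ := ∑ i, F i * ‖b i‖ ^ 2 with hB
  have hB0 : 0 ≤ B := Finset.sum_nonneg fun i _ => mul_nonneg (hF i) (sq_nonneg _)
  -- The penalty `η |x - x₀|²` adds `2ηB` to the operator; this choice keeps it negative near `x₀`.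
  set η : ℝ := -L x₀ / (4 * (B + 1)) with hη
  have hη0 : 0 < η := div_pos (by linarith) (by positivity)
  have hηB : 2 * η * B < -L x₀ := by
    have : η * (4 * (B + 1)) = -L x₀ := by rw [hη]; field_simp
    nlinarith
  have hLc : ContinuousAt L x₀ := by
    rw [hL]
    refine tendsto_finsetSum _ fun i _ => Tendsto.const_mul _ ?_
    have h1 : ContDiffAt ℝ 1 (fun y => fderiv ℝ q y (b i)) x₀ :=
      (hq.fderiv_right (m := 1) (by norm_num)).clm_apply contDiffAt_const
    have h2 : ContDiffAt ℝ 0 (fun y => fderiv ℝ (fun y => fderiv ℝ q y (b i)) y (b i)) x₀ :=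
      (h1.fderiv_right (m := 0) (by norm_num)).clm_apply contDiffAt_const
    exact h2.continuousAt
  have hev : ∀ᶠ x in 𝓝 x₀, x ∈ Ω ∧ ContDiffAt ℝ 2 q x ∧ v x ≤ q x ∧ L x + 2 * η * B < 0 := by
    have h1 : ∀ᶠ x in 𝓝 x₀, x ∈ Ω := hΩ.mem_nhds hx₀
    have h2 : ∀ᶠ x in 𝓝 x₀, L x + 2 * η * B < 0 :=
      (hLc.add continuousAt_const).eventually_lt_const (by simp only [Pi.add_apply]; linarith)
    exact h1.and ((hq.eventually (by simp)).and (hle.and h2))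
  obtain ⟨R, hR, hball⟩ := Metric.eventually_nhds_iff_ball.1 hev
  set r : ℝ := R / 4 with hr
  have hr0 : 0 < r := by positivity
  -- The averaging radius is small enough that replacing `v` by its average costs at most `η r²/4`,
  -- so that two such errors stay below the penalty `η r²` on the sphere of radius `r`.
  set ε : ℝ := min r (η * r ^ 2 / (4 * (D + 1))) with hε
  have hε0 : 0 < ε := by positivity
  have hεr : ε ≤ r := min_le_left _ _
  have hεD : D * ε ≤ η * r ^ 2 / 4 := by
    have : ε * (4 * ((D : ℝ) + 1)) ≤ η * r ^ 2 := by
      rw [← le_div_iff₀ (by positivity)]; exact min_le_right _ _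
    nlinarith
  have hlip : LipschitzOnWith D v (ball x₀ R) :=
    (convex_ball x₀ _).lipschitzOnWith_of_nnnorm_fderiv_le (fun y hy => hdiff y (hball y hy).1)
      fun y hy => hD y (hball y hy).1
  have hmem : ∀ x ∈ closedBall x₀ r, ∀ y ∈ ball (0 : E) ε, x + y ∈ ball x₀ R := by
    intro x hx y hy
    rw [mem_ball_zero_iff] at hy
    rw [mem_closedBall_iff_norm] at hx
    rw [mem_ball_iff_norm, show x + y - x₀ = (x - x₀) + y by abel]
    calc _ ≤ ‖x - x₀‖ + ‖y‖ := norm_add_le _ _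
      _ < R := by linarith
  set c : ℝ := μ.real (ball (0 : E) ε) with hc
  have hc0 : 0 < c := by
    rw [hc, measureReal_def]
    exact ENNReal.toReal_pos (measure_ball_pos μ 0 hε0).ne' measure_ball_lt_top.ne
  set V : E → ℝ := fun x => ∫ y in ball 0 ε, v (x + y) ∂μ with hV
  have hVv : ∀ x ∈ closedBall x₀ r, |V x - c * v x| ≤ c * (η * r ^ 2 / 4) := by
    intro x hx
    have hintegrable := integrableOn_ball_shift μ hlip hε0 (hmem x hx)
    have h1 : V x - c * v x = ∫ y in ball 0 ε, (v (x + y) - v x) ∂μ := by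
      rw [integral_sub hintegrable (integrableOn_const measure_ball_lt_top.ne), setIntegral_const,
        smul_eq_mul]
    have h2 := norm_setIntegral_le_of_norm_le_const (μ := μ) (s := ball (0 : E) ε)
      (f := fun y => v (x + y) - v x) (C := η * r ^ 2 / 4) measure_ball_lt_top fun y hy => by
        have h3 := hlip.dist_le_mul (x + y) (hmem x hx y hy) x
          (by simpa using hmem x hx 0 (mem_ball_self hε0))
        rw [dist_eq_norm, dist_eq_norm, add_sub_cancel_left] at h3
        rw [mem_ball_zero_iff] at hy
        have : (D : ℝ) * ‖y‖ ≤ D * ε := by gcongr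
        linarith
    rw [h1, ← Real.norm_eq_abs]
    linarith
  set m : E → ℝ := fun x => V x - c * (q x + η * ‖x - x₀‖ ^ 2) with hm
  have hVcont : ContinuousOn V (closedBall x₀ r) := by
    refine LipschitzOnWith.continuousOn (K := (c * D).toNNReal)
      (LipschitzOnWith.of_dist_le_mul fun x hx z hz => ?_)
    have hx' := integrableOn_ball_shift μ hlip hε0 (hmem x hx)
    have hz' := integrableOn_ball_shift μ hlip hε0 (hmem z hz)
    have h2 := norm_setIntegral_le_of_norm_le_const (μ := μ) (s := ball (0 : E) ε)
      (f := fun y => v (x + y) - v (z + y)) (C := D * dist x z) measure_ball_lt_top fun y hy => by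
        have h3 := hlip.dist_le_mul (x + y) (hmem x hx y hy) (z + y) (hmem z hz y hy)
        rwa [dist_add_right, dist_eq_norm] at h3
    rw [integral_sub hx' hz'] at h2
    rw [dist_eq_norm]
    refine h2.trans (le_of_eq ?_)
    rw [Real.coe_toNNReal _ (by positivity)]; ring
  have hmcont : ContinuousOn m (closedBall x₀ r) := by
    refine hVcont.sub (ContinuousOn.const_mul ?_ c)
    refine ContinuousOn.add (fun x hx => ?_) (by fun_prop)
    exact (hball x (closedBall_subset_ball (by linarith) hx)).2.1.continuousAt.continuousWithinAt
  obtain ⟨x₁, hx₁, hmax⟩ := (isCompact_closedBall x₀ r).exists_isMaxOn ⟨x₀, by simp [hr0.le]⟩ hmcont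
  have hx₁R := hball x₁ (closedBall_subset_ball (by linarith) hx₁)
  -- The maximum of the penalized difference is interior, so the second derivative test applies
  -- there to the averaged function, which has a genuine second derivative along lines.
  have hx₁r : dist x₁ x₀ < r := by
    by_contra! hge
    have hd : ‖x₁ - x₀‖ = r := le_antisymm (mem_closedBall_iff_norm.1 hx₁) (by rwa [← dist_eq_norm])
    have h1 : m x₀ ≤ m x₁ := hmax (by simp [hr0.le])
    have a1 := (abs_le.1 (hVv x₀ (by simp [hr0.le]))).1
    have a2 := (abs_le.1 (hVv x₁ hx₁)).2
    have a3 : c * v x₁ ≤ c * q x₁ := mul_le_mul_of_nonneg_left hx₁R.2.2.1 hc0.le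
    simp only [hm, hd, sub_self, norm_zero] at h1
    rw [heq] at a1
    have a4 : 0 < c * (η * r ^ 2) := by positivity
    nlinarith
  have hloc : IsLocalMax m x₁ := by
    have : closedBall x₀ r ∈ 𝓝 x₁ :=
      mem_of_superset (isOpen_ball.mem_nhds (mem_ball.2 hx₁r)) ball_subset_closedBall
    exact hmax.isLocalMax this
  have hballsub : ball x₁ (ε + 2 * (r / 2)) ⊆ Ω := by
    refine (ball_subset_ball' ?_).trans fun y hy => (hball y hy).1
    linarith
  have hJ := fun i => J2.ball_integral μ hΩ hdiff hD hK (hae.mono fun _ h => h.1) (x := x₁)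
    (b := b i) hε0 (half_pos hr0) hballsub
  have hsecond : ∀ i, (∫ y in ball 0 ε, fderiv ℝ (fderiv ℝ v) (x₁ + y) (b i) (b i) ∂μ) ≤
      c * (fderiv ℝ (fun y => fderiv ℝ q y (b i)) x₁ (b i) + 2 * η * ‖b i‖ ^ 2) := by
    intro i
    have j1 := J2.of_contDiffAt hx₁R.2.1 (b i)
    have j2 : J2 (fun t : ℝ => η * ‖x₁ + t • b i - x₀‖ ^ 2) (η * ‖x₁ - x₀‖ ^ 2)
        (η * (2 * inner ℝ (x₁ - x₀) (b i))) (2 * η * ‖b i‖ ^ 2) := by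
      have he : ∀ t : ℝ, ‖x₁ + t • b i - x₀‖ ^ 2 = ‖x₁ - x₀‖ ^ 2 +
          t * (2 * inner ℝ (x₁ - x₀) (b i)) + t * t * ‖b i‖ ^ 2 := fun t => by
        rw [show x₁ + t • b i - x₀ = (x₁ - x₀) + t • b i by abel, norm_add_sq_real,
          inner_smul_right, norm_smul, mul_pow, Real.norm_eq_abs, sq_abs]
        ring
      simp only [he]
      exact ((((J2.const _).add (J2.id.mul (J2.const _))).add
        ((J2.id.mul J2.id).mul (J2.const _))).const_mul η).congr_coeff
          (by ring) (by ring) (by ring)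
    have j3 := (hJ i).2.sub ((j1.add j2).const_mul c)
    have hmaxline : IsLocalMax (fun t : ℝ => (∫ y in ball 0 ε, v (x₁ + t • b i + y) ∂μ) -
        c * (q (x₁ + t • b i) + η * ‖x₁ + t • b i - x₀‖ ^ 2)) 0 := by
      have hcont : Tendsto (fun t : ℝ => x₁ + t • b i) (𝓝 0) (𝓝 x₁) := by
        have : ContinuousAt (fun t : ℝ => x₁ + t • b i) 0 := by fun_prop
        simpa using this.tendsto
      filter_upwards [hcont.eventually hloc] with t ht
      simpa [hm, hV] using ht
    have := (j3.of_isLocalMax hmaxline).2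
    linarith
  have htot : ∑ i, F i * (∫ y in ball 0 ε, fderiv ℝ (fderiv ℝ v) (x₁ + y) (b i) (b i) ∂μ) ≤
      c * (L x₁ + 2 * η * B) := by
    have : c * (L x₁ + 2 * η * B) = ∑ i, F i *
        (c * (fderiv ℝ (fun y => fderiv ℝ q y (b i)) x₁ (b i) + 2 * η * ‖b i‖ ^ 2)) := by
      rw [hL, hB, Finset.mul_sum, ← Finset.sum_add_distrib, Finset.mul_sum]
      exact Finset.sum_congr rfl fun i _ => by ring
    rw [this]
    exact Finset.sum_le_sum fun i _ => mul_le_mul_of_nonneg_left (hsecond i) (hF i)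
  have hnonneg : 0 ≤ ∑ i, F i *
      (∫ y in ball 0 ε, fderiv ℝ (fderiv ℝ v) (x₁ + y) (b i) (b i) ∂μ) := by
    have : ∑ i, F i * (∫ y in ball 0 ε, fderiv ℝ (fderiv ℝ v) (x₁ + y) (b i) (b i) ∂μ) =
        ∫ y in ball 0 ε, ∑ i, F i * fderiv ℝ (fderiv ℝ v) (x₁ + y) (b i) (b i) ∂μ := by
      rw [integral_finsetSum _ fun i _ => (hJ i).1.const_mul (F i)]
      exact Finset.sum_congr rfl fun i _ => (integral_const_mul _ _).symm
    rw [this]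
    refine integral_nonneg_of_ae ?_
    have := ae_shift μ hΩ.measurableSet (hae.mono fun _ h => h.2) (x := x₁) (ε := ε)
      fun y hy => (hball _ (hmem x₁ hx₁ y hy)).1
    exact this
  have : c * (L x₁ + 2 * η * B) < 0 := mul_neg_of_pos_of_neg hc0 hx₁R.2.2.2
  linarith

end Viscosity

/-! ### Symmetric forms, orthonormal bases and eigenvalues -/

section Spectral

variable {n : ℕ}

theorem es_comp_perm (m : ℕ) (l : Fin n → ℝ) (τ : Equiv.Perm (Fin n)) :
    es Finset.univ m (l ∘ τ) = es Finset.univ m l := by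
  rcases lt_or_ge n m with h | h
  · rw [es_eq_zero (by simpa using h), es_eq_zero (by simpa using h)]
  · rw [es_eq_coeff _ m (n - m) _ (by simp; omega), es_eq_coeff _ m (n - m) _ (by simp; omega)]
    congr 1
    exact Equiv.prod_comp τ fun i => Polynomial.X + Polynomial.C (l i)

theorem Cone.comp_perm {k : ℕ} {l : Fin n → ℝ} (h : Cone Finset.univ k l)
    (τ : Equiv.Perm (Fin n)) : Cone Finset.univ k (l ∘ τ) := fun m hm => by
  rw [es_comp_perm]; exact h m hm

theorem comp_perm_mem_closure {k : ℕ} {l : Fin n → ℝ} (h : l ∈ closure (gardingCone n k))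
    (τ : Equiv.Perm (Fin n)) : l ∘ τ ∈ closure (gardingCone n k) := by
  have hc : Continuous fun l : Fin n → ℝ => l ∘ τ := by
    unfold Function.comp; fun_prop
  exact map_mem_closure (f := fun l : Fin n → ℝ => l ∘ τ) hc h fun l hl =>
    mem_gardingCone_iff.2 ((mem_gardingCone_iff.1 hl).comp_perm τ)

/-- The matrix of a bilinear form in an orthonormal basis. -/
def formMatrix (b : OrthonormalBasis (Fin n) ℝ (EuclideanSpace ℝ (Fin n)))
    (H : EuclideanSpace ℝ (Fin n) →L[ℝ] EuclideanSpace ℝ (Fin n) →L[ℝ] ℝ) :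
    Matrix (Fin n) (Fin n) ℝ := Matrix.of fun p q => H (b p) (b q)

theorem form_eq_sum (b : OrthonormalBasis (Fin n) ℝ (EuclideanSpace ℝ (Fin n)))
    (H : EuclideanSpace ℝ (Fin n) →L[ℝ] EuclideanSpace ℝ (Fin n) →L[ℝ] ℝ)
    (v w : EuclideanSpace ℝ (Fin n)) :
    H v w = ∑ p, ∑ q, inner ℝ (b p) v * inner ℝ (b q) w * formMatrix b H p q := by
  conv_lhs => rw [← b.sum_repr' v, ← b.sum_repr' w]
  simp only [map_sum, map_smul, sum_apply, smul_apply,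
    smul_eq_mul, Finset.mul_sum, formMatrix, Matrix.of_apply]
  rw [Finset.sum_comm]
  exact Finset.sum_congr rfl fun p _ => Finset.sum_congr rfl fun q _ => by ring

theorem formMatrix_eq_conj (b c : OrthonormalBasis (Fin n) ℝ (EuclideanSpace ℝ (Fin n)))
    (H : EuclideanSpace ℝ (Fin n) →L[ℝ] EuclideanSpace ℝ (Fin n) →L[ℝ] ℝ) :
    formMatrix b H = (Matrix.of fun i p => inner ℝ (c i) (b p)).transpose * formMatrix c H *
      Matrix.of fun i p => inner ℝ (c i) (b p) := by
  ext p q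
  simp only [Matrix.mul_apply, Matrix.transpose_apply, Matrix.of_apply, Finset.sum_mul]
  rw [formMatrix, Matrix.of_apply, form_eq_sum c, Finset.sum_comm]
  exact Finset.sum_congr rfl fun i _ => Finset.sum_congr rfl fun j _ => by ring

theorem innerMatrix_orthogonal (b c : OrthonormalBasis (Fin n) ℝ (EuclideanSpace ℝ (Fin n))) :
    (Matrix.of fun i p => inner ℝ (c i) (b p)).transpose *
      (Matrix.of fun i p => inner ℝ (c i) (b p)) = (1 : Matrix (Fin n) (Fin n) ℝ) := by
  ext p q
  simp only [Matrix.mul_apply, Matrix.transpose_apply, Matrix.of_apply]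
  have h := c.sum_inner_mul_inner (b p) (b q)
  rw [orthonormal_iff_ite.1 b.orthonormal p q] at h
  rw [Matrix.one_apply, ← h]
  exact Finset.sum_congr rfl fun i _ => by rw [real_inner_comm (c i)]

theorem det_formMatrix (b c : OrthonormalBasis (Fin n) ℝ (EuclideanSpace ℝ (Fin n)))
    (H : EuclideanSpace ℝ (Fin n) →L[ℝ] EuclideanSpace ℝ (Fin n) →L[ℝ] ℝ) (r : ℝ) :
    (Matrix.diagonal (fun _ : Fin n => r) + formMatrix b H).det =
      (Matrix.diagonal (fun _ : Fin n => r) + formMatrix c H).det := by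
  set Q : Matrix (Fin n) (Fin n) ℝ := Matrix.of fun i p => inner ℝ (c i) (b p) with hQ
  have h1 : Q.transpose * Q = 1 := innerMatrix_orthogonal b c
  have h2 : Matrix.diagonal (fun _ : Fin n => r) = r • (1 : Matrix (Fin n) (Fin n) ℝ) := by
    rw [Matrix.smul_one_eq_diagonal]
  have h3 : Matrix.diagonal (fun _ : Fin n => r) + formMatrix b H =
      Q.transpose * (Matrix.diagonal (fun _ : Fin n => r) + formMatrix c H) * Q := by
    rw [formMatrix_eq_conj b c, h2, mul_add, add_mul, mul_smul_comm, smul_mul_assoc, mul_one, h1]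
  have h4 : Q.transpose.det * Q.det = 1 := by rw [← Matrix.det_mul, h1, Matrix.det_one]
  rw [h3, Matrix.det_mul, Matrix.det_mul, mul_right_comm, h4, one_mul]

/-- Diagonalization of a symmetric bilinear form in an orthonormal basis, with decreasing
eigenvalues. -/
theorem exists_eigenbasis {H : EuclideanSpace ℝ (Fin n) →L[ℝ] EuclideanSpace ℝ (Fin n) →L[ℝ] ℝ}
    {A : Matrix (Fin n) (Fin n) ℝ}
    (hA : A = formMatrix (EuclideanSpace.basisFun (Fin n) ℝ) H) (hH : ∀ v w, H v w = H w v) :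
    ∃ (b : OrthonormalBasis (Fin n) ℝ (EuclideanSpace ℝ (Fin n))) (l : Fin n → ℝ)
      (τ : Equiv.Perm (Fin n)), Antitone l ∧ l = eigenvalues A ∘ τ ∧
        formMatrix b H = Matrix.diagonal l := by
  have hherm : A.IsHermitian := by
    ext p q
    simp [hA, formMatrix, hH (EuclideanSpace.single q 1)]
  have heig : eigenvalues A = hherm.eigenvalues := dif_pos hherm
  set τ : Equiv.Perm (Fin n) := Tuple.sort fun i => -eigenvalues A i with hτ
  have hmono := Tuple.monotone_sort fun i => -eigenvalues A i
  have key : ∀ p q, H (hherm.eigenvectorBasis p) (hherm.eigenvectorBasis q) =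
      hherm.eigenvalues q * inner ℝ (hherm.eigenvectorBasis p) (hherm.eigenvectorBasis q) := by
    intro p q
    have hmv := hherm.mulVec_eigenvectorBasis q
    rw [form_eq_sum (EuclideanSpace.basisFun (Fin n) ℝ), ← hA]
    have h1 : ∀ i, ∑ j, A i j * hherm.eigenvectorBasis q j =
        hherm.eigenvalues q * hherm.eigenvectorBasis q i := fun i => by
      have := congrFun hmv i
      simpa [Matrix.mulVec, dotProduct] using this
    have h2 : inner ℝ (hherm.eigenvectorBasis p) (hherm.eigenvectorBasis q) =
        ∑ i, hherm.eigenvectorBasis p i * hherm.eigenvectorBasis q i := by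
      rw [PiLp.inner_apply]
      exact Finset.sum_congr rfl fun i _ => by simp [mul_comm]
    rw [h2, Finset.mul_sum]
    refine Finset.sum_congr rfl fun i _ => ?_
    simp only [EuclideanSpace.basisFun_apply, EuclideanSpace.inner_single_left, map_one, one_mul]
    rw [show hherm.eigenvalues q * (hherm.eigenvectorBasis p i * hherm.eigenvectorBasis q i) =
      hherm.eigenvectorBasis p i * (hherm.eigenvalues q * hherm.eigenvectorBasis q i) by ring, ← h1,
      Finset.mul_sum]
    exact Finset.sum_congr rfl fun j _ => by ring
  refine ⟨hherm.eigenvectorBasis.reindex τ.symm, eigenvalues A ∘ τ, τ, ?_, rfl, ?_⟩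
  · intro i j hij
    have := hmono hij
    simp only [Function.comp] at this ⊢
    exact neg_le_neg_iff.1 this
  · ext p q
    simp only [formMatrix, Matrix.of_apply, OrthonormalBasis.reindex_apply, Equiv.symm_symm]
    rw [key, orthonormal_iff_ite.1 hherm.eigenvectorBasis.orthonormal, heig]
    by_cases hpq : p = q
    · subst hpq; simp
    · simp [hpq]

/-- `σ_k` of the eigenvalues can be computed in any fixed orthonormal basis, which is what permits
differentiating it in `x` without following eigenvectors. -/
theorem minorSum_formMatrix {H : EuclideanSpace ℝ (Fin n) →L[ℝ] EuclideanSpace ℝ (Fin n) →L[ℝ] ℝ}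
    {A : Matrix (Fin n) (Fin n) ℝ}
    (hA : A = formMatrix (EuclideanSpace.basisFun (Fin n) ℝ) H) (hH : ∀ v w, H v w = H w v)
    {k : ℕ} (hk : k ≤ n) (b : OrthonormalBasis (Fin n) ℝ (EuclideanSpace ℝ (Fin n))) :
    minorSum n k (formMatrix b H) = sigma k (eigenvalues A) := by
  obtain ⟨c, l, τ, -, hl, hc⟩ := exists_eigenbasis hA hH
  rw [minorSum_eq_es hk (l := l), hl, es_comp_perm, sigma_eq_es]
  intro r
  rw [det_formMatrix b c, hc, Matrix.diagonal_add, Matrix.det_diagonal]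

/-- The linearized operator at a point of the cone is nonnegative on symmetric forms whose
eigenvalues lie in the closed cone. -/
theorem trace_gradient_nonneg {k : ℕ} (hk : k + 2 ≤ n)
    {H : EuclideanSpace ℝ (Fin n) →L[ℝ] EuclideanSpace ℝ (Fin n) →L[ℝ] ℝ}
    {A : Matrix (Fin n) (Fin n) ℝ}
    (hA : A = formMatrix (EuclideanSpace.basisFun (Fin n) ℝ) H) (hH : ∀ v w, H v w = H w v)
    (hcl : eigenvalues A ∈ closure (gardingCone n (k + 2)))
    (b : OrthonormalBasis (Fin n) ℝ (EuclideanSpace ℝ (Fin n))) {l : Fin n → ℝ}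
    (hl : Cone Finset.univ (k + 2) l) :
    0 ≤ ∑ i, es (Finset.univ.erase i) (k + 1) l * H (b i) (b i) := by
  obtain ⟨c, ν, τ, -, hν, hc⟩ := exists_eigenbasis hA hH
  have hνcl : ν ∈ closure (gardingCone n (k + 2)) := hν ▸ comp_perm_mem_closure hcl τ
  set W : Matrix (Fin n) (Fin n) ℝ := Matrix.of fun i j => inner ℝ (c j) (b i) ^ 2 with hW
  have hdiag : ∀ i, H (b i) (b i) = ∑ j, W i j * ν j := by
    intro i
    rw [form_eq_sum c, hc]
    refine Finset.sum_congr rfl fun p _ => ?_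
    rw [Finset.sum_eq_single p]
    · rw [Matrix.diagonal_apply_eq, hW, Matrix.of_apply]; ring
    · intro q _ hq
      rw [Matrix.diagonal_apply_ne _ hq.symm, mul_zero]
    · simp
  have hds : W ∈ doublyStochastic ℝ (Fin n) := by
    rw [mem_doublyStochastic_iff_sum]
    refine ⟨fun i j => sq_nonneg _, fun i => ?_, fun j => ?_⟩
    · have := c.sum_sq_norm_inner_right (b i)
      simpa [hW, b.orthonormal.1 i] using this
    · have := b.sum_sq_norm_inner_left (c j)
      simpa [hW, c.orthonormal.1 j] using this
  -- Birkhoff: the diagonal of a symmetric form in any orthonormal basis is a convex combination of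
  -- permutations of its eigenvalues, and the closed cone is invariant under permutations.
  obtain ⟨w, hw0, -, hwW⟩ := exists_eq_sum_perm_of_mem_doublyStochastic hds
  have hdiag2 : ∀ i, H (b i) (b i) = ∑ π : Equiv.Perm (Fin n), w π * ν (π i) := by
    intro i
    rw [hdiag, ← hwW]
    simp only [Matrix.sum_apply, Matrix.smul_apply, smul_eq_mul, Finset.sum_mul]
    rw [Finset.sum_comm]
    refine Finset.sum_congr rfl fun π _ => ?_
    rw [Finset.sum_eq_single (π i)]
    · simp [Equiv.Perm.permMatrix, PEquiv.toMatrix_apply]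
    · intro j _ hj
      simp [Equiv.Perm.permMatrix, PEquiv.toMatrix_apply, hj.symm]
    · simp
  have htot : ∑ i, es (Finset.univ.erase i) (k + 1) l * H (b i) (b i) =
      ∑ π : Equiv.Perm (Fin n), w π * ∑ i, es (Finset.univ.erase i) (k + 1) l * (ν ∘ π) i := by
    simp only [hdiag2, Finset.mul_sum]
    rw [Finset.sum_comm]
    exact Finset.sum_congr rfl fun π _ => Finset.sum_congr rfl fun i _ => by
      simp only [Function.comp]; ring
  rw [htot]
  exact Finset.sum_nonneg fun π _ => mul_nonneg (hw0 π)
    (hl.gradient_nonneg hk (comp_perm_mem_closure hνcl π))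

end Spectral

/-! ### Algebra of the estimate at a maximum point -/

section PointwiseEstimate

/-- The gradient of the weight is controlled by a quarter of its own good second order terms `B z² +
A`; smallness of `A` and `B` relative to `R` and `M₁` serves only this. -/
theorem cutoff_gradient_sq_le {A B M₁ R x y z : ℝ} (hA : 0 < A) (hB : 0 < B)
    (hBM : 8 * B * M₁ ^ 2 ≤ 1) (hAR : 8 * A * R ^ 2 ≤ 1) (hy : |y| ≤ M₁) (hx : |x| ≤ R) :
    (B * y * z + A * x) ^ 2 ≤ B / 4 * z ^ 2 + A / 4 := by
  have hy2 : y ^ 2 ≤ M₁ ^ 2 := sq_le_sq' (abs_le.1 hy).1 (abs_le.1 hy).2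
  have hx2 : x ^ 2 ≤ R ^ 2 := sq_le_sq' (abs_le.1 hx).1 (abs_le.1 hx).2
  have h1 : (B * y * z + A * x) ^ 2 ≤ 2 * (B * y * z) ^ 2 + 2 * (A * x) ^ 2 := by
    nlinarith [sq_nonneg (B * y * z - A * x)]
  have h2 : 2 * (B * y * z) ^ 2 ≤ B / 4 * z ^ 2 := by
    have : 8 * B * y ^ 2 ≤ 1 := by nlinarith
    have h3 : 0 ≤ B * z ^ 2 := by positivity
    nlinarith [mul_le_mul_of_nonneg_left this h3]
  have h4 : 2 * (A * x) ^ 2 ≤ A / 4 := by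
    have : 8 * A * x ^ 2 ≤ 1 := by nlinarith
    nlinarith [mul_le_mul_of_nonneg_left this hA.le]
  linarith

/-- Absorption of the third order terms in a direction other than the leading one. -/
theorem third_order_absorb {A B β Λ F F₀ e l τ φ Y : ℝ} (hA : 0 < A) (hB : 0 < B) (hβ : 2 ≤ β)
    (hΛ : 0 < Λ) (hF : 0 < F) (hF₀ : 0 < F₀) (he : 0 ≤ e) (heF : F - F₀ = e * (Λ - l))
    (hφ : φ ^ 2 ≤ B / 4 * l ^ 2 + A / 4) (hψ : (φ + τ) ^ 2 ≤ Y) (hY : 980 * Y ≤ B * Λ ^ 2) :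
    F * ((φ + τ) ^ 2 / β + τ ^ 2) - 2 * e * Λ * τ ^ 2 ≤
      B * F * l ^ 2 + A / 2 * F + 40 * Y * F₀ := by
  have hY0 : 0 ≤ Y := (sq_nonneg _).trans hψ
  have hdiv : (φ + τ) ^ 2 / β ≤ (φ + τ) ^ 2 / 2 := by gcongr
  have hτ0 := sq_nonneg τ
  have hl0 : 0 ≤ F * l ^ 2 := by positivity
  -- In the good case `F - F₀ ≥ 15/16 F` and `Λ - l ≤ 15/14 Λ`, so `2eΛ ≥ 7/4 F`, which covers the
  -- `τ²` terms since `1 + 1/β ≤ 3/2`. Otherwise either `F` is comparable with `F₀`, or `l` is very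
  -- negative, and then `B F l²` dominates because `980 = 5 · 14²`.
  by_cases hgood : 16 * F₀ ≤ F ∧ -(Λ / 14) ≤ l
  · have h1 : (φ + τ) ^ 2 / 2 + τ ^ 2 ≤ 7 / 4 * τ ^ 2 + 3 / 2 * φ ^ 2 := by
      nlinarith [sq_nonneg (τ - 2 * φ)]
    have h2 : 7 / 8 * F ≤ e * Λ := by
      have h3 : e * (Λ - l) ≤ e * (15 / 14 * Λ) :=
        mul_le_mul_of_nonneg_left (by linarith [hgood.2]) he
      linarith [hgood.1]
    have h4 : F * ((φ + τ) ^ 2 / β + τ ^ 2) ≤ F * (7 / 4 * τ ^ 2 + 3 / 2 * φ ^ 2) :=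
      mul_le_mul_of_nonneg_left (by linarith) hF.le
    have h5 : 7 / 8 * F * τ ^ 2 ≤ e * Λ * τ ^ 2 := mul_le_mul_of_nonneg_right h2 hτ0
    have h6 : F * φ ^ 2 ≤ F * (B / 4 * l ^ 2 + A / 4) := mul_le_mul_of_nonneg_left hφ hF.le
    have h7 : 0 ≤ B * (F * l ^ 2) := by positivity
    have h8 : 0 ≤ A * F := by positivity
    have h9 : 0 ≤ Y * F₀ := by positivity
    nlinarith
  · have h1 : τ ^ 2 ≤ 2 * (φ + τ) ^ 2 + 2 * φ ^ 2 := by nlinarith [sq_nonneg (τ + 2 * φ)]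
    have h2 : F * ((φ + τ) ^ 2 / β + τ ^ 2) ≤ F * (5 / 2 * Y + B / 2 * l ^ 2 + A / 2) :=
      mul_le_mul_of_nonneg_left (by linarith) hF.le
    have h3 : 0 ≤ 2 * e * Λ * τ ^ 2 := by positivity
    have h9 : 0 ≤ Y * F₀ := by positivity
    have h7 : 0 ≤ B * (F * l ^ 2) := by positivity
    rcases lt_or_ge F (16 * F₀) with h | h
    · have : F * Y ≤ 16 * F₀ * Y := mul_le_mul_of_nonneg_right h.le hY0
      nlinarith
    · have hl : l < -(Λ / 14) := by
        by_contra! hc; exact hgood ⟨h, hc⟩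
      have hl2 : Λ ^ 2 ≤ 196 * l ^ 2 := by nlinarith
      have : 5 * Y ≤ B * l ^ 2 := by nlinarith
      have := mul_le_mul_of_nonneg_left this hF.le
      nlinarith

/-- Absorption of the third order terms in the leading direction. -/
theorem third_order_absorb_leading {A B β Λ F τ φ Y : ℝ} (hβ : 2 ≤ β)
    (hF : 0 < F) (hφ : φ ^ 2 ≤ B / 4 * Λ ^ 2 + A / 4) (hψ : (φ + τ) ^ 2 ≤ Y) :
    F * ((φ + τ) ^ 2 / β + τ ^ 2) ≤ B / 2 * F * Λ ^ 2 + A / 2 * F + 40 * Y * F := by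
  have hY0 : 0 ≤ Y := (sq_nonneg _).trans hψ
  have hdiv : (φ + τ) ^ 2 / β ≤ (φ + τ) ^ 2 / 2 := by gcongr
  have h1 : τ ^ 2 ≤ 2 * (φ + τ) ^ 2 + 2 * φ ^ 2 := by nlinarith [sq_nonneg (τ + 2 * φ)]
  have h2 : F * ((φ + τ) ^ 2 / β + τ ^ 2) ≤ F * (40 * Y + B / 2 * Λ ^ 2 + A / 2) :=
    mul_le_mul_of_nonneg_left (by linarith) hF.le
  linarith

/-- The constant in the pointwise estimate. -/
def pointConst (n k : ℕ) (A B M M₁ R C c₀ β : ℝ) : ℝ :=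
  B * n * M₁ * k * C + 2 * k * C + 2 * C * (β * M + B * M₁ + A * R) + n ^ 2 * C ^ 2 / (2 * c₀)

/-- The estimate at a maximum point, from the differential inequalities that hold there. -/
theorem pointwise_estimate {n k : ℕ} (o : Fin n) (S : Finset (Fin n)) {A B β M M₁ R C c₀ : ℝ}
    {l F e y X T Q ξ Φ Ψ Φ₂ Ψ₂ : Fin n → ℝ} {Λ W G θ f : ℝ}
    (hA : 0 < A) (hB : 0 < B) (hβ : 2 ≤ β) (hM : 0 ≤ M) (hR : 0 ≤ R)
    (hC : 0 ≤ C) (hc₀ : 0 < c₀) (hBM : 8 * B * M₁ ^ 2 ≤ 1) (hAR : 8 * A * R ^ 2 ≤ 1)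
    (hF : ∀ i, 0 < F i) (hlo : l o = Λ) (hΛ : 1 ≤ Λ)
    (he : ∀ i, i ≠ o → 0 ≤ e i ∧ F i - F o = e i * (Λ - l i))
    (hy : ∀ i, |y i| ≤ M₁) (hX : ∀ i, |X i| ≤ R)
    (hΦ : ∀ i, Φ i = B * y i * l i + A * X i) (hΨ : ∀ i, Ψ i = -Φ i - T i / Λ)
    (hW : 0 < W) (hΨM : ∀ i, |Ψ i| ≤ β * M / W)
    (hvisc : 0 ≤ β * (k * f) / W + ∑ i, F i * (Ψ₂ i + Ψ i ^ 2 / β))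
    (hΨ₂ : ∀ i, Ψ₂ i ≤ -Φ₂ i - Q i / Λ + T i ^ 2 / Λ ^ 2 -
      if i ∈ S then 2 * ξ i ^ 2 / (n * Λ ^ 2) else 0)
    (hΦ₂ : B * ∑ i, F i * l i ^ 2 + A * ∑ i, F i - B * n * M₁ * k * C * G ≤ ∑ i, F i * Φ₂ i)
    (hQ : -(2 * G * C * (|T o| + ∑ p ∈ S, |ξ p|) / Λ) - k * C * G * (1 + Λ) +
      2 * ∑ i ∈ Finset.univ.erase o, e i * T i ^ 2 ≤ ∑ i, F i * Q i)
    (hf : f ≤ C * G) (hG : 0 < G) (hθ : 1 ≤ θ) (hθG : θ * G ≤ ∑ i, F i)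
    (hS : ∀ p ∈ S, c₀ * ∑ i, F i ≤ F p) (hWΛ : 1 ≤ W * Λ)
    (hlarge : 980 * n * (β * M / W) ^ 2 ≤ B * Λ ^ 2) :
    W * θ ≤ 2 / A * (β * k * C + pointConst n k A B M M₁ R C c₀ β * W) := by
  have hn : (1 : ℝ) ≤ n := by exact_mod_cast (o.pos : 0 < n)
  have hΛ0 : 0 < Λ := by linarith
  set Y : ℝ := (β * M / W) ^ 2 with hY
  have hY0 : 0 ≤ Y := sq_nonneg _
  have hY1 : 980 * Y ≤ B * Λ ^ 2 := by
    have := le_mul_of_one_le_left hY0 hn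
    linarith
  have hφ : ∀ i, Φ i ^ 2 ≤ B / 4 * l i ^ 2 + A / 4 := fun i => by
    rw [hΦ]; exact cutoff_gradient_sq_le hA hB hBM hAR (hy i) (hX i)
  have hψ : ∀ i, (Φ i + T i / Λ) ^ 2 ≤ Y := fun i => by
    have : (Φ i + T i / Λ) ^ 2 = Ψ i ^ 2 := by rw [hΨ]; ring
    rw [this]; exact sq_le_sq' (abs_le.1 (hΨM i)).1 (abs_le.1 (hΨM i)).2
  have hΨsq : ∀ i, Ψ i ^ 2 = (Φ i + T i / Λ) ^ 2 := fun i => by rw [hΨ]; ring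
  -- third order terms
  have hthird : ∑ i, F i * (Ψ i ^ 2 / β + (T i / Λ) ^ 2) -
      2 / Λ * ∑ i ∈ Finset.univ.erase o, e i * T i ^ 2 ≤
        B * ∑ i, F i * l i ^ 2 + A / 2 * ∑ i, F i := by
    rw [← Finset.add_sum_erase _ _ (Finset.mem_univ o), ← Finset.add_sum_erase _
      (fun i => F i * l i ^ 2) (Finset.mem_univ o), ← Finset.add_sum_erase _ F (Finset.mem_univ o)]
    have h0 := third_order_absorb_leading (A := A) (B := B) (Λ := Λ) hβ (hF o)
      (by simpa [hlo] using hφ o) (hψ o)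
    have hi : ∑ i ∈ Finset.univ.erase o, (F i * (Ψ i ^ 2 / β + (T i / Λ) ^ 2) -
        2 / Λ * (e i * T i ^ 2)) ≤ ∑ i ∈ Finset.univ.erase o,
          (B * (F i * l i ^ 2) + A / 2 * F i + 40 * Y * F o) := by
      refine Finset.sum_le_sum fun i hi => ?_
      have hne := (Finset.mem_erase.1 hi).1
      have := third_order_absorb hA hB hβ hΛ0 (hF i) (hF o) (he i hne).1 (he i hne).2 (hφ i) (hψ i)
        hY1
      have h2 : 2 / Λ * (e i * T i ^ 2) = 2 * e i * Λ * (T i / Λ) ^ 2 := by field_simp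
      rw [h2, hΨsq]; linarith
    rw [Finset.sum_sub_distrib, Finset.sum_add_distrib, Finset.sum_add_distrib, Finset.sum_const,
      Finset.card_erase_of_mem (Finset.mem_univ o), Finset.card_univ, Fintype.card_fin,
      nsmul_eq_mul, ← Finset.mul_sum, ← Finset.mul_sum, ← Finset.mul_sum,
      Nat.cast_sub o.pos, Nat.cast_one] at hi
    rw [← hΨsq] at h0
    -- The `n` leftover terms `40 Y F_o` fit into the half of `B F_o Λ²` that the leading direction
    -- has not used.
    have h3 : 40 * Y * F o * n ≤ B / 2 * F o * Λ ^ 2 := by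
      have := mul_le_mul_of_nonneg_right hlarge (hF o).le
      have h4 : 0 ≤ n * Y * F o := by have := (hF o).le; positivity
      linarith
    rw [hlo]
    linarith
  -- combination of the second order terms
  have hΨsum : ∑ i, F i * (Ψ₂ i + Ψ i ^ 2 / β) ≤
      ∑ i, F i * (Ψ i ^ 2 / β + (T i / Λ) ^ 2) - ∑ i, F i * Φ₂ i - 1 / Λ * ∑ i, F i * Q i -
        ∑ p ∈ S, F p * (2 * ξ p ^ 2 / (n * Λ ^ 2)) := by
    have h1 : ∑ p ∈ S, F p * (2 * ξ p ^ 2 / (n * Λ ^ 2)) =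
        ∑ i, F i * (if i ∈ S then 2 * ξ i ^ 2 / (n * Λ ^ 2) else 0) := by
      simp [Finset.sum_ite_mem]
    rw [h1, Finset.mul_sum, ← Finset.sum_sub_distrib, ← Finset.sum_sub_distrib,
      ← Finset.sum_sub_distrib]
    refine Finset.sum_le_sum fun i _ => ?_
    have h2 := mul_le_mul_of_nonneg_left (hΨ₂ i) (hF i).le
    have h3 : F i * (Ψ i ^ 2 / β + (T i / Λ) ^ 2) - F i * Φ₂ i - 1 / Λ * (F i * Q i) -
        F i * (if i ∈ S then 2 * ξ i ^ 2 / (n * Λ ^ 2) else 0) =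
        F i * (-Φ₂ i - Q i / Λ + T i ^ 2 / Λ ^ 2 -
          if i ∈ S then 2 * ξ i ^ 2 / (n * Λ ^ 2) else 0) + F i * (Ψ i ^ 2 / β) := by
      rw [div_pow]; ring
    rw [h3, mul_add]; linarith
  have hQ' := mul_le_mul_of_nonneg_left hQ (by positivity : 0 ≤ 1 / Λ)
  -- the remaining diagonal third order terms
  have hξ : ∑ p ∈ S, (2 * G * C * |ξ p| / Λ ^ 2 - F p * (2 * ξ p ^ 2 / (n * Λ ^ 2))) ≤
      G * (n ^ 2 * C ^ 2 / (2 * c₀)) := by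
    have hp : ∀ p ∈ S, 2 * G * C * |ξ p| / Λ ^ 2 - F p * (2 * ξ p ^ 2 / (n * Λ ^ 2)) ≤
        G * (n * C ^ 2 / (2 * c₀)) := by
      intro p hp
      have hFp : c₀ * G ≤ F p := by
        have h1 : G ≤ θ * G := le_mul_of_one_le_left hG.le hθ
        have h2 : c₀ * G ≤ c₀ * ∑ i, F i := mul_le_mul_of_nonneg_left (h1.trans hθG) hc₀.le
        exact h2.trans (hS p hp)
      have h1 : 2 * G * C * |ξ p| / Λ ^ 2 - F p * (2 * ξ p ^ 2 / (n * Λ ^ 2)) =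
          (2 * G * C * |ξ p| - 2 / n * F p * ξ p ^ 2) / Λ ^ 2 := by
        field_simp
      have h2 : 2 * G * C * |ξ p| - 2 / n * F p * ξ p ^ 2 ≤ G * (n * C ^ 2 / (2 * c₀)) := by
        have h3 : 2 / n * (c₀ * G) * ξ p ^ 2 ≤ 2 / n * F p * ξ p ^ 2 := by gcongr
        -- Completing the square: since `F_p ≥ c₀ G`, the gain from the rotating frame absorbs the
        -- term linear in `ξ_p` at the cost of a multiple of `G`.
        have h4 : 2 * G * C * |ξ p| - 2 / n * (c₀ * G) * ξ p ^ 2 =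
            G * (n * C ^ 2 / (2 * c₀)) - G * (2 * c₀ / n) * (|ξ p| - n * C / (2 * c₀)) ^ 2 := by
          rw [← sq_abs (ξ p)]
          field_simp
          ring
        have h5 : 0 ≤ G * (2 * c₀ / n) * (|ξ p| - n * C / (2 * c₀)) ^ 2 := by positivity
        linarith
      have h6 : 0 ≤ G * (n * C ^ 2 / (2 * c₀)) := by positivity
      rw [h1, div_le_iff₀ (by positivity)]
      exact h2.trans (le_mul_of_one_le_right h6 (one_le_pow₀ hΛ))
    refine (Finset.sum_le_card_nsmul _ _ _ hp).trans ?_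
    have hcard : (S.card : ℝ) ≤ n := by
      exact_mod_cast (Finset.card_le_univ S).trans (by simp)
    rw [nsmul_eq_mul]
    have h6 : 0 ≤ G * (n * C ^ 2 / (2 * c₀)) := by positivity
    calc _ ≤ n * (G * (n * C ^ 2 / (2 * c₀))) := by gcongr
      _ = _ := by ring
  -- The first order condition expresses `T_o/Λ` through `Ψ_o` and `Φ_o`; the singular `1/W` is
  -- traded for `Λ` by `W Λ ≥ 1`.
  have hTo : |T o| / Λ ^ 2 ≤ β * M + B * M₁ + A * R := by
    have h1 : T o / Λ = -Ψ o - Φ o := by rw [hΨ]; ring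
    have h2 : |T o| / Λ ≤ β * M / W + B * M₁ * Λ + A * R := by
      rw [← abs_of_pos hΛ0, ← abs_div, abs_of_pos hΛ0, h1]
      have h3 : |Φ o| ≤ B * M₁ * Λ + A * R := by
        rw [hΦ, hlo]
        refine (abs_add_le _ _).trans ?_
        rw [abs_mul, abs_mul, abs_mul, abs_of_pos hB, abs_of_pos hA, abs_of_pos hΛ0]
        gcongr
        · exact hy o
        · exact hX o
      have h4 := abs_sub (-Ψ o) (Φ o)
      rw [abs_neg] at h4
      linarith [hΨM o]
    have h5 : |T o| / Λ ^ 2 = |T o| / Λ / Λ := by rw [div_div, sq]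
    rw [h5, div_le_iff₀ hΛ0]
    have h6 : β * M / W ≤ β * M * Λ := by
      rw [div_le_iff₀ hW]
      have : 0 ≤ β * M := by positivity
      rw [mul_assoc, mul_comm Λ W]
      exact le_mul_of_one_le_right this hWΛ
    have h7 : A * R ≤ A * R * Λ := le_mul_of_one_le_right (by positivity) hΛ
    linarith
  have hsumξ : ∑ p ∈ S, (2 * G * C * |ξ p| / Λ ^ 2 - F p * (2 * ξ p ^ 2 / (n * Λ ^ 2))) =
      2 * G * C * (∑ p ∈ S, |ξ p|) / Λ ^ 2 - ∑ p ∈ S, F p * (2 * ξ p ^ 2 / (n * Λ ^ 2)) := by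
    rw [Finset.sum_sub_distrib, Finset.mul_sum, Finset.sum_div]
  have hQ'' : 1 / Λ * (-(2 * G * C * (|T o| + ∑ p ∈ S, |ξ p|) / Λ) - k * C * G * (1 + Λ) +
      2 * ∑ i ∈ Finset.univ.erase o, e i * T i ^ 2) =
      -(2 * G * C * (|T o| / Λ ^ 2)) - 2 * G * C * (∑ p ∈ S, |ξ p|) / Λ ^ 2 -
        k * C * G * (1 / Λ + 1) + 2 / Λ * ∑ i ∈ Finset.univ.erase o, e i * T i ^ 2 := by
    field_simp
    ring
  rw [hQ''] at hQ'
  have h1Λ : k * C * G * (1 / Λ + 1) ≤ k * C * G * 2 := by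
    have : 1 / Λ ≤ 1 := by rw [div_le_one hΛ0]; exact hΛ
    have h0 : 0 ≤ k * C * G := by positivity
    exact mul_le_mul_of_nonneg_left (by linarith) h0
  have hTo' : 2 * G * C * (|T o| / Λ ^ 2) ≤ 2 * G * C * (β * M + B * M₁ + A * R) := by gcongr
  have hfW : β * (k * f) / W ≤ β * (k * (C * G)) / W := by gcongr
  -- The quadratic terms `B F_i l_i²` cancel completely and half of `A ∑ F_i` survives; everything
  -- else is a multiple of `G`, which is divided out below.
  have hfinal : A / 2 * ∑ i, F i ≤ β * (k * (C * G)) / W +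
      G * pointConst n k A B M M₁ R C c₀ β := by
    unfold pointConst
    rw [hsumξ] at hξ
    linarith
  have h2 : A / 2 * (θ * G) ≤ β * (k * (C * G)) / W + G * pointConst n k A B M M₁ R C c₀ β :=
    (mul_le_mul_of_nonneg_left hθG (by positivity)).trans hfinal
  have h3 : G * (A / 2 * (W * θ)) ≤ G * (β * k * C + pointConst n k A B M M₁ R C c₀ β * W) := by
    have := mul_le_mul_of_nonneg_left h2 hW.le
    have h4 : W * (β * (k * (C * G)) / W + G * pointConst n k A B M M₁ R C c₀ β) =
        G * (β * k * C + pointConst n k A B M M₁ R C c₀ β * W) := by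
      field_simp
    rw [h4] at this
    linarith
  have h5 := le_of_mul_le_mul_left h3 hG
  rw [div_mul_eq_mul_div, le_div_iff₀ hA]
  linarith

end PointwiseEstimate

/-! ### Iterated directional derivatives and their commutation -/

section DirectionalDerivatives

variable {E : Type*} [NormedAddCommGroup E] [NormedSpace ℝ E]

/-- The derivative of `g` in the direction `v`. -/
def dd (v : E) (g : E → ℝ) : E → ℝ := fun x => fderiv ℝ g x v

theorem contDiffOn_dd {g : E → ℝ} {Ω : Set E} (hΩ : IsOpen Ω) {m k : ℕ} (hg : ContDiffOn ℝ k g Ω)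
    (hm : m + 1 ≤ k) (v : E) : ContDiffOn ℝ m (dd v g) Ω :=
  (hg.fderiv_of_isOpen hΩ (by exact_mod_cast hm)).clm_apply contDiffOn_const

theorem dd_congr {g g' : E → ℝ} {Ω : Set E} (hΩ : IsOpen Ω) (h : EqOn g g' Ω) (v : E) :
    EqOn (dd v g) (dd v g') Ω := fun x hx => by
  have : g =ᶠ[nhds x] g' := Filter.eventuallyEq_of_mem (hΩ.mem_nhds hx) h
  simp only [dd, this.fderiv_eq]

theorem dd_dd_eq {g : E → ℝ} {Ω : Set E} (hΩ : IsOpen Ω) (hg : ContDiffOn ℝ 2 g Ω) {x : E}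
    (hx : x ∈ Ω) (v w : E) : dd v (dd w g) x = fderiv ℝ (fderiv ℝ g) x v w := by
  have h1 : DifferentiableAt ℝ (fderiv ℝ g) x :=
    ((hg.contDiffAt (hΩ.mem_nhds hx)).fderiv_right (m := 1) (by norm_num)).differentiableAt
      (by simp)
  have h2 := ((ContinuousLinearMap.apply ℝ ℝ w).hasFDerivAt.comp x h1.hasFDerivAt).fderiv
  change fderiv ℝ (ContinuousLinearMap.apply ℝ ℝ w ∘ fderiv ℝ g) x v = _
  rw [h2]; rfl

theorem fderiv_fderiv_symm {g : E → ℝ} {Ω : Set E} (hΩ : IsOpen Ω) (hg : ContDiffOn ℝ 2 g Ω)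
    {x : E} (hx : x ∈ Ω) (v w : E) :
    fderiv ℝ (fderiv ℝ g) x v w = fderiv ℝ (fderiv ℝ g) x w v :=
  (hg.contDiffAt (hΩ.mem_nhds hx)).isSymmSndFDerivAt (by simp) v w

theorem dd_comm {g : E → ℝ} {Ω : Set E} (hΩ : IsOpen Ω) {k : ℕ} (hg : ContDiffOn ℝ k g Ω)
    (hk : 2 ≤ k) (v w : E) : EqOn (dd v (dd w g)) (dd w (dd v g)) Ω := fun x hx => by
  have hg2 : ContDiffOn ℝ 2 g Ω := hg.of_le (by exact_mod_cast hk)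
  rw [dd_dd_eq hΩ hg2 hx, dd_dd_eq hΩ hg2 hx, fderiv_fderiv_symm hΩ hg2 hx]

theorem J2.dd_line {g : E → ℝ} {Ω : Set E} (hΩ : IsOpen Ω) {k : ℕ} (hg : ContDiffOn ℝ k g Ω)
    (hk : 2 ≤ k) {x : E} (hx : x ∈ Ω) (v : E) :
    J2 (fun t => g (x + t • v)) (g x) (dd v g x) (dd v (dd v g) x) :=
  J2.of_contDiffAt ((hg.contDiffAt (hΩ.mem_nhds hx)).of_le (by exact_mod_cast hk)) v

end DirectionalDerivatives

/-! ### Jets of the weight, the rotating direction and the Hessian form -/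

section Touching

open Filter Topology

variable {n : ℕ}

theorem sum_sq_functional (b : OrthonormalBasis (Fin n) ℝ (EuclideanSpace ℝ (Fin n)))
    (L : EuclideanSpace ℝ (Fin n) →L[ℝ] ℝ) : ∑ r, L (b r) ^ 2 = ‖L‖ ^ 2 := by
  set g := (InnerProductSpace.toDual ℝ (EuclideanSpace ℝ (Fin n))).symm L with hg
  have h1 : ∀ v, L v = inner ℝ g v := fun v => by
    rw [hg, InnerProductSpace.toDual_symm_apply]
  have h2 : ‖L‖ = ‖g‖ := by rw [hg, LinearIsometryEquiv.norm_map]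
  rw [h2, ← b.sum_sq_norm_inner_left g]
  exact Finset.sum_congr rfl fun r _ => by rw [h1, Real.norm_eq_abs, sq_abs]

theorem J2.norm_sq_line {E : Type*} [NormedAddCommGroup E] [InnerProductSpace ℝ E] (x v : E) :
    J2 (fun t : ℝ => ‖x + t • v‖ ^ 2) (‖x‖ ^ 2) (2 * inner ℝ x v) (2 * ‖v‖ ^ 2) := by
  have he : ∀ t : ℝ, ‖x + t • v‖ ^ 2 = ‖x‖ ^ 2 + t * (2 * inner ℝ x v) + t * t * ‖v‖ ^ 2 :=
    fun t => by
      rw [norm_add_sq_real, inner_smul_right, norm_smul, mul_pow, Real.norm_eq_abs, sq_abs]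
      ring
  simp only [he]
  exact (((J2.const _).add (J2.id.mul (J2.const _))).add
    ((J2.id.mul J2.id).mul (J2.const _))).congr_coeff (by ring) (by ring) (by ring)

/-- The weight in Pogorelov's test function. -/
def weight (A B : ℝ) (z : EuclideanSpace ℝ (Fin n)) (u : EuclideanSpace ℝ (Fin n) → ℝ)
    (x : EuclideanSpace ℝ (Fin n)) : ℝ :=
  B / 2 * ‖fderiv ℝ u x‖ ^ 2 + A / 2 * ‖x - z‖ ^ 2

theorem weight_eq (A B : ℝ) (z : EuclideanSpace ℝ (Fin n)) (u : EuclideanSpace ℝ (Fin n) → ℝ)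
    (b : OrthonormalBasis (Fin n) ℝ (EuclideanSpace ℝ (Fin n))) (x : EuclideanSpace ℝ (Fin n)) :
    weight A B z u x = B / 2 * ∑ r, dd (b r) u x ^ 2 + A / 2 * ‖x - z‖ ^ 2 := by
  rw [weight, ← sum_sq_functional b]; rfl

variable {Ω : Set (EuclideanSpace ℝ (Fin n))} {u : EuclideanSpace ℝ (Fin n) → ℝ}
  {b : OrthonormalBasis (Fin n) ℝ (EuclideanSpace ℝ (Fin n))} {l : Fin n → ℝ}
  {x₀ : EuclideanSpace ℝ (Fin n)}

theorem dd_dd_basis (hΩ : IsOpen Ω) (hu : ContDiffOn ℝ 4 u Ω) (hx₀ : x₀ ∈ Ω)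
    (hl : formMatrix b (fderiv ℝ (fderiv ℝ u) x₀) = Matrix.diagonal l) (p q : Fin n) :
    dd (b p) (dd (b q) u) x₀ = Matrix.diagonal l p q := by
  rw [dd_dd_eq hΩ (hu.of_le (by norm_num)) hx₀, ← hl]; rfl

theorem J2.weight_line (hΩ : IsOpen Ω) (hu : ContDiffOn ℝ 4 u Ω) (hx₀ : x₀ ∈ Ω)
    (hl : formMatrix b (fderiv ℝ (fderiv ℝ u) x₀) = Matrix.diagonal l) (A B : ℝ)
    (z : EuclideanSpace ℝ (Fin n)) (i : Fin n) :
    J2 (fun t => weight A B z u (x₀ + t • b i)) (weight A B z u x₀)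
      (B * dd (b i) u x₀ * l i + A * inner ℝ (x₀ - z) (b i))
      (B * (l i ^ 2 + ∑ r, dd (b r) u x₀ * dd (b i) (dd (b i) (dd (b r) u)) x₀) + A) := by
  have hu4 : ContDiffOn ℝ (4 : ℕ) u Ω := hu
  have h1 := J2.sum (s := Finset.univ) fun r _ =>
    (J2.dd_line hΩ (contDiffOn_dd hΩ (m := 3) hu4 (by norm_num) (b r)) (by norm_num) hx₀
      (b i)).pow 2
  have h2 := J2.norm_sq_line (x₀ - z) (b i)
  have h3 := (h1.const_mul (B / 2)).add (h2.const_mul (A / 2))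
  have hfun : ∀ t : ℝ, weight A B z u (x₀ + t • b i) =
      B / 2 * ∑ r, dd (b r) u (x₀ + t • b i) ^ 2 + A / 2 * ‖x₀ - z + t • b i‖ ^ 2 := fun t => by
    rw [weight_eq A B z u b, show x₀ + t • b i - z = x₀ - z + t • b i by abel]
  simp only [hfun]
  refine h3.congr_coeff (weight_eq A B z u b x₀).symm ?_ ?_
  · simp only [dd_dd_basis hΩ hu hx₀ hl]
    rw [Finset.sum_eq_single i]
    · rw [Matrix.diagonal_apply_eq]; norm_num; ring
    · intro r _ hr
      rw [Matrix.diagonal_apply_ne _ hr.symm, mul_zero]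
    · simp
  · simp only [dd_dd_basis hΩ hu hx₀ hl, Finset.sum_add_distrib]
    rw [Finset.sum_eq_single i]
    · rw [Matrix.diagonal_apply_eq, b.orthonormal.1 i, mul_add B, Finset.mul_sum, mul_add (B / 2),
        Finset.mul_sum]
      have : ∑ r, B / 2 * (((2 : ℕ) : ℝ) * dd (b r) u x₀ ^ (2 - 1) *
          dd (b i) (dd (b i) (dd (b r) u)) x₀) =
          ∑ r, B * (dd (b r) u x₀ * dd (b i) (dd (b i) (dd (b r) u)) x₀) :=
        Finset.sum_congr rfl fun r _ => by norm_num; ring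
      rw [this]; norm_num; ring
    · intro r _ hr
      rw [Matrix.diagonal_apply_ne _ hr.symm]; simp
    · simp

/-- The rotating direction in Pogorelov's test function. -/
def frameField (b : OrthonormalBasis (Fin n) ℝ (EuclideanSpace ℝ (Fin n))) (o : Fin n)
    (a : Fin n → ℝ) (x₀ x : EuclideanSpace ℝ (Fin n)) : EuclideanSpace ℝ (Fin n) :=
  b o + ∑ p, (a p * inner ℝ (b p) (x - x₀)) • b p

theorem frameField_line (o : Fin n) (a : Fin n → ℝ) (i : Fin n) (t : ℝ) :
    frameField b o a x₀ (x₀ + t • b i) = b o + t • (a i • b i) := by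
  unfold frameField
  rw [Finset.sum_eq_single i]
  · rw [add_sub_cancel_left, inner_smul_right, real_inner_self_eq_norm_sq, b.orthonormal.1 i,
      smul_smul]
    congr 2; ring
  · intro p _ hp
    rw [add_sub_cancel_left, inner_smul_right, b.orthonormal.2 hp]; simp
  · simp

theorem frameField_self (o : Fin n) (a : Fin n → ℝ) : frameField b o a x₀ x₀ = b o := by
  simp [frameField]

theorem J2.frameField_norm {o : Fin n} {a : Fin n → ℝ} (ha : a o = 0) (i : Fin n) :
    J2 (fun t => ‖frameField b o a x₀ (x₀ + t • b i)‖ ^ 2) 1 0 (2 * a i ^ 2) := by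
  simp only [frameField_line]
  refine (J2.norm_sq_line (b o) (a i • b i)).congr_coeff (by rw [b.orthonormal.1 o]; norm_num) ?_ ?_
  · by_cases h : i = o
    · simp [h, ha]
    · rw [inner_smul_right, b.orthonormal.2 (Ne.symm h)]; simp
  · rw [norm_smul, b.orthonormal.1 i, mul_one, Real.norm_eq_abs, sq_abs]

/-- Along `b i` the form is `u_oo + 2 a_i t u_oi + a_i² t² u_ii`. The rotation does not affect the
first derivative, because `u_oi` vanishes at `x₀` for `i ≠ o` and `a o = 0`. It contributes `4 a_i
u_oii` to the second, and this cross term is the reason for rotating. -/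
theorem J2.form_line (hΩ : IsOpen Ω) (hu : ContDiffOn ℝ 4 u Ω) (hx₀ : x₀ ∈ Ω)
    (hl : formMatrix b (fderiv ℝ (fderiv ℝ u) x₀) = Matrix.diagonal l) {o : Fin n}
    {a : Fin n → ℝ} (ha : a o = 0) (i : Fin n) :
    J2 (fun t => fderiv ℝ (fderiv ℝ u) (x₀ + t • b i) (frameField b o a x₀ (x₀ + t • b i))
        (frameField b o a x₀ (x₀ + t • b i))) (l o) (dd (b i) (dd (b o) (dd (b o) u)) x₀)
      (dd (b i) (dd (b i) (dd (b o) (dd (b o) u))) x₀ +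
        4 * a i * dd (b o) (dd (b i) (dd (b i) u)) x₀ + 2 * a i ^ 2 * l i) := by
  have hu4 : ContDiffOn ℝ (4 : ℕ) u Ω := hu
  have hu2 : ContDiffOn ℝ 2 u Ω := hu.of_le (by norm_num)
  have hdd : ∀ p q, ContDiffOn ℝ (2 : ℕ) (dd (b p) (dd (b q) u)) Ω := fun p q =>
    contDiffOn_dd hΩ (contDiffOn_dd hΩ (m := 3) hu4 (by norm_num) _) (by norm_num) _
  have hJ : ∀ p q, _ := fun p q => J2.dd_line hΩ (hdd p q) le_rfl hx₀ (b i)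
  have h1 := ((hJ o o).add ((J2.id.mul (hJ o i)).const_mul (2 * a i))).add
    (((J2.id.mul J2.id).mul (hJ i i)).const_mul (a i ^ 2))
  have hsymm : dd (b i) (dd (b o) (dd (b i) u)) x₀ = dd (b o) (dd (b i) (dd (b i) u)) x₀ :=
    dd_comm hΩ (contDiffOn_dd hΩ (m := 3) hu4 (by norm_num) (b i)) (by norm_num) _ _ hx₀
  have hnhds : ∀ᶠ t in 𝓝 (0 : ℝ), x₀ + t • b i ∈ Ω := by
    have : ContinuousAt (fun t : ℝ => x₀ + t • b i) 0 := by fun_prop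
    exact this.eventually (hΩ.mem_nhds (by simpa using hx₀))
  refine (h1.congr ?_).congr_coeff ?_ ?_ ?_
  · filter_upwards [hnhds] with t ht
    rw [frameField_line]
    simp only [map_add, map_smul, add_apply, smul_apply, smul_eq_mul]
    rw [fderiv_fderiv_symm hΩ hu2 ht (b i) (b o), dd_dd_eq hΩ hu2 ht, dd_dd_eq hΩ hu2 ht,
      dd_dd_eq hΩ hu2 ht]
    ring
  · rw [dd_dd_basis hΩ hu hx₀ hl, Matrix.diagonal_apply_eq]; ring
  · rw [dd_dd_basis hΩ hu hx₀ hl]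
    by_cases h : i = o
    · subst h; rw [ha]; ring
    · rw [Matrix.diagonal_apply_ne _ (Ne.symm h)]; ring
  · rw [dd_dd_basis hΩ hu hx₀ hl i i, Matrix.diagonal_apply_eq, hsymm]; ring

end Touching

/-! ### First and second order conditions at the maximum point -/

section TouchingEstimate

open Filter Topology

variable {n : ℕ} {Ω : Set (EuclideanSpace ℝ (Fin n))} {u : EuclideanSpace ℝ (Fin n) → ℝ}
  {b : OrthonormalBasis (Fin n) ℝ (EuclideanSpace ℝ (Fin n))} {l : Fin n → ℝ}
  {x₀ : EuclideanSpace ℝ (Fin n)}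

theorem contDiffAt_weight (hΩ : IsOpen Ω) (hu : ContDiffOn ℝ 4 u Ω) (hx₀ : x₀ ∈ Ω) (A B : ℝ)
    (z : EuclideanSpace ℝ (Fin n)) : ContDiffAt ℝ 2 (weight A B z u) x₀ := by
  have hu4 : ContDiffOn ℝ (4 : ℕ) u Ω := hu
  rw [funext (weight_eq A B z u (EuclideanSpace.basisFun (Fin n) ℝ))]
  have h1 : ∀ r, ContDiffAt ℝ 2 (dd (EuclideanSpace.basisFun (Fin n) ℝ r) u) x₀ := fun r =>
    (contDiffOn_dd hΩ (m := 2) hu4 (by norm_num) _).contDiffAt (hΩ.mem_nhds hx₀)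
  refine ContDiffAt.add (contDiffAt_const.mul (ContDiffAt.sum fun r _ => (h1 r).pow 2))
    (contDiffAt_const.mul (ContDiffAt.norm_sq ℝ (contDiffAt_id.sub contDiffAt_const)))

theorem contDiff_frameField (o : Fin n) (a : Fin n → ℝ) :
    ContDiff ℝ 2 (frameField b o a x₀) := by
  unfold frameField
  refine contDiff_const.add (ContDiff.sum fun p _ => ?_)
  have h : ContDiff ℝ 2 fun x => a p * inner ℝ (b p) (x - x₀) :=
    contDiff_const.mul (contDiff_const.inner ℝ (contDiff_id.sub contDiff_const))
  exact h.smul contDiff_const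

theorem contDiffAt_form_frameField (hΩ : IsOpen Ω) (hu : ContDiffOn ℝ 4 u Ω) (hx₀ : x₀ ∈ Ω)
    (o : Fin n) (a : Fin n → ℝ) :
    ContDiffAt ℝ 2 (fun x => fderiv ℝ (fderiv ℝ u) x (frameField b o a x₀ x)
      (frameField b o a x₀ x)) x₀ := by
  have h1 : ContDiffAt ℝ 3 (fderiv ℝ u) x₀ :=
    (hu.contDiffAt (hΩ.mem_nhds hx₀)).fderiv_right (by norm_num)
  have h2 : ContDiffAt ℝ 2 (fderiv ℝ (fderiv ℝ u)) x₀ := h1.fderiv_right (by norm_num)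
  have h3 : ContDiffAt ℝ 2 (frameField b o a x₀) x₀ := (contDiff_frameField o a).contDiffAt
  exact (h2.clm_apply h3).clm_apply h3

/-- The first and second order conditions at a maximum point of Pogorelov's test function. -/
theorem touching_estimate (hΩ : IsOpen Ω) (hu : ContDiffOn ℝ 4 u Ω) (hx₀ : x₀ ∈ Ω)
    (hl : formMatrix b (fderiv ℝ (fderiv ℝ u) x₀) = Matrix.diagonal l) {o : Fin n}
    {a : Fin n → ℝ} (ha : a o = 0) (hlo : 0 < l o) {ub : EuclideanSpace ℝ (Fin n) → ℝ} {D K : ℝ≥0}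
    (hdiff : ∀ x ∈ Ω, DifferentiableAt ℝ ub x) (hD : ∀ x ∈ Ω, ‖fderiv ℝ ub x‖₊ ≤ D)
    (hK : LipschitzOnWith K (fderiv ℝ ub) Ω) {F : Fin n → ℝ} (hF : ∀ i, 0 ≤ F i)
    (hae : ∀ᵐ x ∂volume.restrict Ω, DifferentiableAt ℝ (fderiv ℝ ub) x ∧
      0 ≤ ∑ i, F i * fderiv ℝ (fderiv ℝ ub) x (b i) (b i)) {M : ℝ}
    (hM : ∀ i, |fderiv ℝ ub x₀ (b i) - fderiv ℝ u x₀ (b i)| ≤ M) {m : ℕ} (hm : 1 ≤ m)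
    (hW : 0 < ub x₀ - u x₀) {A B : ℝ} {z : EuclideanSpace ℝ (Fin n)}
    (hmax : ∀ x ∈ Ω, ∀ v, (ub x - u x) ^ m * fderiv ℝ (fderiv ℝ u) x v v *
      Real.exp (weight A B z u x) ≤
        (ub x₀ - u x₀) ^ m * l o * Real.exp (weight A B z u x₀) * ‖v‖ ^ 2)
    {T Φ Ψ Φ₂ Ψ₂ : Fin n → ℝ}
    (hT : ∀ i, T i = dd (b i) (dd (b o) (dd (b o) u)) x₀)
    (hΦ : ∀ i, Φ i = B * dd (b i) u x₀ * l i + A * inner ℝ (x₀ - z) (b i))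
    (hΨ : ∀ i, Ψ i = -Φ i - T i / l o)
    (hΦ₂ : ∀ i, Φ₂ i = B * (l i ^ 2 + ∑ r, dd (b r) u x₀ *
      dd (b i) (dd (b i) (dd (b r) u)) x₀) + A)
    (hΨ₂ : ∀ i, Ψ₂ i = 2 * a i ^ 2 - Φ₂ i - (dd (b i) (dd (b i) (dd (b o) (dd (b o) u))) x₀ +
        4 * a i * dd (b o) (dd (b i) (dd (b i) u)) x₀ + 2 * a i ^ 2 * l i) / l o +
        T i ^ 2 / l o ^ 2) :
    (∀ i, |Ψ i| ≤ m * M / (ub x₀ - u x₀)) ∧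
      0 ≤ m * (∑ i, F i * l i) / (ub x₀ - u x₀) + ∑ i, F i * (Ψ₂ i + Ψ i ^ 2 / m) := by
  set W : ℝ := ub x₀ - u x₀ with hWdef
  have hm0 : (0 : ℝ) < m := by exact_mod_cast hm
  set fr := frameField b o a x₀ with hfr
  set N : EuclideanSpace ℝ (Fin n) → ℝ := fun x => fderiv ℝ (fderiv ℝ u) x (fr x) (fr x) with hN
  have hNx₀ : N x₀ = l o := by
    simp only [hN, hfr, frameField_self]
    have : formMatrix b (fderiv ℝ (fderiv ℝ u) x₀) o o = l o := by rw [hl, Matrix.diagonal_apply_eq]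
    exact this
  have hfrx₀ : ‖fr x₀‖ = 1 := by rw [hfr, frameField_self, b.orthonormal.1 o]
  set c : ℝ := m * Real.log W + Real.log (l o) + weight A B z u x₀ with hc
  set ψ : EuclideanSpace ℝ (Fin n) → ℝ := fun x =>
    Real.log (‖fr x‖ ^ 2) - weight A B z u x - Real.log (N x) with hψ
  -- `w` is what `ubar - u` would be if the test function in the direction `fr x`, normalized by
  -- `‖fr x‖²`, kept its maximal value. Maximality thus says that `ubar ≤ u + w` near `x₀`, with
  -- equality at `x₀`.
  set w : EuclideanSpace ℝ (Fin n) → ℝ := fun x => Real.exp ((1 / m) * (c + ψ x)) with hw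
  have hwx₀ : w x₀ = W := by
    simp only [hw, hψ, hNx₀, hfrx₀, hc]
    rw [one_pow, Real.log_one, show 1 / (m : ℝ) * (m * Real.log W + Real.log (l o) +
      weight A B z u x₀ + (0 - weight A B z u x₀ - Real.log (l o))) = Real.log W by
        field_simp; ring, Real.exp_log hW]
  have hNc : ContDiffAt ℝ 2 N x₀ := contDiffAt_form_frameField hΩ hu hx₀ o a
  have hfrc : ContDiffAt ℝ 2 (fun x => ‖fr x‖ ^ 2) x₀ :=
    ContDiffAt.norm_sq ℝ (contDiff_frameField o a).contDiffAt
  have hwc : ContDiffAt ℝ 2 w x₀ := by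
    refine ContDiffAt.exp (contDiffAt_const.mul (contDiffAt_const.add ?_))
    refine ((hfrc.log (by simp only [hfrx₀]; norm_num)).sub (contDiffAt_weight hΩ hu hx₀ A B z)).sub
      (hNc.log (by rw [hNx₀]; exact hlo.ne'))
  set q : EuclideanSpace ℝ (Fin n) → ℝ := fun x => u x + w x with hq
  have huc : ContDiffAt ℝ 2 u x₀ := (hu.contDiffAt (hΩ.mem_nhds hx₀)).of_le (by norm_num)
  have hqc : ContDiffAt ℝ 2 q x₀ := huc.add hwc
  have hle : ∀ᶠ x in 𝓝 x₀, ub x ≤ q x := by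
    have h1 : ∀ᶠ x in 𝓝 x₀, 0 < N x := hNc.continuousAt.eventually_const_lt (by rw [hNx₀]; exact hlo)
    have h2 : ∀ᶠ x in 𝓝 x₀, 0 < ‖fr x‖ ^ 2 :=
      hfrc.continuousAt.eventually_const_lt (by simp only [hfrx₀]; norm_num)
    have h3 : ∀ᶠ x in 𝓝 x₀, x ∈ Ω := hΩ.mem_nhds hx₀
    filter_upwards [h1, h2, h3] with x h1 h2 h3
    rcases le_or_gt (ub x - u x) 0 with h | h
    · have : 0 < w x := Real.exp_pos _
      simp only [hq]; linarith
    · have h4 := hmax x h3 (fr x)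
      have h5 := Real.log_le_log (by positivity) h4
      rw [Real.log_mul (by positivity) (Real.exp_ne_zero _), Real.log_mul (by positivity) h1.ne',
        Real.log_pow, Real.log_exp, Real.log_mul (by positivity) h2.ne',
        Real.log_mul (by positivity) (Real.exp_ne_zero _), Real.log_mul (by positivity) hlo.ne',
        Real.log_pow, Real.log_exp] at h5
      have h6 : Real.log (ub x - u x) ≤ 1 / m * (c + ψ x) := by
        rw [one_div, inv_mul_eq_div, le_div_iff₀ hm0]
        simp only [hψ, hc]
        linarith
      have h7 : ub x - u x ≤ w x := by
        rw [← Real.exp_log h]; exact Real.exp_le_exp.2 h6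
      simp only [hq]; linarith
  have heq : ub x₀ = q x₀ := by simp only [hq, hwx₀, hWdef]; ring
  have hJw : ∀ i, J2 (fun t => w (x₀ + t • b i)) W (W * (1 / m * Ψ i))
      (W * (1 / m * Ψ i) ^ 2 + W * (1 / m * Ψ₂ i)) := by
    intro i
    have j1 := (J2.frameField_norm (b := b) (x₀ := x₀) ha i).log one_pos
    have j2 := J2.weight_line hΩ hu hx₀ hl A B z i
    have j3 := (J2.form_line hΩ hu hx₀ hl ha i).log hlo
    have j4 := ((((J2.const c).add ((j1.sub j2).sub j3))).const_mul (1 / (m : ℝ))).exp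
    have e1 : Real.exp (1 / (m : ℝ) * (c + (Real.log 1 - weight A B z u x₀ - Real.log (l o)))) =
        W := by
      have := hwx₀
      simp only [hw, hψ, hNx₀, hfrx₀] at this
      simpa using this
    refine j4.congr_coeff e1 ?_ ?_
    · rw [e1, hΨ, hΦ, hT]; congr 2; field_simp; ring
    · rw [e1, hΨ₂, hΦ₂, hΨ, hΦ, hT]; field_simp; ring
  have hJq : ∀ i, J2 (fun t => q (x₀ + t • b i)) (u x₀ + W)
      (dd (b i) u x₀ + W * (1 / m * Ψ i))
      (l i + (W * (1 / m * Ψ i) ^ 2 + W * (1 / m * Ψ₂ i))) := by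
    intro i
    have := (J2.dd_line (k := 4) hΩ hu (by norm_num) hx₀ (b i)).add (hJw i)
    rw [dd_dd_basis hΩ hu hx₀ hl, Matrix.diagonal_apply_eq] at this
    exact this
  have huniq := fun i => (J2.of_contDiffAt hqc (b i)).unique (hJq i)
  constructor
  · intro i
    have hloc : IsLocalMax (fun x => ub x - q x) x₀ := by
      filter_upwards [hle] with x hx
      rw [heq]; linarith
    have h1 := hloc.fderiv_eq_zero
    rw [fderiv_fun_sub (hdiff x₀ hx₀) (hqc.differentiableAt (by simp))] at h1
    have h2 : fderiv ℝ ub x₀ (b i) = fderiv ℝ q x₀ (b i) := by rw [sub_eq_zero.1 h1]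
    have h3 := hM i
    rw [h2, (huniq i).2.1, show dd (b i) u x₀ + W * (1 / m * Ψ i) - fderiv ℝ u x₀ (b i) =
      W / m * Ψ i by simp only [dd]; ring, abs_mul, abs_of_pos (by positivity)] at h3
    rw [le_div_iff₀ hW]
    rw [div_mul_eq_mul_div, div_le_iff₀ hm0] at h3
    linarith
  · have h1 := viscosity_subsolution volume hΩ hdiff hD hK hF hae hx₀ hqc hle heq
    rw [Finset.sum_congr rfl fun i _ => by rw [(huniq i).2.2]] at h1
    have h2 : ∑ i, F i * (l i + (W * (1 / m * Ψ i) ^ 2 + W * (1 / m * Ψ₂ i))) =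
        W / m * (m * (∑ i, F i * l i) / W + ∑ i, F i * (Ψ₂ i + Ψ i ^ 2 / m)) := by
      rw [mul_add, show W / m * (m * (∑ i, F i * l i) / W) = ∑ i, F i * l i by
        field_simp, Finset.mul_sum, ← Finset.sum_add_distrib]
      refine Finset.sum_congr rfl fun i _ => ?_
      field_simp
      ring
    rw [h2] at h1
    exact nonneg_of_mul_nonneg_right h1 (by positivity)

end TouchingEstimate

/-! ### The equation `σ_k(D²u) = h^{k-1}`, differentiated twice -/

section EquationJets

open Filter Topology

/-- The jet of a positive function is determined by that of one of its powers. -/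
theorem exists_J2_root {η s : ℝ → ℝ} {s₀ s₁ s₂ : ℝ} (j : ℕ) (hs : J2 s s₀ s₁ s₂)
    (hη : ∀ᶠ t in 𝓝 0, 0 < η t) (h : ∀ᶠ t in 𝓝 0, η t ^ (j + 1) = s t) :
    ∃ h₁ h₂, J2 η (η 0) h₁ h₂ ∧ s₁ = (j + 1) * η 0 ^ j * h₁ ∧
      s₂ = (j + 1) * (j * η 0 ^ (j - 1)) * h₁ ^ 2 + (j + 1) * η 0 ^ j * h₂ := by
  have hs0 : 0 < s₀ := by
    rw [← hs.val, ← h.self_of_nhds]; exact pow_pos hη.self_of_nhds _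
  set r : ℝ := ((j + 1 : ℕ) : ℝ)⁻¹ with hr
  have h1 : J2 (fun t => s t ^ r) _ _ _ := hs.comp (g := fun y => y ^ r)
    (g' := fun y => r * y ^ (r - 1)) (d := r * ((r - 1) * s₀ ^ (r - 1 - 1)))
    (by
      filter_upwards [lt_mem_nhds hs0] with y hy
      exact Real.hasDerivAt_rpow_const (Or.inl hy.ne'))
    ((Real.hasDerivAt_rpow_const (Or.inl hs0.ne')).const_mul r)
  -- The root is not assumed twice differentiable; it inherits a jet from its power, since a smooth
  -- branch of the root exists where that power is positive. How small the value is does not matter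
  -- for this qualitative step.
  have heq : η =ᶠ[𝓝 0] fun t => s t ^ r := by
    filter_upwards [hη, h] with t ht ht'
    rw [← ht', hr, Real.pow_rpow_inv_natCast ht.le (by omega)]
  have h2 := h1.congr heq
  have h3 := h2.congr_coeff h2.val.symm rfl rfl
  have h4 := ((h3.pow (j + 1)).congr (g := s) (by filter_upwards [h] with t ht using ht.symm)).unique
    hs
  refine ⟨_, _, h3, ?_, ?_⟩
  · simpa only [Nat.add_sub_cancel, Nat.cast_add, Nat.cast_one] using h4.2.1.symm
  · simpa only [Nat.add_sub_cancel, Nat.cast_add, Nat.cast_one] using h4.2.2.symm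

/-- Bounds for the jet of a `C^{1,1}` function along a curve. -/
theorem J2.bounds_of_lipschitz {E : Type*} [NormedAddCommGroup E] [NormedSpace ℝ E] {g : E → ℝ}
    {S : Set E} {M : ℝ≥0} (hdiff : ∀ p ∈ S, DifferentiableAt ℝ g p)
    (hbd : ∀ p ∈ S, ‖fderiv ℝ g p‖ ≤ M) (hlip : LipschitzOnWith M (fderiv ℝ g) S)
    {γ γ' : ℝ → E} {γ'' : E} (hγS : ∀ᶠ t in 𝓝 0, γ t ∈ S)
    (hγ : ∀ᶠ t in 𝓝 0, HasDerivAt γ (γ' t) t) (hγ' : HasDerivAt γ' γ'' 0) {a h₁ h₂ : ℝ}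
    (h : J2 (fun t => g (γ t)) a h₁ h₂) :
    |h₁| ≤ M * ‖γ' 0‖ ∧ |h₂| ≤ M * ‖γ''‖ + M * ‖γ' 0‖ ^ 2 := by
  obtain ⟨η', -, rfl, h2, h3⟩ := h
  -- The gradient of `g` is only Lipschitz, so the second derivative is bounded as a limit of
  -- difference quotients of this first derivative.
  have hη' : η' =ᶠ[𝓝 0] fun t => fderiv ℝ g (γ t) (γ' t) := by
    filter_upwards [hγS, hγ, h2] with t ht1 ht2 ht3
    exact ht3.unique ((hdiff _ ht1).hasFDerivAt.comp_hasDerivAt t ht2)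
  have hS0 := hγS.self_of_nhds
  have hη0 := hη'.self_of_nhds
  simp only at hη0
  constructor
  · rw [hη0, ← Real.norm_eq_abs]
    exact (ContinuousLinearMap.le_opNorm _ _).trans (by gcongr; exact hbd _ hS0)
  · have hd := (hasDerivAt_iff_tendsto_slope.1 h3).norm
    have hg := ((hasDerivAt_iff_tendsto_slope.1 hγ').norm.const_mul (M : ℝ)).add
      (((hasDerivAt_iff_tendsto_slope.1 hγ.self_of_nhds).norm.mul_const ‖γ' 0‖).const_mul (M : ℝ))
    rw [← Real.norm_eq_abs, sq]
    refine le_of_tendsto_of_tendsto hd hg ?_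
    filter_upwards [nhdsWithin_le_nhds hη', nhdsWithin_le_nhds hγS] with t ht1 ht2
    rw [slope_def_module, slope_def_module, slope_def_module, norm_smul, norm_smul, norm_smul,
      ht1, hη0]
    have h4 : fderiv ℝ g (γ t) (γ' t) - fderiv ℝ g (γ 0) (γ' 0) =
        fderiv ℝ g (γ t) (γ' t - γ' 0) + (fderiv ℝ g (γ t) - fderiv ℝ g (γ 0)) (γ' 0) := by
      simp
    have h5 : ‖fderiv ℝ g (γ t) (γ' t) - fderiv ℝ g (γ 0) (γ' 0)‖ ≤
        M * ‖γ' t - γ' 0‖ + M * ‖γ t - γ 0‖ * ‖γ' 0‖ := by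
      rw [h4]
      refine (norm_add_le _ _).trans (add_le_add ?_ ?_)
      · exact (ContinuousLinearMap.le_opNorm _ _).trans (by gcongr; exact hbd _ ht2)
      · refine (ContinuousLinearMap.le_opNorm _ _).trans ?_
        gcongr
        exact hlip.norm_sub_le ht2 hS0
    calc _ ≤ ‖(t - 0)⁻¹‖ * (M * ‖γ' t - γ' 0‖ + M * ‖γ t - γ 0‖ * ‖γ' 0‖) := by gcongr
      _ = _ := by ring

variable {n : ℕ} {Ω : Set (EuclideanSpace ℝ (Fin n))} {u : EuclideanSpace ℝ (Fin n) → ℝ}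
  {b : OrthonormalBasis (Fin n) ℝ (EuclideanSpace ℝ (Fin n))} {l : Fin n → ℝ}
  {x₀ : EuclideanSpace ℝ (Fin n)}

theorem dd_dd_dd_comm (hΩ : IsOpen Ω) (hu : ContDiffOn ℝ 4 u Ω)
    (v w : EuclideanSpace ℝ (Fin n)) :
    EqOn (dd v (dd v (dd w u))) (dd w (dd v (dd v u))) Ω := fun x hx => by
  have hu4 : ContDiffOn ℝ (4 : ℕ) u Ω := hu
  rw [dd_congr hΩ (dd_comm hΩ hu4 (by norm_num) v w) v hx]
  exact dd_comm hΩ (contDiffOn_dd hΩ (m := 3) hu4 (by norm_num) v) (by norm_num) v w hx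

theorem dd_dd_dd_dd_comm (hΩ : IsOpen Ω) (hu : ContDiffOn ℝ 4 u Ω)
    (v w : EuclideanSpace ℝ (Fin n)) :
    EqOn (dd v (dd v (dd w (dd w u)))) (dd w (dd w (dd v (dd v u)))) Ω := fun x hx => by
  have hu4 : ContDiffOn ℝ (4 : ℕ) u Ω := hu
  have h1 : EqOn (dd v (dd w (dd w u))) (dd w (dd w (dd v u))) Ω := fun y hy =>
    (dd_dd_dd_comm hΩ hu w v hy).symm
  rw [dd_congr hΩ h1 v hx, dd_comm hΩ (contDiffOn_dd hΩ (m := 2)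
    (contDiffOn_dd hΩ (m := 3) hu4 (by norm_num) v) (by norm_num) w) le_rfl v w hx]
  refine dd_congr hΩ (fun y hy => ?_) w hx
  rw [dd_comm hΩ (contDiffOn_dd hΩ (m := 3) hu4 (by norm_num) v) (by norm_num) v w hy]

theorem hessian_eq_formMatrix (x : EuclideanSpace ℝ (Fin n)) :
    hessian u x = formMatrix (EuclideanSpace.basisFun (Fin n) ℝ) (fderiv ℝ (fderiv ℝ u) x) := by
  ext p q
  simp [hessian, formMatrix]

/-- The expansion of `σ_k(D²u)` along a line through a point where `D²u` is diagonal. -/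
theorem J2.minorSum_line (hΩ : IsOpen Ω) (hu : ContDiffOn ℝ 4 u Ω) (hx₀ : x₀ ∈ Ω)
    (hl : formMatrix b (fderiv ℝ (fderiv ℝ u) x₀) = Matrix.diagonal l) {j : ℕ} (hj : j + 2 ≤ n)
    (v : EuclideanSpace ℝ (Fin n)) :
    J2 (fun t => HessianPogorelov.minorSum n (j + 2)
        (formMatrix b (fderiv ℝ (fderiv ℝ u) (x₀ + t • v))))
      (es Finset.univ (j + 2) l)
      (∑ i, es (Finset.univ.erase i) (j + 1) l * dd v (dd (b i) (dd (b i) u)) x₀)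
      (∑ i, es (Finset.univ.erase i) (j + 1) l * dd v (dd v (dd (b i) (dd (b i) u))) x₀ +
        ∑ i, ∑ p ∈ Finset.univ.erase i, es ((Finset.univ.erase i).erase p) j l *
          (dd v (dd (b i) (dd (b i) u)) x₀ * dd v (dd (b p) (dd (b p) u)) x₀ -
            dd v (dd (b i) (dd (b p) u)) x₀ * dd v (dd (b p) (dd (b i) u)) x₀)) := by
  have hu4 : ContDiffOn ℝ (4 : ℕ) u Ω := hu
  have hu2 : ContDiffOn ℝ 2 u Ω := hu.of_le (by norm_num)
  have hnhds : ∀ᶠ t in 𝓝 (0 : ℝ), x₀ + t • v ∈ Ω := by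
    have : ContinuousAt (fun t : ℝ => x₀ + t • v) 0 := by fun_prop
    exact this.eventually (hΩ.mem_nhds (by simpa using hx₀))
  refine J2.minorSum hj (B := Matrix.of fun p q => dd v (dd (b p) (dd (b q) u)) x₀)
    (C := Matrix.of fun p q => dd v (dd v (dd (b p) (dd (b q) u))) x₀) fun p q => ?_
  have h := J2.dd_line hΩ (contDiffOn_dd hΩ (m := 2) (contDiffOn_dd hΩ (m := 3) hu4 (by norm_num)
    (b q)) (by norm_num) (b p)) le_rfl hx₀ v
  refine (h.congr ?_).congr_coeff (dd_dd_basis hΩ hu hx₀ hl p q) rfl rfl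
  filter_upwards [hnhds] with t ht
  rw [dd_dd_eq hΩ hu2 ht]; rfl

/-- The equation, differentiated twice. -/
theorem equation_jet (hΩ : IsOpen Ω) (hu : ContDiffOn ℝ 4 u Ω) (hx₀ : x₀ ∈ Ω)
    (hl : formMatrix b (fderiv ℝ (fderiv ℝ u) x₀) = Matrix.diagonal l) {j : ℕ} (hj : j + 2 ≤ n)
    {h : EuclideanSpace ℝ (Fin n) → ℝ} (hpos : ∀ x ∈ Ω, 0 < h x)
    (heq : ∀ x ∈ Ω, h x ^ (j + 1) = sigma (j + 2) (eigenvalues (hessian u x)))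
    (v : EuclideanSpace ℝ (Fin n)) :
    ∃ h₁ h₂, J2 (fun t => h (x₀ + t • v)) (h x₀) h₁ h₂ ∧
      ∑ i, es (Finset.univ.erase i) (j + 1) l * dd v (dd (b i) (dd (b i) u)) x₀ =
        (j + 1) * h x₀ ^ j * h₁ ∧
      ∑ i, es (Finset.univ.erase i) (j + 1) l * dd v (dd v (dd (b i) (dd (b i) u))) x₀ +
        ∑ i, ∑ p ∈ Finset.univ.erase i, es ((Finset.univ.erase i).erase p) j l *
          (dd v (dd (b i) (dd (b i) u)) x₀ * dd v (dd (b p) (dd (b p) u)) x₀ -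
            dd v (dd (b i) (dd (b p) u)) x₀ * dd v (dd (b p) (dd (b i) u)) x₀) =
        (j + 1) * (j * h x₀ ^ (j - 1)) * h₁ ^ 2 + (j + 1) * h x₀ ^ j * h₂ := by
  have hu2 : ContDiffOn ℝ 2 u Ω := hu.of_le (by norm_num)
  have hnhds : ∀ᶠ t in 𝓝 (0 : ℝ), x₀ + t • v ∈ Ω := by
    have : ContinuousAt (fun t : ℝ => x₀ + t • v) 0 := by fun_prop
    exact this.eventually (hΩ.mem_nhds (by simpa using hx₀))
  have := exists_J2_root j (J2.minorSum_line hΩ hu hx₀ hl hj v) (η := fun t => h (x₀ + t • v))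
    (by filter_upwards [hnhds] with t ht using hpos _ ht)
    (by
      filter_upwards [hnhds] with t ht
      rw [heq _ ht, minorSum_formMatrix (hessian_eq_formMatrix _)
        (fderiv_fderiv_symm hΩ hu2 ht) hj])
  simpa only [zero_smul, add_zero] using this

end EquationJets

/-! ### Concavity and mixed terms in the twice differentiated equation -/

section ThirdOrder

variable {n : ℕ}

/-- The indices `p` with `k - 1 ≤ p` for `k = j + 2`. -/
def tailIndices (n j : ℕ) : Finset (Fin n) := Finset.univ.filter fun p => j + 1 ≤ (p : ℕ)

theorem mem_tailIndices {j : ℕ} {p : Fin n} : p ∈ tailIndices n j ↔ j + 1 ≤ (p : ℕ) := by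
  simp [tailIndices]

/-- The indices `p` with `1 ≤ p ≤ j`. -/
def middleIndices (n j : ℕ) : Finset (Fin n) :=
  Finset.univ.filter fun p => 1 ≤ (p : ℕ) ∧ (p : ℕ) ≤ j

theorem card_middleIndices {j : ℕ} (hj : j + 2 ≤ n) : (middleIndices n j).card = j := by
  have : (middleIndices n j).map Fin.valEmbedding = Finset.Icc 1 j := by
    ext p
    simp only [middleIndices, Finset.mem_map, Finset.mem_filter, Finset.mem_univ, true_and,
      Fin.valEmbedding_apply, Finset.mem_Icc]
    constructor
    · rintro ⟨q, hq, rfl⟩; exact hq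
    · intro hp; exact ⟨⟨p, by omega⟩, hp, rfl⟩
  rw [← Finset.card_map Fin.valEmbedding, this]; simp

/-- Removing the `k-2` middle indices leaves the leading one and the tail, so `ℓ` is the largest
eigenvalue plus the tail sum. -/
theorem univ_sdiff_middleIndices {j : ℕ} (hj : j + 2 ≤ n) :
    Finset.univ \ middleIndices n j = insert ⟨0, by omega⟩ (tailIndices n j) := by
  ext p
  simp only [middleIndices, tailIndices, Finset.mem_sdiff, Finset.mem_filter, Finset.mem_univ,
    true_and, Finset.mem_insert, Fin.ext_iff]
  omega

theorem zero_notMem_tailIndices {j : ℕ} (hj : j + 2 ≤ n) :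
    (⟨0, by omega⟩ : Fin n) ∉ tailIndices n j := by
  simp [mem_tailIndices]

/-- The tail arises by removing `k-1` indices, and each removal lowers the cone by one, leaving
`Γ_1`. Hence `ℓ` exceeds the largest eigenvalue, which allows division by it. -/
theorem Cone.sum_tailIndices_pos {j : ℕ} (hj : j + 2 ≤ n) {l : Fin n → ℝ}
    (hl : Cone Finset.univ (j + 2) l) : 0 < ∑ p ∈ tailIndices n j, l p := by
  have h1 : tailIndices n j =
      Finset.univ \ insert ⟨0, by omega⟩ (middleIndices n j) := by
    ext p
    simp only [middleIndices, tailIndices, Finset.mem_sdiff, Finset.mem_filter, Finset.mem_univ,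
      true_and, Finset.mem_insert, Fin.ext_iff]
    omega
  have hcard : (insert ⟨0, by omega⟩ (middleIndices n j) : Finset (Fin n)).card = j + 1 := by
    rw [Finset.card_insert_of_notMem (by simp [middleIndices]), card_middleIndices hj]
  have h2 : Cone (tailIndices n j) 1 l := by
    rw [h1]
    refine Cone.sdiff (Finset.subset_univ _) ?_
    rw [hcard, show 1 + (j + 1) = j + 2 by ring]
    exact hl
  rw [← es_one]
  exact h2 1 le_rfl

/-- The concavity of the equation, in the form needed for functions with
`σ_k = h ^ (k - 1)`. -/
theorem Cone.second_order_le {j : ℕ} (hj : j + 2 ≤ n) {l : Fin n → ℝ}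
    (hl : Cone Finset.univ (j + 2) l) {ξ : Fin n → ℝ} {h h₁ : ℝ} (hh : 0 < h)
    (hσ : h ^ (j + 1) = es Finset.univ (j + 2) l)
    (h1 : ∑ i, es (Finset.univ.erase i) (j + 1) l * ξ i = (j + 1) * h ^ j * h₁) :
    ∑ i, ∑ p ∈ Finset.univ.erase i, es ((Finset.univ.erase i).erase p) j l * (ξ i * ξ p) ≤
      (j + 1) * (j * h ^ (j - 1)) * h₁ ^ 2 + 2 * h ^ j * h₁ *
        ((ξ ⟨0, by omega⟩ + ∑ p ∈ tailIndices n j, ξ p) /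
          (l ⟨0, by omega⟩ + ∑ p ∈ tailIndices n j, l p)) := by
  have hcard := card_middleIndices hj
  have key := Cone.log_concave (Finset.subset_univ (middleIndices n j)) (x := l)
    (by rw [hcard]; exact hl) ξ (by rw [hcard]; exact J2.es_line hj l ξ)
  rw [hcard, univ_sdiff_middleIndices hj, es_one, es_one,
    Finset.sum_insert (zero_notMem_tailIndices hj), Finset.sum_insert (zero_notMem_tailIndices hj),
    h1, ← hσ] at key
  set r : ℝ := (ξ ⟨0, by omega⟩ + ∑ p ∈ tailIndices n j, ξ p) /
    (l ⟨0, by omega⟩ + ∑ p ∈ tailIndices n j, l p) with hr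
  set s := ∑ i, ∑ p ∈ Finset.univ.erase i, es ((Finset.univ.erase i).erase p) j l * (ξ i * ξ p)
    with hs
  have e1 : (j + 1) * h ^ j * h₁ / h ^ (j + 1) = (j + 1) * (h₁ / h) := by
    rw [pow_succ]; field_simp
  -- For `j = 0` the truncated exponent `j - 1` is harmless thanks to the factor `j`.
  have e2 : (j : ℝ) * h ^ (j - 1) * h ^ 2 = j * h ^ (j + 1) := by
    cases j with
    | zero => simp
    | succ j => rw [Nat.add_sub_cancel]; ring
  rw [e1] at key
  -- In terms of `h₁/h` the coefficient is `(j+1)² - (j+1) = (j+1) j`, exactly that of the term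
  -- `h^{j-1} h₁²` in the second derivative of `h^{j+1}`. Only the linear term in `r` remains; the
  -- terms `-r²` are dropped.
  have e3 : s / h ^ (j + 1) ≤ (j + 1) * j * (h₁ / h) ^ 2 + 2 * (h₁ / h) * r := by
    have hj1 : (0 : ℝ) < (j : ℝ) + 1 := by positivity
    have e4 : ((j : ℝ) + 1)⁻¹ * ((j + 1) * (h₁ / h) - r) ^ 2 =
        (j + 1) * (h₁ / h) ^ 2 - 2 * (h₁ / h) * r + ((j : ℝ) + 1)⁻¹ * r ^ 2 := by
      field_simp; ring
    have e5 : 0 ≤ ((j : ℝ) + 1)⁻¹ * r ^ 2 := by positivity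
    nlinarith [sq_nonneg r]
  rw [div_le_iff₀ (by positivity)] at e3
  refine e3.trans (le_of_eq ?_)
  have e6 : ((j : ℝ) + 1) * j * (h₁ / h) ^ 2 * h ^ (j + 1) =
      (j + 1) * (j * h ^ (j - 1)) * h₁ ^ 2 := by
    have : ((j : ℝ) + 1) * j * (h₁ / h) ^ 2 * h ^ (j + 1) =
      ((j : ℝ) + 1) * (j * h ^ (j + 1)) * (h₁ ^ 2 / h ^ 2) := by rw [div_pow]; ring
    rw [this, ← e2]; field_simp
  rw [add_mul, e6]
  congr 1
  rw [pow_succ]; field_simp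

/-- The lower bound for the fourth order terms. -/
theorem Cone.fourth_order_ge {j : ℕ} (hj : j + 2 ≤ n) {l : Fin n → ℝ}
    (hl : Cone Finset.univ (j + 2) l) {o : Fin n} (ho : (o : ℕ) = 0) {ξ T Q : Fin n → ℝ}
    {U : Fin n → Fin n → ℝ} {h h₁ h₂ C : ℝ} (hh : 0 < h)
    (hσ : h ^ (j + 1) = es Finset.univ (j + 2) l) (hlo : 0 < l o)
    (h1 : ∑ i, es (Finset.univ.erase i) (j + 1) l * ξ i = (j + 1) * h ^ j * h₁)
    (h2 : ∑ i, es (Finset.univ.erase i) (j + 1) l * Q i +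
        ∑ i, ∑ p ∈ Finset.univ.erase i, es ((Finset.univ.erase i).erase p) j l *
          (ξ i * ξ p - U i p * U p i) =
        (j + 1) * (j * h ^ (j - 1)) * h₁ ^ 2 + (j + 1) * h ^ j * h₂)
    (hU : ∀ i p, U i p = U p i) (hT : ∀ i, U o i = T i) (hξ : ξ o = T o)
    (hC₁ : |h₁| ≤ C) (hC₂ : |h₂| ≤ C * (1 + l o)) :
    -(2 * h ^ j * C * (|T o| + ∑ p ∈ tailIndices n j, |ξ p|) / l o) -
        ((j + 2 : ℕ) : ℝ) * C * h ^ j * (1 + l o) +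
      2 * ∑ i ∈ Finset.univ.erase o, es ((Finset.univ.erase o).erase i) j l * T i ^ 2 ≤
        ∑ i, es (Finset.univ.erase i) (j + 1) l * Q i := by
  have hC : 0 ≤ C := (abs_nonneg _).trans hC₁
  have hodef : o = ⟨0, by omega⟩ := Fin.ext ho
  have hpp : ∀ i p, i ≠ p → 0 ≤ es ((Finset.univ.erase i).erase p) j l := fun i p hip =>
    (((hl.erase (Finset.mem_univ i)).erase (Finset.mem_erase.2 ⟨hip.symm, Finset.mem_univ p⟩))
      j le_rfl).le
  have hsec := hl.second_order_le hj hh hσ h1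
  rw [← hodef] at hsec
  set r : ℝ := (ξ o + ∑ p ∈ tailIndices n j, ξ p) / (l o + ∑ p ∈ tailIndices n j, l p) with hr
  have hrle : |r| ≤ (|T o| + ∑ p ∈ tailIndices n j, |ξ p|) / l o := by
    have hpos := hl.sum_tailIndices_pos hj
    rw [hr, abs_div, abs_of_pos (by linarith : 0 < l o + ∑ p ∈ tailIndices n j, l p)]
    refine div_le_div₀ (by positivity) ?_ hlo (by linarith)
    refine (abs_add_le _ _).trans ?_
    rw [hξ]
    gcongr
    exact Finset.abs_sum_le_sum_abs _ _
  -- the mixed third order terms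
  have hmix : 2 * ∑ i ∈ Finset.univ.erase o, es ((Finset.univ.erase o).erase i) j l * T i ^ 2 ≤
      ∑ i, ∑ p ∈ Finset.univ.erase i, es ((Finset.univ.erase i).erase p) j l * (U i p * U p i) := by
    rw [← Finset.add_sum_erase _ _ (Finset.mem_univ o), two_mul]
    -- The row and the column of `o` supply one copy each of the sum; the other entries are squares
    -- with nonnegative coefficients.
    refine add_le_add (le_of_eq ?_) (Finset.sum_le_sum fun i hi => ?_)
    · exact Finset.sum_congr rfl fun i _ => by rw [hU i o, hT, sq]
    · have hio := (Finset.mem_erase.1 hi).1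
      have hmem : o ∈ Finset.univ.erase i := Finset.mem_erase.2 ⟨hio.symm, Finset.mem_univ o⟩
      refine le_trans (le_of_eq ?_) (Finset.single_le_sum (f := fun p =>
        es ((Finset.univ.erase i).erase p) j l * (U i p * U p i)) (fun p hp => ?_) hmem)
      · rw [Finset.erase_right_comm, hU i o, hT, sq]
      · rw [hU i p, ← sq]
        exact mul_nonneg (hpp i p (Finset.mem_erase.1 hp).1.symm) (sq_nonneg _)
  simp only [mul_sub, Finset.sum_sub_distrib] at h2
  have b1 : 2 * h ^ j * h₁ * r ≤ 2 * h ^ j * C * (|T o| + ∑ p ∈ tailIndices n j, |ξ p|) / l o := by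
    have : h₁ * r ≤ C * ((|T o| + ∑ p ∈ tailIndices n j, |ξ p|) / l o) := by
      refine (le_abs_self _).trans ?_
      rw [abs_mul]; gcongr
    calc 2 * h ^ j * h₁ * r = 2 * h ^ j * (h₁ * r) := by ring
      _ ≤ 2 * h ^ j * (C * ((|T o| + ∑ p ∈ tailIndices n j, |ξ p|) / l o)) := by gcongr
      _ = _ := by ring
  have b2 : -(((j + 2 : ℕ) : ℝ) * C * h ^ j * (1 + l o)) ≤ (j + 1) * h ^ j * h₂ := by
    have h3 : -(C * (1 + l o)) ≤ h₂ := (abs_le.1 hC₂).1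
    have h4 : (0 : ℝ) ≤ (j + 1) * h ^ j := by positivity
    have h5 := mul_le_mul_of_nonneg_left h3 h4
    have h6 : 0 ≤ C * h ^ j * (1 + l o) := by positivity
    push_cast
    linarith
  linarith

end ThirdOrder

/-! ### Pogorelov's estimate at the maximum point -/

section MaximumPoint

open Filter Topology

variable {n : ℕ} {Ω : Set (EuclideanSpace ℝ (Fin n))} {u : EuclideanSpace ℝ (Fin n) → ℝ}
  {b : OrthonormalBasis (Fin n) ℝ (EuclideanSpace ℝ (Fin n))} {l : Fin n → ℝ}
  {x₀ : EuclideanSpace ℝ (Fin n)}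

theorem Cone.gradient_pos {j : ℕ} (hl : Cone Finset.univ (j + 2) l) (i : Fin n) :
    0 < es (Finset.univ.erase i) (j + 1) l :=
  (hl.erase (Finset.mem_univ i)) _ le_rfl

theorem Cone.le_es_one {j : ℕ} (hl : Cone Finset.univ (j + 2) l) (i : Fin n) :
    l i ≤ es Finset.univ 1 l := by
  have h1 := es_erase (Finset.mem_univ i) 0 l
  have h2 := (hl.erase (Finset.mem_univ i)) 1 (by omega)
  simp only [zero_add, es_zero, mul_one] at h1
  linarith

/-- The trace is positive, so no eigenvalue lies below `-(n-1)` times the largest one. -/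
theorem Cone.sub_le {j : ℕ} (hl : Cone Finset.univ (j + 2) l) {o : Fin n} (ho : ∀ i, l i ≤ l o)
    (i : Fin n) : l o - l i ≤ n * l o := by
  have h1 := hl 1 (by omega)
  rw [es_one, ← Finset.add_sum_erase _ _ (Finset.mem_univ i)] at h1
  have h2 := Finset.sum_le_card_nsmul (Finset.univ.erase i) l (l o) fun p _ => ho p
  rw [Finset.card_erase_of_mem (Finset.mem_univ i), Finset.card_univ, Fintype.card_fin,
    nsmul_eq_mul, Nat.cast_sub i.pos, Nat.cast_one] at h2
  linarith

theorem Cone.leading_pos {j : ℕ} (hl : Cone Finset.univ (j + 2) l) {o : Fin n}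
    (ho : ∀ i, l i ≤ l o) : 0 < l o := by
  have h1 := hl 1 (by omega)
  rw [es_one] at h1
  have h2 := Finset.sum_le_card_nsmul Finset.univ l (l o) fun p _ => ho p
  rw [nsmul_eq_mul] at h2
  by_contra! h
  have h3 : ((Finset.univ : Finset (Fin n)).card : ℝ) * l o ≤ 0 :=
    mul_nonpos_of_nonneg_of_nonpos (by positivity) h
  linarith

/-- The linearized operator dominates a power of the largest eigenvalue. -/
theorem Cone.rpow_mul_le_sum_gradient {j : ℕ} (hj : j + 2 ≤ n) (hl : Cone Finset.univ (j + 2) l)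
    {o : Fin n} (hlo : 0 ≤ l o) {h : ℝ} (hσ : h ^ (j + 1) = es Finset.univ (j + 2) l) :
    l o ^ ((j + 1 : ℕ) : ℝ)⁻¹ * h ^ j ≤ ∑ i, es (Finset.univ.erase i) (j + 1) l := by
  have hpos := hl (j + 1) (by omega)
  have h1 : l o ^ ((j + 1 : ℕ) : ℝ)⁻¹ * h ^ j ≤ es Finset.univ (j + 1) l := by
    -- After raising to the power `k - 1` this becomes `λ_max σ_k^{k-2} ≤ σ_{k-1}^{k-1}`, which is
    -- the Maclaurin-type inequality since `λ_max ≤ σ_1`.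
    refine le_of_pow_le_pow_left₀ (n := j + 1) (by omega) hpos.le ?_
    rw [mul_pow, Real.rpow_inv_natCast_pow hlo (by omega), ← pow_mul, mul_comm j, pow_mul, hσ]
    refine le_trans ?_ hl.maclaurin
    have := hl (j + 2) le_rfl
    gcongr
    exact hl.le_es_one o
  rw [sum_es_erase, Finset.card_univ, Fintype.card_fin]
  refine h1.trans (le_mul_of_one_le_left hpos.le ?_)
  have : ((j + 2 : ℕ) : ℝ) ≤ n := by exact_mod_cast hj
  push_cast at this ⊢
  linarith

/-- The second derivative is symmetric wherever it exists, as `ub` is differentiable nearby; the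
coefficients `l` and the basis are frozen while `x` varies. -/
theorem IsKConvexAEOn.trace_gradient_nonneg {j : ℕ} (hj : j + 2 ≤ n) (hΩ : IsOpen Ω)
    {ub : EuclideanSpace ℝ (Fin n) → ℝ} (hdiff : ∀ x ∈ Ω, DifferentiableAt ℝ ub x)
    (hconv : IsKConvexAEOn (j + 2) ub Ω) (hl : Cone Finset.univ (j + 2) l) :
    ∀ᵐ x ∂volume.restrict Ω, DifferentiableAt ℝ (fderiv ℝ ub) x ∧
      0 ≤ ∑ i, es (Finset.univ.erase i) (j + 1) l * fderiv ℝ (fderiv ℝ ub) x (b i) (b i) := by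
  filter_upwards [hconv, ae_restrict_mem hΩ.measurableSet] with x hx hxΩ
  refine ⟨hx.1, HessianPogorelov.trace_gradient_nonneg hj (hessian_eq_formMatrix x) ?_ hx.2 b hl⟩
  refine second_derivative_symmetric_of_eventually (f := ub) ?_ hx.1.hasFDerivAt
  filter_upwards [hΩ.mem_nhds hxΩ] with y hy using (hdiff y hy).hasFDerivAt

/-- Pogorelov's estimate at a maximum point of the test function. -/
theorem max_point_estimate {j : ℕ} (hj : j + 2 ≤ n) {c₀ : ℝ} (hc₀ : 0 < c₀)
    (hgrad : ∀ x : Fin n → ℝ, Antitone x → Cone Finset.univ (j + 2) x → ∀ p : Fin n,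
      j + 1 ≤ (p : ℕ) → c₀ * ∑ i, es (Finset.univ.erase i) (j + 1) x ≤
        es (Finset.univ.erase p) (j + 1) x)
    (hΩ : IsOpen Ω) (hu : ContDiffOn ℝ 4 u Ω) (hx₀ : x₀ ∈ Ω)
    (hl : formMatrix b (fderiv ℝ (fderiv ℝ u) x₀) = Matrix.diagonal l) (hanti : Antitone l)
    (hcone : Cone Finset.univ (j + 2) l) {o : Fin n} (ho : (o : ℕ) = 0)
    {h : EuclideanSpace ℝ (Fin n) → ℝ} (hpos : ∀ x ∈ Ω, 0 < h x)
    (heq : ∀ x ∈ Ω, h x ^ (j + 1) = sigma (j + 2) (eigenvalues (hessian u x))) {C : ℝ}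
    (hhC : h x₀ ≤ C)
    (hjet : ∀ v : EuclideanSpace ℝ (Fin n), ‖v‖ = 1 → ∀ h₁ h₂,
      J2 (fun t => h (x₀ + t • v)) (h x₀) h₁ h₂ →
        |h₁| ≤ C ∧ |h₂| ≤ C * (1 + |fderiv ℝ (fderiv ℝ u) x₀ v v|))
    {ub : EuclideanSpace ℝ (Fin n) → ℝ} {D K : ℝ≥0}
    (hdiff : ∀ x ∈ Ω, DifferentiableAt ℝ ub x) (hD : ∀ x ∈ Ω, ‖fderiv ℝ ub x‖₊ ≤ D)
    (hK : LipschitzOnWith K (fderiv ℝ ub) Ω) (hconv : IsKConvexAEOn (j + 2) ub Ω)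
    {A B M M₁ R : ℝ} {m : ℕ} {z : EuclideanSpace ℝ (Fin n)} (hA : 0 < A) (hB : 0 < B)
    (hm : 2 ≤ m) (hBM : 8 * B * M₁ ^ 2 ≤ 1) (hAR : 8 * A * R ^ 2 ≤ 1)
    (hy : ‖fderiv ℝ u x₀‖ ≤ M₁) (hM : ‖fderiv ℝ ub x₀ - fderiv ℝ u x₀‖ ≤ M)
    (hR : ‖x₀ - z‖ ≤ R) (hW : 0 < ub x₀ - u x₀)
    (hmax : ∀ x ∈ Ω, ∀ v, (ub x - u x) ^ m * fderiv ℝ (fderiv ℝ u) x v v *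
      Real.exp (weight A B z u x) ≤
        (ub x₀ - u x₀) ^ m * l o * Real.exp (weight A B z u x₀) * ‖v‖ ^ 2)
    (hΛ : 1 ≤ l o) (hWΛ : 1 ≤ (ub x₀ - u x₀) * l o)
    (hlarge : 980 * n * (m * M / (ub x₀ - u x₀)) ^ 2 ≤ B * l o ^ 2) :
    (ub x₀ - u x₀) * l o ^ ((j + 1 : ℕ) : ℝ)⁻¹ ≤ 2 / A * (m * (j + 2 : ℕ) * C +
      pointConst n (j + 2) A B M M₁ R C c₀ m * (ub x₀ - u x₀)) := by
  have hΛ0 : 0 < l o := by linarith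
  have hn : (0 : ℝ) < n := by exact_mod_cast (o.pos : 0 < n)
  have hh := hpos x₀ hx₀
  have hC : 0 ≤ C := hh.le.trans hhC
  have hM0 : 0 ≤ M := (norm_nonneg _).trans hM
  have hM₁0 : 0 ≤ M₁ := (norm_nonneg _).trans hy
  have hR0 : 0 ≤ R := (norm_nonneg _).trans hR
  have hb : ∀ i, ‖b i‖ = 1 := b.orthonormal.1
  have hmax_l : ∀ i, l i ≤ l o := fun i => hanti (by rw [Fin.le_def, ho]; exact Nat.zero_le _)
  have hσ : h x₀ ^ (j + 1) = es Finset.univ (j + 2) l := by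
    rw [heq x₀ hx₀, ← minorSum_formMatrix (hessian_eq_formMatrix x₀)
      (fderiv_fderiv_symm hΩ (hu.of_le (by norm_num)) hx₀) hj b, hl]
    refine minorSum_eq_es hj fun r => ?_
    rw [Matrix.diagonal_add, Matrix.det_diagonal]
  have hlo : ∀ i, fderiv ℝ (fderiv ℝ u) x₀ (b i) (b i) = l i := fun i => by
    have : formMatrix b (fderiv ℝ (fderiv ℝ u) x₀) i i = l i := by rw [hl, Matrix.diagonal_apply_eq]
    exact this
  have hop : ∀ (L : EuclideanSpace ℝ (Fin n) →L[ℝ] ℝ) (i : Fin n), |L (b i)| ≤ ‖L‖ := fun L i => by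
    have := L.le_opNorm (b i); rwa [hb, mul_one] at this
  set S := tailIndices n j with hS
  have hoS : o ∉ S := by rw [hS, mem_tailIndices]; omega
  set F : Fin n → ℝ := fun i => es (Finset.univ.erase i) (j + 1) l with hF
  have hFpos : ∀ i, 0 < F i := hcone.gradient_pos
  set T : Fin n → ℝ := fun i => dd (b i) (dd (b o) (dd (b o) u)) x₀ with hT
  set ξ : Fin n → ℝ := fun i => dd (b o) (dd (b i) (dd (b i) u)) x₀ with hξ
  set Q : Fin n → ℝ := fun i => dd (b i) (dd (b i) (dd (b o) (dd (b o) u))) x₀ with hQ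
  -- The value `ξ_i/(nΛ)` minimizes `2n a² - 4aξ_i/Λ`, which bounds the contribution of the rotation
  -- because `Λ - l_i ≤ nΛ`. The minimum is `-2ξ_i²/(nΛ²)`.
  set a : Fin n → ℝ := fun i => if i ∈ S then ξ i / (n * l o) else 0 with ha
  set Φ : Fin n → ℝ := fun i => B * dd (b i) u x₀ * l i + A * inner ℝ (x₀ - z) (b i) with hΦ
  set Ψ : Fin n → ℝ := fun i => -Φ i - T i / l o with hΨ
  set Φ₂ : Fin n → ℝ := fun i => B * (l i ^ 2 + ∑ r, dd (b r) u x₀ *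
      dd (b i) (dd (b i) (dd (b r) u)) x₀) + A with hΦ₂
  set Ψ₂ : Fin n → ℝ := fun i => 2 * a i ^ 2 - Φ₂ i - (Q i + 4 * a i * ξ i +
    2 * a i ^ 2 * l i) / l o + T i ^ 2 / l o ^ 2 with hΨ₂
  obtain ⟨hΨM, hvisc⟩ := touching_estimate hΩ hu hx₀ hl (o := o) (a := a) (by simp [ha, hoS]) hΛ0
    hdiff hD hK (fun i => (hFpos i).le) (hconv.trace_gradient_nonneg hj hΩ hdiff hcone)
    (fun i => (hop (fderiv ℝ ub x₀ - fderiv ℝ u x₀) i).trans hM) (by omega : 1 ≤ m) hW hmax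
    (T := T) (Φ := Φ) (Ψ := Ψ) (Φ₂ := Φ₂) (Ψ₂ := Ψ₂) (fun i => rfl) (fun i => rfl) (fun i => rfl)
    (fun i => rfl) (fun i => rfl)
  -- Euler's identity for the homogeneous function `σ_k`.
  have hFl : ∑ i, F i * l i = ((j + 2 : ℕ) : ℝ) * h x₀ ^ (j + 1) := by
    rw [hσ, show ((j + 2 : ℕ) : ℝ) = ((j + 1 : ℕ) : ℝ) + 1 by push_cast; ring,
      ← sum_mul_es_erase Finset.univ (j + 1) l]
    exact Finset.sum_congr rfl fun i _ => mul_comm _ _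
  rw [hFl] at hvisc
  refine pointwise_estimate o S (l := l) (F := F)
    (e := fun i => es ((Finset.univ.erase o).erase i) j l) (y := fun i => dd (b i) u x₀)
    (X := fun i => inner ℝ (x₀ - z) (b i)) (T := T) (Q := Q) (ξ := ξ) (Φ := Φ) (Ψ := Ψ) (Φ₂ := Φ₂)
    (Ψ₂ := Ψ₂) (G := h x₀ ^ j) (f := h x₀ ^ (j + 1)) (hA := hA) (hB := hB)
    (hβ := by exact_mod_cast hm) (hM := hM0) (hR := hR0) (hC := hC) (hc₀ := hc₀)
    (hBM := hBM) (hAR := hAR) (hF := hFpos) (hlo := rfl) (hΛ := hΛ) (he := ?_)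
    (hy := fun i => (hop (fderiv ℝ u x₀) i).trans hy)
    (hX := fun i => ?_) (hΦ := fun i => rfl) (hΨ := fun i => rfl) (hW := hW) (hΨM := hΨM)
    (hvisc := hvisc) (hΨ₂ := ?_) (hΦ₂ := ?_) (hQ := ?_) (hf := ?_) (hG := by positivity)
    (hθ := ?_) (hθG := hcone.rpow_mul_le_sum_gradient hj hΛ0.le hσ)
    (hS := fun p hp => hgrad l hanti hcone p (mem_tailIndices.1 hp)) (hWΛ := hWΛ)
    (hlarge := hlarge)
  · intro i hi
    have hio : i ∈ Finset.univ.erase o := Finset.mem_erase.2 ⟨hi, Finset.mem_univ i⟩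
    have hoi : o ∈ Finset.univ.erase i := Finset.mem_erase.2 ⟨hi.symm, Finset.mem_univ o⟩
    refine ⟨(((hcone.erase (Finset.mem_univ o)).erase hio) j le_rfl).le, ?_⟩
    simp only [hF]
    rw [es_erase hoi j l, es_erase hio j l, Finset.erase_right_comm]
    ring
  · refine (abs_real_inner_le_norm _ _).trans ?_
    rw [hb, mul_one]; exact hR
  · intro i
    simp only [hΨ₂, ha]
    by_cases hi : i ∈ S
    · simp only [hi, if_true]
      have h1 := hcone.sub_le hmax_l i
      have h2 : 2 * (ξ i / (n * l o)) ^ 2 - Φ₂ i - (Q i + 4 * (ξ i / (n * l o)) * ξ i +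
          2 * (ξ i / (n * l o)) ^ 2 * l i) / l o + T i ^ 2 / l o ^ 2 =
          -Φ₂ i - Q i / l o + T i ^ 2 / l o ^ 2 - 2 * ξ i ^ 2 / (n * l o ^ 2) -
            2 * ξ i ^ 2 / (n ^ 2 * l o ^ 3) * (n * l o - (l o - l i)) := by
        field_simp; ring
      have h3 : 0 ≤ 2 * ξ i ^ 2 / (n ^ 2 * l o ^ 3) * (n * l o - (l o - l i)) :=
        mul_nonneg (by positivity) (by linarith)
      linarith
    · simp only [hi, if_false]
      apply le_of_eq; ring
  · have h1 : ∀ r, |∑ i, F i * dd (b i) (dd (b i) (dd (b r) u)) x₀| ≤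
        ((j + 2 : ℕ) : ℝ) * C * h x₀ ^ j := fun r => by
      obtain ⟨h₁, h₂, hJ, e1, -⟩ := equation_jet hΩ hu hx₀ hl hj hpos heq (b r)
      have e2 : ∑ i, F i * dd (b i) (dd (b i) (dd (b r) u)) x₀ = (j + 1) * h x₀ ^ j * h₁ := by
        rw [← e1]
        exact Finset.sum_congr rfl fun i _ => by rw [dd_dd_dd_comm hΩ hu (b i) (b r) hx₀]
      rw [e2, abs_mul, abs_of_nonneg (by positivity)]
      have e3 := (hjet (b r) (hb r) h₁ h₂ hJ).1
      calc (j + 1) * h x₀ ^ j * |h₁| ≤ (j + 1) * h x₀ ^ j * C := by gcongr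
        _ ≤ ((j + 2 : ℕ) : ℝ) * h x₀ ^ j * C := by gcongr; push_cast; linarith
        _ = _ := by ring
    have h2 : ∑ i, F i * Φ₂ i = B * ∑ i, F i * l i ^ 2 + A * ∑ i, F i +
        B * ∑ r, dd (b r) u x₀ * ∑ i, F i * dd (b i) (dd (b i) (dd (b r) u)) x₀ := by
      have h3 : ∑ r, dd (b r) u x₀ * ∑ i, F i * dd (b i) (dd (b i) (dd (b r) u)) x₀ =
          ∑ i, F i * ∑ r, dd (b r) u x₀ * dd (b i) (dd (b i) (dd (b r) u)) x₀ := by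
        simp only [Finset.mul_sum]
        rw [Finset.sum_comm]
        exact Finset.sum_congr rfl fun i _ => Finset.sum_congr rfl fun r _ => by ring
      rw [h3, Finset.mul_sum, Finset.mul_sum, Finset.mul_sum, ← Finset.sum_add_distrib,
        ← Finset.sum_add_distrib]
      exact Finset.sum_congr rfl fun i _ => by simp only [hΦ₂]; ring
    have h4 : |∑ r, dd (b r) u x₀ * ∑ i, F i * dd (b i) (dd (b i) (dd (b r) u)) x₀| ≤
        n * (M₁ * (((j + 2 : ℕ) : ℝ) * C * h x₀ ^ j)) := by
      refine (Finset.abs_sum_le_sum_abs _ _).trans ?_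
      refine (Finset.sum_le_card_nsmul _ _ (M₁ * (((j + 2 : ℕ) : ℝ) * C * h x₀ ^ j))
        fun r _ => ?_).trans (le_of_eq (by simp))
      rw [abs_mul]
      gcongr
      · exact (hop (fderiv ℝ u x₀) r).trans hy
      · exact h1 r
    rw [h2]
    have h5 := mul_le_mul_of_nonneg_left (abs_le.1 h4).1 hB.le
    linarith
  · obtain ⟨h₁, h₂, hJ, e1, e2⟩ := equation_jet hΩ hu hx₀ hl hj hpos heq (b o)
    obtain ⟨e3, e4⟩ := hjet (b o) (hb o) h₁ h₂ hJ
    rw [hlo, abs_of_pos hΛ0] at e4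
    refine hcone.fourth_order_ge hj ho (ξ := ξ) (T := T) (Q := Q)
      (U := fun i p => dd (b o) (dd (b i) (dd (b p) u)) x₀) hh hσ hΛ0 e1 ?_ ?_ ?_ rfl e3 e4
    · rw [← e2]
      congr 1
      exact Finset.sum_congr rfl fun i _ => by
        simp only [hQ]; rw [dd_dd_dd_dd_comm hΩ hu (b i) (b o) hx₀]
    · exact fun i p => dd_congr hΩ (dd_comm hΩ (k := 4) hu (by norm_num) _ _) _ hx₀
    · exact fun i => dd_dd_dd_comm hΩ hu (b o) (b i) hx₀
  · rw [pow_succ, mul_comm]; gcongr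
  · exact Real.one_le_rpow hΛ (by positivity)

end MaximumPoint

/-! ### Pointwise consequences of the norm bounds -/

section NormBounds

variable {E : Type*} [NormedAddCommGroup E] [NormedSpace ℝ E] {w : E → ℝ} {S : Set E} {M : ℝ≥0}

theorem bounds_of_c1Norm_le (h : c1Norm w S ≤ M) {x : E} (hx : x ∈ S) :
    |w x| ≤ M ∧ ‖fderiv ℝ w x‖ ≤ M := by
  have h1 : ‖w x‖ₑ ≤ M :=
    ((le_iSup₂ (f := fun x (_ : x ∈ S) => ‖w x‖ₑ) x hx).trans le_self_add).trans h
  have h2 : ‖fderiv ℝ w x‖ₑ ≤ M :=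
    ((le_iSup₂ (f := fun x (_ : x ∈ S) => ‖fderiv ℝ w x‖ₑ) x hx).trans le_add_self).trans h
  rw [enorm_le_coe] at h1 h2
  exact ⟨by exact_mod_cast h1, by exact_mod_cast h2⟩

theorem bounds_of_c11Norm_le (h : c11Norm w S ≤ M) :
    c1Norm w S ≤ M ∧ LipschitzOnWith M (fderiv ℝ w) S := by
  refine ⟨le_self_add.trans h, fun x hx y hy => ?_⟩
  have h1 : edist (fderiv ℝ w x) (fderiv ℝ w y) / edist x y ≤ M := by
    refine le_trans ?_ (le_add_self.trans h)
    exact (le_iSup₂ (f := fun y (_ : y ∈ S) => edist (fderiv ℝ w x) (fderiv ℝ w y) / edist x y)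
      y hy).trans (le_iSup₂ (f := fun x (_ : x ∈ S) => ⨆ y ∈ S,
        edist (fderiv ℝ w x) (fderiv ℝ w y) / edist x y) x hx)
  rcases eq_or_ne x y with rfl | hxy
  · simp
  · rwa [ENNReal.div_le_iff (edist_pos.2 hxy).ne' (edist_ne_top x y)] at h1

end NormBounds

/-! ### Bounds for forms and Hessians by eigenvalues -/

section Forms

variable {n : ℕ} {b : OrthonormalBasis (Fin n) ℝ (EuclideanSpace ℝ (Fin n))} {l : Fin n → ℝ}
  {H : EuclideanSpace ℝ (Fin n) →L[ℝ] EuclideanSpace ℝ (Fin n) →L[ℝ] ℝ}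

theorem form_eq_sum_of_diagonal (hl : formMatrix b H = Matrix.diagonal l)
    (v w : EuclideanSpace ℝ (Fin n)) :
    H v w = ∑ p, inner ℝ (b p) v * inner ℝ (b p) w * l p := by
  rw [form_eq_sum b, hl]
  refine Finset.sum_congr rfl fun p _ => ?_
  rw [Finset.sum_eq_single p]
  · rw [Matrix.diagonal_apply_eq]
  · intro q _ hq
    rw [Matrix.diagonal_apply_ne _ hq.symm, mul_zero]
  · simp

theorem form_le_of_diagonal (hl : formMatrix b H = Matrix.diagonal l) {c : ℝ} (hc : ∀ i, l i ≤ c)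
    (v : EuclideanSpace ℝ (Fin n)) : H v v ≤ c * ‖v‖ ^ 2 := by
  rw [form_eq_sum_of_diagonal hl, ← b.sum_sq_norm_inner_right v, Finset.mul_sum]
  refine Finset.sum_le_sum fun p _ => ?_
  rw [Real.norm_eq_abs, sq_abs, ← sq, mul_comm]
  exact mul_le_mul_of_nonneg_right (hc p) (sq_nonneg _)

theorem abs_form_le_of_diagonal (hl : formMatrix b H = Matrix.diagonal l) {c : ℝ}
    (hc : ∀ i, |l i| ≤ c) {v w : EuclideanSpace ℝ (Fin n)} (hv : ‖v‖ ≤ 1) (hw : ‖w‖ ≤ 1) :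
    |H v w| ≤ n * c := by
  rw [form_eq_sum_of_diagonal hl]
  refine (Finset.abs_sum_le_sum_abs _ _).trans ?_
  refine (Finset.sum_le_card_nsmul _ _ c fun p _ => ?_).trans (le_of_eq (by simp))
  have h1 : ∀ v : EuclideanSpace ℝ (Fin n), ‖v‖ ≤ 1 → |inner ℝ (b p) v| ≤ 1 := fun v hv => by
    have := abs_real_inner_le_norm (b p) v
    rw [b.orthonormal.1 p, one_mul] at this
    exact this.trans hv
  rw [abs_mul, abs_mul]
  calc _ ≤ 1 * 1 * c := by
        gcongr
        exacts [h1 v hv, h1 w hw, hc p]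
    _ = c := by ring

theorem hessianNorm_le {u : EuclideanSpace ℝ (Fin n) → ℝ} {x : EuclideanSpace ℝ (Fin n)}
    (hl : formMatrix b (fderiv ℝ (fderiv ℝ u) x) = Matrix.diagonal l) {c : ℝ}
    (hc : ∀ i, |l i| ≤ c) (hc0 : 0 ≤ c) : hessianNorm u x ≤ n ^ 2 * c := by
  refine Real.sqrt_le_iff.2 ⟨by positivity, ?_⟩
  have h1 : ∀ i j, hessian u x i j ^ 2 ≤ (n * c) ^ 2 := fun i j => by
    refine sq_le_sq.2 ?_
    rw [abs_of_nonneg (by positivity : 0 ≤ n * c)]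
    exact abs_form_le_of_diagonal hl hc (by simp) (by simp)
  calc ∑ i, ∑ j, hessian u x i j ^ 2 ≤ ∑ i : Fin n, ∑ j : Fin n, (n * c) ^ 2 :=
        Finset.sum_le_sum fun i _ => Finset.sum_le_sum fun j _ => h1 i j
    _ = (n ^ 2 * c) ^ 2 := by simp; ring

end Forms

/-! ### Existence of the maximum point -/

section Existence

/-- Existence of a maximum point of Pogorelov's test function. -/
theorem exists_max_point {E : Type*} [NormedAddCommGroup E] [NormedSpace ℝ E] [ProperSpace E]
    {Ω : Set E} (hbdd : Bornology.IsBounded Ω) (hΩ : IsOpen Ω) {w ρ : E → ℝ}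
    (hw : ContinuousOn w (closure Ω)) (hw0 : ∀ x ∈ Ω, 0 ≤ w x) (hwf : ∀ x ∈ frontier Ω, w x = 0)
    {N : E → E →L[ℝ] E →L[ℝ] ℝ} (hN : ContinuousOn N Ω) {H : ℝ}
    (hNH : ∀ x ∈ Ω, ∀ v, ‖v‖ = 1 → N x v v ≤ H) (hρ : ContinuousOn ρ Ω) {r : ℝ}
    (hρr : ∀ x ∈ Ω, ρ x ≤ r) {m : ℕ} (hm : m ≠ 0) {y vy : E} (hy : y ∈ Ω) (hvy : ‖vy‖ = 1)
    (hpos : 0 < w y ^ m * N y vy vy * Real.exp (ρ y)) :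
    ∃ x₀ ∈ Ω, ∃ v₀, ‖v₀‖ = 1 ∧ 0 < w x₀ ∧ ∀ x ∈ Ω, ∀ v,
      w x ^ m * N x v v * Real.exp (ρ x) ≤
        w x₀ ^ m * N x₀ v₀ v₀ * Real.exp (ρ x₀) * ‖v‖ ^ 2 := by
  set P : E × E → ℝ := fun p => w p.1 ^ m * N p.1 p.2 p.2 * Real.exp (ρ p.1) with hP
  set c : ℝ := P (y, vy) with hc
  have hc0 : 0 < c := hpos
  -- Off this set the test function is below its value `c` at the given point. The set avoids the
  -- frontier, where `w = 0`, so it is compact inside `Ω` and continuity of the Hessian form is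
  -- needed only there.
  set K : Set E := closure Ω ∩ {x | c ≤ w x ^ m * (|H| * Real.exp r)} with hK
  have hPle : ∀ x ∈ Ω, ∀ v, ‖v‖ = 1 → P (x, v) ≤ w x ^ m * (|H| * Real.exp r) := by
    intro x hx v hv
    simp only [hP, mul_assoc]
    have h1 := hw0 x hx
    refine mul_le_mul_of_nonneg_left ?_ (by positivity)
    exact mul_le_mul ((hNH x hx v hv).trans (le_abs_self H)) (Real.exp_le_exp.2 (hρr x hx))
      (Real.exp_pos _).le (abs_nonneg H)
  have hKΩ : K ⊆ Ω := by
    rintro x ⟨hx1, hx2⟩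
    by_contra hx
    have : x ∈ frontier Ω := by rw [hΩ.frontier_eq]; exact ⟨hx1, hx⟩
    simp only [mem_ofPred_eq, hwf x this, zero_pow hm, zero_mul] at hx2
    linarith
  have hKc : IsCompact K := by
    refine Metric.isCompact_of_isClosed_isBounded ?_ (hbdd.subset hKΩ)
    have h1 : ContinuousOn (fun x => w x ^ m * (|H| * Real.exp r)) (closure Ω) :=
      (hw.pow m).mul continuousOn_const
    exact h1.preimage_isClosed_of_isClosed isClosed_closure isClosed_Ici
  have hyK : y ∈ K := ⟨subset_closure hy, hPle y hy vy hvy⟩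
  have hPc : ContinuousOn P (K ×ˢ Metric.sphere (0 : E) 1) := by
    have hf : MapsTo Prod.fst (K ×ˢ Metric.sphere (0 : E) 1) Ω := fun p hp => hKΩ hp.1
    have h1 : ContinuousOn (fun p : E × E => w p.1) (K ×ˢ Metric.sphere (0 : E) 1) :=
      (hw.mono subset_closure).comp continuousOn_fst hf
    have h2 : ContinuousOn (fun p : E × E => N p.1) (K ×ˢ Metric.sphere (0 : E) 1) :=
      hN.comp continuousOn_fst hf
    have h3 : ContinuousOn (fun p : E × E => ρ p.1) (K ×ˢ Metric.sphere (0 : E) 1) :=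
      hρ.comp continuousOn_fst hf
    exact ((h1.pow m).mul ((h2.clm_apply continuousOn_snd).clm_apply continuousOn_snd)).mul
      h3.rexp
  obtain ⟨⟨x₀, v₀⟩, hmem, hmax⟩ := (hKc.prod (isCompact_sphere (0 : E) 1)).exists_isMaxOn
    ⟨(y, vy), hyK, by simpa using hvy⟩ hPc
  have hx₀ := hKΩ hmem.1
  have hv₀ : ‖v₀‖ = 1 := by simpa using hmem.2
  have hcP : c ≤ P (x₀, v₀) := hmax (a := (y, vy)) ⟨hyK, by simpa using hvy⟩
  have hunit : ∀ x ∈ Ω, ∀ v, ‖v‖ = 1 → P (x, v) ≤ P (x₀, v₀) := by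
    intro x hx v hv
    by_cases hxK : c ≤ w x ^ m * (|H| * Real.exp r)
    · exact hmax (a := (x, v)) ⟨⟨subset_closure hx, hxK⟩, by simpa using hv⟩
    · exact ((hPle x hx v hv).trans (not_le.1 hxK).le).trans hcP
  refine ⟨x₀, hx₀, v₀, hv₀, ?_, ?_⟩
  · refine lt_of_le_of_ne (hw0 x₀ hx₀) fun h => ?_
    have : P (x₀, v₀) = 0 := by simp only [hP]; rw [← h, zero_pow hm]; ring
    linarith
  · intro x hx v
    rcases eq_or_ne v 0 with rfl | hv
    · simp
    · have hv' : 0 < ‖v‖ := norm_pos_iff.2 hv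
      have h1 := hunit x hx (‖v‖⁻¹ • v) (by rw [norm_smul, norm_inv, norm_norm]; field_simp)
      simp only [hP, map_smul, smul_apply, smul_eq_mul] at h1
      have h2 := mul_le_mul_of_nonneg_right h1 (sq_nonneg ‖v‖)
      refine le_trans (le_of_eq ?_) h2
      field_simp

end Existence

/-! ### From the estimate at the maximum point to a bound of `W^α Λ` -/

section Constants

theorem pointConst_nonneg {n k : ℕ} {A B M M₁ R C c₀ β : ℝ} (hA : 0 ≤ A) (hB : 0 ≤ B) (hM : 0 ≤ M)
    (hM₁ : 0 ≤ M₁) (hR : 0 ≤ R) (hC : 0 ≤ C) (hc₀ : 0 ≤ c₀) (hβ : 0 ≤ β) :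
    0 ≤ pointConst n k A B M M₁ R C c₀ β := by
  unfold pointConst; positivity

/-- The bound for `W ^ m * Λ` that results from the estimate at a maximum point. -/
theorem exists_bound_of_estimate {j m : ℕ} (hm : j + 1 ≤ m) {B M N E P : ℝ} (hB : 0 < B)
    (hE : 0 ≤ E) (hP : 0 ≤ P) :
    ∃ C₀ : ℝ, 0 ≤ C₀ ∧ ∀ W Λ : ℝ, 0 < W → W ≤ M → 0 < Λ →
      (1 ≤ Λ → 1 ≤ W * Λ → N * (m * M / W) ^ 2 ≤ B * Λ ^ 2 →
        W * Λ ^ ((j + 1 : ℕ) : ℝ)⁻¹ ≤ E + P * W) → W ^ m * Λ ≤ C₀ := by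
  rcases lt_or_ge M 0 with hM | hM
  · exact ⟨0, le_rfl, fun W Λ h1 h2 => absurd (h1.trans_le h2) (not_lt.2 hM.le)⟩
  set q : ℝ := Real.sqrt (N * (m * M) ^ 2 / B) with hq
  -- One summand per case: `Λ < 1`; `W Λ < 1`; failure of the largeness condition, which means `W Λ
  -- < q`; and the main estimate raised to the power `j + 1`.
  refine ⟨M ^ m + M ^ (m - 1) + M ^ (m - 1) * q + M ^ (m - (j + 1)) * (E + P * M) ^ (j + 1),
    by positivity, fun W Λ hW hWM hΛ h => ?_⟩
  have t1 : 0 ≤ M ^ m := by positivity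
  have t2 : 0 ≤ M ^ (m - 1) := by positivity
  have t3 : 0 ≤ M ^ (m - 1) * q := by positivity
  have t4 : 0 ≤ M ^ (m - (j + 1)) * (E + P * M) ^ (j + 1) := by positivity
  have hsplit : W ^ m * Λ = W ^ (m - 1) * (W * Λ) := by
    conv_lhs => rw [show m = m - 1 + 1 by omega, pow_succ]
    ring
  have hpow : W ^ (m - 1) ≤ M ^ (m - 1) := by gcongr
  by_cases h1 : 1 ≤ Λ
  · by_cases h2 : 1 ≤ W * Λ
    · by_cases h3 : N * (m * M / W) ^ 2 ≤ B * Λ ^ 2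
      · have h4 := h h1 h2 h3
        have h5 : W * Λ ^ ((j + 1 : ℕ) : ℝ)⁻¹ ≤ E + P * M := h4.trans (by gcongr)
        have h6 : W ^ (j + 1) * Λ ≤ (E + P * M) ^ (j + 1) := by
          have := pow_le_pow_left₀ (by positivity) h5 (j + 1)
          rwa [mul_pow, Real.rpow_inv_natCast_pow hΛ.le (by omega)] at this
        have h7 : W ^ m * Λ = W ^ (m - (j + 1)) * (W ^ (j + 1) * Λ) := by
          rw [← mul_assoc, ← pow_add, Nat.sub_add_cancel hm]
        have h8 : W ^ m * Λ ≤ M ^ (m - (j + 1)) * (E + P * M) ^ (j + 1) := by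
          rw [h7]; gcongr
        linarith
      · have h4 : (W * Λ) ^ 2 ≤ N * (m * M) ^ 2 / B := by
          rw [le_div_iff₀ hB]
          have h5 := (mul_lt_mul_of_pos_right (not_le.1 h3) (by positivity : 0 < W ^ 2)).le
          have h6 : N * (m * M / W) ^ 2 * W ^ 2 = N * (m * M) ^ 2 := by field_simp
          rw [h6] at h5
          linarith
        have h5 : W * Λ ≤ q := Real.le_sqrt_of_sq_le h4
        have h8 : W ^ m * Λ ≤ M ^ (m - 1) * q := by rw [hsplit]; gcongr
        linarith
    · have h8 : W ^ m * Λ ≤ M ^ (m - 1) * 1 := by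
        rw [hsplit]; gcongr; exact (not_le.1 h2).le
      linarith
  · have h8 : W ^ m * Λ ≤ M ^ m * 1 := by gcongr; exact (not_le.1 h1).le
    linarith

end Constants

/-! ### Reduction of the hypotheses to the pointwise estimates -/

section Main

open Filter Topology

variable {n : ℕ} {Ω : Set (EuclideanSpace ℝ (Fin n))} {u : EuclideanSpace ℝ (Fin n) → ℝ}
  {f : EuclideanSpace ℝ (Fin n) → ℝ → ℝ} {M₁ M₃ : ℝ≥0}

theorem graph_mem (hM₁ : ∀ x ∈ Ω, |u x| ≤ M₁) {x : EuclideanSpace ℝ (Fin n)} (hx : x ∈ Ω) :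
    (x, u x) ∈ Ω ×ˢ Icc (sInf (u '' Ω)) (sSup (u '' Ω)) := by
  refine ⟨hx, csInf_le ⟨-M₁, ?_⟩ (mem_image_of_mem u hx), le_csSup ⟨M₁, ?_⟩ (mem_image_of_mem u hx)⟩
  · rintro _ ⟨y, hy, rfl⟩; exact (abs_le.1 (hM₁ y hy)).1
  · rintro _ ⟨y, hy, rfl⟩; exact (abs_le.1 (hM₁ y hy)).2

theorem RootIsC11.differentiableAt {k : ℕ} (hΩ : IsOpen Ω) (hf : RootIsC11 k f Ω)
    {p : EuclideanSpace ℝ (Fin n) × ℝ} (hp : p.1 ∈ Ω) : DifferentiableAt ℝ (rootRHS k f) p := by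
  have h1 := (hf (|p.2| + 1) (by positivity)).1
  refine (h1.contDiffAt ((hΩ.prod isOpen_Ioo).mem_nhds ⟨hp, ?_⟩)).differentiableAt one_ne_zero
  exact abs_lt.1 (lt_add_one _)

/-- Bounds for the derivatives of `f^{1/(k-1)}(x, u(x))`. -/
theorem root_jet_bounds {k : ℕ} (hΩ : IsOpen Ω) (hu : ContDiffOn ℝ 4 u Ω)
    (hf : RootIsC11 k f Ω) (hM₁ : c1Norm u Ω ≤ M₁)
    (hM₃ : c11Norm (rootRHS k f) (Ω ×ˢ Icc (sInf (u '' Ω)) (sSup (u '' Ω))) ≤ M₃)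
    {x : EuclideanSpace ℝ (Fin n)} (hx : x ∈ Ω) {v : EuclideanSpace ℝ (Fin n)} (hv : ‖v‖ = 1)
    {a h₁ h₂ : ℝ} (h : J2 (fun t => rootRHS k f (x + t • v, u (x + t • v))) a h₁ h₂) :
    |h₁| ≤ M₃ * (1 + M₁) ^ 2 ∧
      |h₂| ≤ M₃ * (1 + M₁) ^ 2 * (1 + |fderiv ℝ (fderiv ℝ u) x v v|) := by
  have hub := fun y hy => (bounds_of_c1Norm_le hM₁ (x := y) hy)
  obtain ⟨hc1, hlip⟩ := bounds_of_c11Norm_le hM₃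
  have hnhds : ∀ᶠ t in 𝓝 (0 : ℝ), x + t • v ∈ Ω := by
    have : ContinuousAt (fun t : ℝ => x + t • v) 0 := by fun_prop
    exact this.eventually (hΩ.mem_nhds (by simpa using hx))
  have hline : ∀ t : ℝ, HasDerivAt (fun t : ℝ => x + t • v) v t := fun t => by
    simpa using ((hasDerivAt_id t).smul_const v).const_add x
  have hdu : ∀ (g : EuclideanSpace ℝ (Fin n) → ℝ), DifferentiableOn ℝ g Ω → ∀ t : ℝ,
      x + t • v ∈ Ω → HasDerivAt (fun t : ℝ => g (x + t • v)) (dd v g (x + t • v)) t :=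
    fun g hg t ht => (hg.differentiableAt (hΩ.mem_nhds ht)).hasFDerivAt.comp_hasDerivAt t (hline t)
  have hu4 : ContDiffOn ℝ (4 : ℕ) u Ω := hu
  have hd1 := (contDiffOn_dd hΩ (m := 3) hu4 (by norm_num) v).differentiableOn (by norm_num)
  -- The curve is the graph of `u` over the line. Its velocity is bounded by `1 + M₁`, and `D²u`
  -- enters only through its acceleration, hence linearly.
  have key := J2.bounds_of_lipschitz (γ := fun t => (x + t • v, u (x + t • v)))
    (γ' := fun t => (v, dd v u (x + t • v))) (γ'' := (0, dd v (dd v u) x))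
    (fun p hp => hf.differentiableAt hΩ hp.1) (fun p hp => (bounds_of_c1Norm_le hc1 hp).2) hlip
    (by filter_upwards [hnhds] with t ht using graph_mem (fun y hy => (hub y hy).1) ht)
    (by
      filter_upwards [hnhds] with t ht
      exact (hline t).prodMk (hdu u (hu.differentiableOn (by norm_num)) t ht))
    (by
      have := hdu _ hd1 0 (by simpa using hx)
      simp only [zero_smul, add_zero] at this
      exact (hasDerivAt_const _ _).prodMk this) h
  have hn1 : ‖(v, dd v u (x + (0 : ℝ) • v))‖ ≤ 1 + M₁ := by
    rw [Prod.norm_def, zero_smul, add_zero, hv]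
    refine max_le (by simp) ?_
    have := (fderiv ℝ u x).le_opNorm v
    rw [hv, mul_one] at this
    exact (this.trans (hub x hx).2).trans (by simp)
  have hn2 : ‖((0 : EuclideanSpace ℝ (Fin n)), dd v (dd v u) x)‖ =
      |fderiv ℝ (fderiv ℝ u) x v v| := by
    rw [Prod.norm_def, norm_zero, max_eq_right (norm_nonneg _),
      dd_dd_eq hΩ (hu.of_le (by norm_num)) hx, Real.norm_eq_abs]
  have h1M : (1 : ℝ) ≤ 1 + M₁ := by simp
  have hsq : (1 : ℝ) + M₁ ≤ (1 + M₁) ^ 2 := by nlinarith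
  refine ⟨key.1.trans (by gcongr; exact hn1.trans hsq), key.2.trans ?_⟩
  rw [hn2]
  have h3 : (M₃ : ℝ) * ‖(v, dd v u (x + (0 : ℝ) • v))‖ ^ 2 ≤ M₃ * (1 + M₁) ^ 2 := by gcongr
  have h4 : (M₃ : ℝ) * |fderiv ℝ (fderiv ℝ u) x v v| ≤
      M₃ * (1 + M₁) ^ 2 * |fderiv ℝ (fderiv ℝ u) x v v| := by
    gcongr
    exact le_mul_of_one_le_right (by positivity) (h1M.trans hsq)
  linarith

theorem MemCUpTo.exists_hessian_bound (hbdd : Bornology.IsBounded Ω) (hu : MemCUpTo 4 u Ω) :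
    ∃ H : ℝ, ∀ x ∈ Ω, ∀ v, ‖v‖ = 1 → fderiv ℝ (fderiv ℝ u) x v v ≤ H := by
  obtain ⟨g, hg, hgu⟩ := hu.2.2 2 (by norm_num)
  obtain ⟨H, hH⟩ := hbdd.isCompact_closure.exists_bound_of_continuousOn hg
  refine ⟨H, fun x hx v hv => ?_⟩
  have h1 := (g x).le_opNorm fun _ => v
  rw [← hgu hx, iteratedFDeriv_two_apply] at h1
  simp only [hv, Finset.prod_const_one, mul_one] at h1
  refine (le_abs_self _).trans (h1.trans ?_)
  rw [hgu hx]
  exact hH x (subset_closure hx)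

theorem rootRHS_pow {j : ℕ} {x : EuclideanSpace ℝ (Fin n)} {z : ℝ} (h : 0 < f x z) :
    rootRHS (j + 2) f (x, z) ^ (j + 1) = f x z := by
  rw [rootRHS, show (((j + 2 : ℕ) : ℝ) - 1) = ((j + 1 : ℕ) : ℝ) by push_cast; ring, one_div]
  exact Real.rpow_inv_natCast_pow h.le (by omega)

/-- Eigenvectors and sorted eigenvalues of `D²u` for a `k`-convex solution. -/
theorem exists_eigenbasis_hessian {k : ℕ} (hk : 1 ≤ k) (hΩ : IsOpen Ω) (hu : ContDiffOn ℝ 4 u Ω)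
    (hconv : IsKConvexOn k u Ω) {x : EuclideanSpace ℝ (Fin n)} (hx : x ∈ Ω)
    (hpos : 0 < sigma k (eigenvalues (hessian u x))) :
    ∃ (b : OrthonormalBasis (Fin n) ℝ (EuclideanSpace ℝ (Fin n))) (l : Fin n → ℝ),
      Antitone l ∧ formMatrix b (fderiv ℝ (fderiv ℝ u) x) = Matrix.diagonal l ∧
        Cone Finset.univ k l := by
  obtain ⟨b, l, τ, h1, h2, h3⟩ := exists_eigenbasis (hessian_eq_formMatrix x)
    (fderiv_fderiv_symm hΩ (hu.of_le (by norm_num)) hx)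
  exact ⟨b, l, h1, h3, h2 ▸ (mem_cone_of_mem_closure hk (hconv x hx) hpos).comp_perm τ⟩

theorem weight_bounds {A B M₁ R : ℝ} (hA : 0 ≤ A) (hB : 0 ≤ B) (hBM : 8 * B * M₁ ^ 2 ≤ 1)
    (hAR : 8 * A * R ^ 2 ≤ 1) {x z : EuclideanSpace ℝ (Fin n)} (hy : ‖fderiv ℝ u x‖ ≤ M₁)
    (hR : ‖x - z‖ ≤ R) : 0 ≤ weight A B z u x ∧ weight A B z u x ≤ 1 := by
  unfold weight
  refine ⟨by positivity, ?_⟩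
  have h1 : B / 2 * ‖fderiv ℝ u x‖ ^ 2 ≤ B / 2 * M₁ ^ 2 := by gcongr
  have h2 : A / 2 * ‖x - z‖ ^ 2 ≤ A / 2 * R ^ 2 := by gcongr
  linarith

end Main

end HessianPogorelov

end

/-! ### Proof of the theorem -/

theorem theorem3p1 (n k : ℕ) (hk : 2 ≤ k) (hkn : k ≤ n) (R M₁ M₂ M₃ : ℝ≥0) :
    ∃ C : ℝ, ∀ (Ω : Set (EuclideanSpace ℝ (Fin n)))
      (f : EuclideanSpace ℝ (Fin n) → ℝ → ℝ) (φ u ubar : EuclideanSpace ℝ (Fin n) → ℝ),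
      IsOpen Ω → IsConnected Ω → Bornology.IsBounded Ω →
      (∀ x ∈ Ω, ∀ z : ℝ, 0 < f x z) →
      HessianPogorelov.RootIsC11 k f Ω →
      HessianPogorelov.MemC11 ubar Ω →
      HessianPogorelov.IsKConvexAEOn k ubar Ω →
      HessianPogorelov.MemCUpTo 4 u Ω →
      HessianPogorelov.IsKConvexOn k u Ω →
      HessianPogorelov.SolvesDirichlet k f φ u Ω →
      (∀ x ∈ Ω, u x ≤ ubar x) →
      (∀ x ∈ frontier Ω, ubar x = u x) →
      Metric.diam Ω ≤ R →
      HessianPogorelov.c1Norm u Ω ≤ M₁ →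
      HessianPogorelov.c11Norm ubar Ω ≤ M₂ →
      HessianPogorelov.c11Norm (HessianPogorelov.rootRHS k f)
        (Ω ×ˢ Set.Icc (sInf (u '' Ω)) (sSup (u '' Ω))) ≤ M₃ →
      ∀ x ∈ Ω, (ubar x - u x) ^ HessianPogorelov.pogorelovExponent k *
        HessianPogorelov.hessianNorm u x ≤ C := by
  obtain ⟨j, rfl⟩ : ∃ j, k = j + 2 := ⟨k - 2, by omega⟩
  set m := HessianPogorelov.pogorelovExponent (j + 2) with hm
  -- The exponent is used only through these two lower bounds: `2` for absorbing third order terms,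
  -- `k - 1` for the final power.
  have hm2 : 2 ≤ m := by simp only [hm, HessianPogorelov.pogorelovExponent]; split_ifs <;> omega
  have hmj : j + 1 ≤ m := by simp only [hm, HessianPogorelov.pogorelovExponent]; split_ifs <;> omega
  obtain ⟨c₀, hc₀, hgrad⟩ := HessianPogorelov.exists_gradient_lower_bound hkn
  set A : ℝ := 1 / (8 * ((R : ℝ) ^ 2 + 1)) with hA
  set B : ℝ := 1 / (8 * ((M₁ : ℝ) ^ 2 + 1)) with hB
  have hA0 : 0 < A := by positivity
  have hB0 : 0 < B := by positivity
  have hAR : 8 * A * (R : ℝ) ^ 2 ≤ 1 := by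
    rw [hA, show 8 * (1 / (8 * ((R : ℝ) ^ 2 + 1))) * (R : ℝ) ^ 2 = R ^ 2 / (R ^ 2 + 1) by
      field_simp, div_le_one (by positivity)]
    linarith
  have hBM : 8 * B * (M₁ : ℝ) ^ 2 ≤ 1 := by
    rw [hB, show 8 * (1 / (8 * ((M₁ : ℝ) ^ 2 + 1))) * (M₁ : ℝ) ^ 2 = M₁ ^ 2 / (M₁ ^ 2 + 1) by
      field_simp, div_le_one (by positivity)]
    linarith
  set M : ℝ := M₂ + M₁ with hM
  set C : ℝ := M₃ * (1 + M₁) ^ 2 with hC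
  set P : ℝ := HessianPogorelov.pointConst n (j + 2) A B M M₁ R C c₀ m with hP
  have hP0 : 0 ≤ P := HessianPogorelov.pointConst_nonneg hA0.le hB0.le (by positivity)
    (by positivity) (by positivity) (by positivity) hc₀.le (by positivity)
  obtain ⟨C₀, hC₀, hbound⟩ := HessianPogorelov.exists_bound_of_estimate (j := j) (m := m)
    (M := M) (N := 980 * n) (E := 2 / A * (m * (j + 2 : ℕ) * C)) (P := 2 / A * P) hmj hB0
    (by positivity) (by positivity)
  -- `n²` passes from eigenvalues to the Frobenius norm, one more `n` from the largest eigenvalue to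
  -- all absolute values, and `exp 1` bounds the weight factor, which lies between `1` and `exp 1`.
  refine ⟨n ^ 3 * (C₀ * Real.exp 1), ?_⟩
  intro Ω f φ u ubar hΩ hconn hbdd hfpos hroot hubar hubconv hu huconv hsol hle hfront hdiam hM₁
    hM₂ hM₃ y hy
  have hu4 : ContDiffOn ℝ 4 u Ω := hu.1
  obtain ⟨z, hz⟩ := hconn.nonempty
  have hub := fun x hx => HessianPogorelov.bounds_of_c1Norm_le hM₁ (x := x) hx
  obtain ⟨hM₂', hlip⟩ := HessianPogorelov.bounds_of_c11Norm_le hM₂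
  have hubb := fun x hx => HessianPogorelov.bounds_of_c1Norm_le hM₂' (x := x) hx
  have hzR : ∀ x ∈ Ω, ‖x - z‖ ≤ R := fun x hx => by
    rw [← dist_eq_norm]; exact (Metric.dist_le_diam_of_mem hbdd hx hz).trans hdiam
  have hweight := fun x hx => HessianPogorelov.weight_bounds hA0.le hB0.le hBM hAR (hub x hx).2
    (hzR x hx)
  have hdiff : ∀ x ∈ Ω, DifferentiableAt ℝ ubar x := fun x hx =>
    (hubar.1.contDiffAt (hΩ.mem_nhds hx)).differentiableAt one_ne_zero
  have hσpos : ∀ x ∈ Ω, 0 < HessianPogorelov.sigma (j + 2)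
      (HessianPogorelov.eigenvalues (HessianPogorelov.hessian u x)) := fun x hx => by
    rw [hsol.1 x hx]; exact hfpos x hx _
  have ho : 0 < n := by omega
  set o : Fin n := ⟨0, ho⟩ with hodef
  have htop : ∀ l : Fin n → ℝ, Antitone l → ∀ i, l i ≤ l o := fun l hl i =>
    hl (Fin.le_def.2 (Nat.zero_le _))
  obtain ⟨b, l, hanti, hl, hcone⟩ := HessianPogorelov.exists_eigenbasis_hessian (by omega) hΩ hu4
    huconv hy (hσpos y hy)
  have hlo := hcone.leading_pos (htop l hanti)
  have hly : fderiv ℝ (fderiv ℝ u) y (b o) (b o) = l o := by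
    have : HessianPogorelov.formMatrix b (fderiv ℝ (fderiv ℝ u) y) o o = l o := by
      rw [hl, Matrix.diagonal_apply_eq]
    exact this
  have hw0 : 0 ≤ ubar y - u y := sub_nonneg.2 (hle y hy)
  suffices hmain : (ubar y - u y) ^ m * l o ≤ C₀ * Real.exp 1 by
    have h1 : HessianPogorelov.hessianNorm u y ≤ n ^ 2 * (n * l o) := by
      refine HessianPogorelov.hessianNorm_le hl (fun i => abs_le.2 ⟨?_, ?_⟩) (by positivity)
      · linarith [hcone.sub_le (htop l hanti) i]
      · exact (htop l hanti i).trans (le_mul_of_one_le_left hlo.le (by exact_mod_cast ho))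
    calc _ ≤ (ubar y - u y) ^ m * (n ^ 2 * (n * l o)) := by gcongr
      _ = n ^ 3 * ((ubar y - u y) ^ m * l o) := by ring
      _ ≤ _ := by gcongr
  rcases hw0.eq_or_lt with hw | hw
  · rw [← hw, zero_pow (by omega), zero_mul]; positivity
  obtain ⟨H, hH⟩ := hu.exists_hessian_bound hbdd
  have hd1 : ContDiffOn ℝ 3 (fderiv ℝ u) Ω := hu4.fderiv_of_isOpen hΩ (by norm_num)
  have hd2 : ContDiffOn ℝ 2 (fderiv ℝ (fderiv ℝ u)) Ω := hd1.fderiv_of_isOpen hΩ (by norm_num)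
  obtain ⟨x₀, hx₀, v₀, hv₀, hW, hmax⟩ := HessianPogorelov.exists_max_point hbdd hΩ
    (w := fun x => ubar x - u x) (ρ := HessianPogorelov.weight A B z u) (m := m)
    (hubar.2.1.sub hu.2.1) (fun x hx => sub_nonneg.2 (hle x hx))
    (fun x hx => sub_eq_zero.2 (hfront x hx)) hd2.continuousOn hH
    (fun x hx => (HessianPogorelov.contDiffAt_weight hΩ hu4 hx A B z).continuousAt.continuousWithinAt)
    (fun x hx => (hweight x hx).2) (by omega) hy (b.orthonormal.1 o)
    (by rw [hly]; positivity)
  obtain ⟨b', l', hanti', hl', hcone'⟩ := HessianPogorelov.exists_eigenbasis_hessian (by omega) hΩ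
    hu4 huconv hx₀ (hσpos x₀ hx₀)
  have hlo' := hcone'.leading_pos (htop l' hanti')
  have hmax' : ∀ x ∈ Ω, ∀ v, (ubar x - u x) ^ m * fderiv ℝ (fderiv ℝ u) x v v *
      Real.exp (HessianPogorelov.weight A B z u x) ≤ (ubar x₀ - u x₀) ^ m * l' o *
        Real.exp (HessianPogorelov.weight A B z u x₀) * ‖v‖ ^ 2 := fun x hx v => by
    refine (hmax x hx v).trans ?_
    -- The maximizing direction may be replaced by the leading eigenvector at `x₀`, which can only
    -- increase the right-hand side.
    have := HessianPogorelov.form_le_of_diagonal hl' (htop l' hanti') v₀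
    rw [hv₀, one_pow, mul_one] at this
    gcongr
  have hest : (ubar x₀ - u x₀) ^ m * l' o ≤ C₀ := by
    refine hbound _ _ hW ?_ hlo' fun h1 h2 h3 => ?_
    · have e1 := (abs_le.1 (hubb x₀ hx₀).1).2
      have e2 := (abs_le.1 (hub x₀ hx₀).1).1
      rw [hM]; linarith
    · have hhpos : ∀ x ∈ Ω, 0 < HessianPogorelov.rootRHS (j + 2) f (x, u x) := fun x hx =>
        Real.rpow_pos_of_pos (hfpos x hx _) _
      have key := HessianPogorelov.max_point_estimate hkn hc₀ hgrad hΩ hu4 hx₀ hl' hanti' hcone'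
        (o := o) rfl (h := fun x => HessianPogorelov.rootRHS (j + 2) f (x, u x)) (C := C)
        hhpos (fun x hx => by
          rw [HessianPogorelov.rootRHS_pow (hfpos x hx _), hsol.1 x hx])
        ?_ (fun v hv h₁ h₂ hJ => HessianPogorelov.root_jet_bounds hΩ hu4 hroot hM₁ hM₃ hx₀ hv hJ)
        (D := M₂) (K := M₂) hdiff (fun x hx => by exact_mod_cast (hubb x hx).2) hlip hubconv
        (M := M) (M₁ := M₁) (R := R) hA0 hB0 hm2 hBM hAR (hub x₀ hx₀).2 ?_ (hzR x₀ hx₀) hW hmax'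
        h1 h2 h3
      · rw [← hP] at key
        linarith
      · have e1 := (HessianPogorelov.bounds_of_c1Norm_le
          (HessianPogorelov.bounds_of_c11Norm_le hM₃).1
          (HessianPogorelov.graph_mem (fun x hx => (hub x hx).1) hx₀)).1
        refine ((le_abs_self _).trans e1).trans ?_
        have : (1 : ℝ) ≤ (1 + M₁) ^ 2 := one_le_pow₀ (by simp)
        exact le_mul_of_one_le_right (by positivity) this
      · exact (norm_sub_le _ _).trans (add_le_add (hubb x₀ hx₀).2 (hub x₀ hx₀).2)
  have hfin := hmax' y hy (b o)
  rw [hly, b.orthonormal.1 o, one_pow, mul_one] at hfin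
  calc (ubar y - u y) ^ m * l o = (ubar y - u y) ^ m * l o * 1 := (mul_one _).symm
    _ ≤ (ubar y - u y) ^ m * l o * Real.exp (HessianPogorelov.weight A B z u y) := by
        gcongr; exact Real.one_le_exp (hweight y hy).1
    _ ≤ _ := hfin
    _ ≤ C₀ * Real.exp 1 := by gcongr; exact (hweight x₀ hx₀).2
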